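/- Let $F/F_0$ be an unramified quadratic extension of $p$-adic local fields ($p=2$ allowed), with Galois involution $x\mapsto\bar x$, normalized valuation $v$, and let $\eta(x)=(-1)^{v(x)}$ on $F^\times$. **Setting.** Let $V$ be a finite-dimensional nondegenerate $F/F_0$-hermitian space and $L=\bigoplus_i O_Fe_i\subset V$ a lattice with a chosen orthogonal basis. Put $V_0=\bigoplus_i F_0e_i$, let $\bar{\ }$ be the induced conjugation on $V$ and $\mathrm{End}(V)$, and $S(V_0)=\{\gamma\in \mathrm{GL}(V):\gamma\bar\gamma=1\}$. Put $L^\vee=\{x\in V:(x,L)\subseteq O_F\}$, $L_0=L\cap V_0$, $L_0^\vee=L^\vee\cap V_0$, $L_0^{\vee*}=\{l\in V_0^*: l(L_0^\vee)\subseteq O_{F_0}\}$, and let $S(L_0,L_0^\vee)\subset S(V_0)$, resp. $\mathrm{GL}(L_0,L_0^\vee)\subset\mathrm{GL}(V_0)$, be the subset of elements that stabilize $L$ and $L^\vee$, resp. $L_0$ and $L_0^\vee$. A point of a space with a group action is regular semisimple (rs) if its stabilizer is trivial and its orbit is closed. *Semi-Lie transfer conjecture for $L$.* The group $\mathrm U(V)$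 acts on $\mathrm U(V)\times V$ by $h.(g,u)=(h^{-1}gh,h^{-1}u)$, and $\mathrm{GL}(V_0)$ acts on $S(V_0)\times V_0\times V_0^*$ by $h.(\gamma,u_1,u_2)=(h^{-1}\gamma h,h^{-1}u_1,u_2h)$. Give $\mathrm U(V)$ and $\mathrm{GL}(V_0)$ the Haar measures with $\mathrm{vol}\,\mathrm U(L)=\mathrm{vol}\,\mathrm{GL}(L_0,L_0^\vee)=1$, and put $$\mathrm{Orb}((g,u),f)=\int_{\mathrm U(V)} f(h.(g,u))\,dh,\qquad \mathrm{Orb}((\gamma,u_1,u_2),f')=\eta\bigl(\det(\gamma^iu_1)_{i=0}^{\dim V-1}\bigr)\int_{\mathrm{GL}(V_0)}f'(h.(\gamma,u_1,u_2))\,\eta(\det h)\,dh,$$ the determinant $\det(\gamma^i u_1)$ being taken with respect to the basis $(e_i)$ of $L$. An rs $(g,u)$ matches an rs $(\gamma,u_1,u_2)$ if $(g,u,x\mapsto(x,u))$ and $(\gamma,u_1,u_2)$ are conjugate under $\mathrm{GL}(V)$. Functions $f,f'$ are transfers of each other if for every rs $(\gamma,u_1,u_2)$ one has $\mathrm{Orb}((\gamma,u_1,u_2),f')=\mathrm{Orb}((g,u),f)$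 whenever $(\gamma,u_1,u_2)$ matches some rs $(g,u)\in \mathrm U(V)\times V$, and $\mathrm{Orb}((\gamma,u_1,u_2),f')=0$ if it matches none. The conjecture is the assertion that $1_{\mathrm U(L)}\times1_L$ and $1_{S(L_0,L_0^\vee)}\times1_{L_0}\times1_{L_0^{\vee*}}$ are transfers of each other. *Group transfer conjecture for $(L,e_L)$.* Let $V=V^\flat\oplus Fe$ be an orthogonal decomposition with $(e,e)\in F_0^\times$, let $e_L=\lambda_Le$ with $\lambda_L\in F_0^\times$, and let $L=L^\flat\oplus O_Fe_L$, with an orthogonal basis $(e_1,\dots,e_{n-1})$ of $L^\flat\subset V^\flat$ extended by $e_L$ to one of $L$. Now $\mathrm U(V^\flat)$ and $\mathrm{GL}(V_0^\flat)$ act by conjugation on $\mathrm U(V)$ and $S(V_0)$, the Haar measures are normalized by $\mathrm U(L^\flat)$ and $\mathrm{GL}(L_0^\flat,L_0^{\flat,\vee})$, rs $g\in \mathrm U(V)$ and $\gamma\in S(V_0)$ match if they are conjugate under $\mathrm{GL}(V^\flat)$, the transfer factor is $\eta(\det(\gamma^ie_L)_{i=0}^{n-1})$ with respect to the basis of $L$,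 and transfers are defined as before. The conjecture is the assertion that $1_{\mathrm U(L)}$ and $1_{S(L_0,L_0^\vee)}$ are transfers of each other with respect to $(L,e_L)$. A lattice $M=M^\flat\oplus O_Fe_M$ satisfies the reduction if $v((e_M,e_M))=\min_{x,y\in M}v((x,y))$. Write $L^\vee=L^{\flat,\vee}\oplus O_Fe_{L^\vee}$ with $e_{L^\vee}=e_L/(e_L,e_L)=\lambda_{L^\vee}e$, so that $\lambda_{L^\vee}=((e,e)\lambda_L)^{-1}$; use on it the dual basis $e_i/(e_i,e_i)$, $e_{L^\vee}$. **Theorem.** 1. If $L$ satisfies the reduction, then the group transfer conjecture for $(L,e_L)$ is equivalent to the semi-Lie transfer conjecture for $\lambda_L^{-1}L^\flat$. 2. If $L^\vee$ satisfies the reduction, then the group transfer conjecture for $(L^\vee,e_{L^\vee})$ is equivalent to the semi-Lie transfer conjecture for $L_{\rm new}=\lambda_{L^\vee}^{-1}L^{\flat,\vee}$. In terms of $L$: with the sign $\varepsilon_L=\eta\bigl(\prod_{i=1}^{n-1}(e_i,e_i)(e_L,e_L)\bigr)$, by which the transfer factors of $(L^\vee,e_{L^\vee})$ and $(L,e_L)$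 differ, the functions $1_{\mathrm U(L)}$ and $\varepsilon_L\,1_{S(L_0,L_0^\vee)}$ are transfers of each other with respect to $(L,e_L)$ if and only if the semi-Lie transfer conjecture for $L_{\rm new}$ holds. In particular, if $\varepsilon_L=1$, then the group transfer conjecture for $(L,e_L)$ is equivalent to the semi-Lie transfer conjecture for $L_{\rm new}$. -/

import Mathlib

open MeasureTheory

set_option linter.unusedSectionVars false

noncomputable section

namespace JacquetRallis

/-! ### Local fields -/

section Fields

/-- The ring of integers `O_K = {x : ‖x‖ ≤ 1}` of a nonarchimedean normed field. -/
def integers (K : Type*) [NormedField K] [IsUltrametricDist K] : Subring K :=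
  (NormedField.valuation (K := K)).integer

/-- `ϖ` is a uniformizer: its norm is the largest value of the norm that is `< 1`. -/
def IsUniformizer {K : Type*} [NormedField K] (ϖ : K) : Prop :=
  IsGreatest {r : ℝ | ∃ y : K, ‖y‖ = r ∧ r < 1} ‖ϖ‖

open Classical in
/-- The normalized valuation `v : Kˣ → ℤ`: the integer `m` with `‖x‖ = ‖ϖ‖ ^ m`, where `ϖ` is a
uniformizer (with value `0` at `x = 0`, which is never used). -/
def ord {K : Type*} [NormedField K] (x : K) : ℤ :=
  if h : ∃ m : ℤ, ∃ ϖ : K, IsUniformizer ϖ ∧ ‖x‖ = ‖ϖ‖ ^ m then h.choose else 0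

open Classical in
/-- The character `η(x) = (-1)^{v(x)}` of `Kˣ`, extended by `η(0) = 0`. -/
def eta {K : Type*} [NormedField K] (x : K) : ℂ :=
  if x = 0 then 0 else (-1 : ℂ) ^ ord x

/-- The extension `F/F₀` is unramified, i.e. of ramification index one: every value of the norm
on `F` is already a value on `F₀` (residue fields are finite here, hence perfect). -/
def IsUnramified (F₀ F : Type*) [NormedField F₀] [NormedField F] : Prop :=
  ∀ x : F, ∃ y : F₀, ‖y‖ = ‖x‖

end Fields

/-! ### Topology of `GL(V)` and normalized Haar integrals -/

section Topology

/-- Finite-dimensional spaces of linear maps carry their canonical topology as `F`-vector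
spaces. The topology of `GL(V)` is the one of the units of `End(V)`. -/
instance linearMapTopology {F V W : Type*} [Field F] [TopologicalSpace F] [AddCommGroup V]
    [Module F V] [AddCommGroup W] [Module F W] : TopologicalSpace (V →ₗ[F] W) :=
  moduleTopology F (V →ₗ[F] W)

instance linearMapIsModuleTopology {F V W : Type*} [Field F] [TopologicalSpace F]
    [AddCommGroup V] [Module F V] [AddCommGroup W] [Module F W] :
    IsModuleTopology F (V →ₗ[F] W) := ⟨rfl⟩

/-- A finite-dimensional space with the module topology is homeomorphic to `Fⁿ`. -/
theorem isHomeomorph_equivFun {F E : Type*} [NontriviallyNormedField F] [AddCommGroup E]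
    [Module F E] [TopologicalSpace E] [IsModuleTopology F E] [FiniteDimensional F E] :
    Nonempty (E ≃ₜ (Fin (Module.finrank F E) → F)) := by
  have := IsModuleTopology.toContinuousAdd F E
  refine ⟨⟨(Module.finBasis F E).equivFun.toEquiv, ?_, ?_⟩⟩
  · exact IsModuleTopology.continuous_of_linearMap (R := F)
      (Module.finBasis F E).equivFun.toLinearMap
  · exact IsModuleTopology.continuous_of_linearMap (R := F)
      (Module.finBasis F E).equivFun.symm.toLinearMap

variable {F V : Type*} [NontriviallyNormedField F] [AddCommGroup V] [Module F V]
  [FiniteDimensional F V]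

instance endTopologicalRing : IsTopologicalRing (V →ₗ[F] V) :=
  IsModuleTopology.isTopologicalRing F (Module.End F V)

instance glTopologicalGroup : IsTopologicalGroup (LinearMap.GeneralLinearGroup F V) := by
  have : ContinuousMul (Module.End F V) := (endTopologicalRing (F := F) (V := V)).toContinuousMul
  exact inferInstanceAs (IsTopologicalGroup (Module.End F V)ˣ)

instance glLocallyCompact [LocallyCompactSpace F] :
    LocallyCompactSpace (LinearMap.GeneralLinearGroup F V) := by
  have : ContinuousMul (Module.End F V) := (endTopologicalRing (F := F) (V := V)).toContinuousMul
  obtain ⟨e⟩ := isHomeomorph_equivFun (F := F) (E := V →ₗ[F] V)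
  have : LocallyCompactSpace (Module.End F V) := e.isClosedEmbedding.locallyCompactSpace
  have : T2Space (Module.End F V) := e.symm.t2Space
  exact inferInstanceAs (LocallyCompactSpace (Module.End F V)ˣ)

/-- `∫_G φ(h) dh` for the Haar measure on `G` that gives `K` the volume `1`. -/
def haarIntegral {G : Type*} [Group G] [TopologicalSpace G] [IsTopologicalGroup G]
    [LocallyCompactSpace G] (K : Set G) (φ : G → ℂ) : ℂ :=
  letI : MeasurableSpace G := borel G
  haveI : BorelSpace G := ⟨rfl⟩
  ∫ h, φ h ∂(((Measure.haar : Measure G) K)⁻¹ • (Measure.haar : Measure G))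

end Topology

/-! ### Regular semisimple elements -/

/-- A point `x` of a space `X` with an action `k ↦ (act k x)` of a group `G` is regular semisimple
if its stabilizer is trivial and its orbit is closed (for the `p`-adic topology). -/
def IsRegSemisimple {G X : Type*} [Group G] [TopologicalSpace X] (act : G → X → X) (x : X) :
    Prop :=
  (∀ k : G, act k x = x → k = 1) ∧ IsClosed (Set.range fun k : G => act k x)

/-! ### Hermitian spaces and lattices -/

section Hermitian

variable {F₀ F : Type*} [NontriviallyNormedField F₀] [IsUltrametricDist F₀]
  [LocallyCompactSpace F₀] [NontriviallyNormedField F] [IsUltrametricDist F]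
  [LocallyCompactSpace F] [NormedAlgebra F₀ F] [Algebra.IsQuadraticExtension F₀ F]
  {σ : F ≃ₐ[F₀] F} {V : Type*} [AddCommGroup V] [Module F V]

/-- Sesquilinear forms `(x, y)` on `V`, linear in `x` and conjugate linear in `y`. -/
abbrev SesqForm (σ : F ≃ₐ[F₀] F) (V : Type*) [AddCommGroup V] [Module F V] :=
  V →ₗ[F] V →ₛₗ[(σ : F →+* F)] F

/-- The form is hermitian. -/
def IsHermitian (h : SesqForm σ V) : Prop := ∀ x y, h y x = σ (h x y)

/-- The unitary group `U(V)`. -/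
def unitary (h : SesqForm σ V) : Subgroup (LinearMap.GeneralLinearGroup F V) where
  carrier := {g | ∀ x y, h (g.1 x) (g.1 y) = h x y}
  one_mem' := fun _ _ => rfl
  mul_mem' := fun {g k} hg hk x y => (hg (k.1 x) (k.1 y)).trans (hk x y)
  inv_mem' := fun {g} hg x y => by
    have e : ∀ z, g.1 (g⁻¹.1 z) = z := fun z => LinearMap.congr_fun g.mul_inv z
    have := hg (g⁻¹.1 x) (g⁻¹.1 y)
    rw [e, e] at this
    exact this.symm

/-- An orthogonal basis of a nondegenerate hermitian space, consisting of vectors of nonzero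
length. It is used to record a hermitian lattice `L` (its `O_F`-span) together with a chosen
orthogonal basis of `L`, which gives the `F₀`-structure `V₀ = ⊕ F₀ eᵢ`. -/
structure OrthBasis (h : SesqForm σ V) (n : ℕ) where
  /-- the basis -/
  basis : Module.Basis (Fin n) F V
  orthogonal : ∀ i j, i ≠ j → h (basis i) (basis j) = 0
  length_ne_zero : ∀ i, h (basis i) (basis i) ≠ 0

namespace OrthBasis

variable {h : SesqForm σ V} {n : ℕ} (B : OrthBasis h n)

/-- The lattice `L = ⊕ O_F eᵢ`. -/
def lattice : Submodule (integers F) V := Submodule.span (integers F) (Set.range B.basis)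

/-- The conjugation `∑ xᵢ eᵢ ↦ ∑ x̄ᵢ eᵢ` of `V`; its fixed space is `V₀`. -/
def conj (x : V) : V := ∑ i, σ (B.basis.repr x i) • B.basis i

/-- `V₀ = ⊕ F₀ eᵢ`. -/
def V₀ : Set V := {x | B.conj x = x}

/-- `V₀*`, as the set of those `F`-linear forms on `V` that commute with the conjugations. -/
def V₀Dual : Set (Module.Dual F V) := {l | ∀ x, l (B.conj x) = σ (l x)}

/-- `GL(V₀)`, as the group of those elements of `GL(V)` that commute with the conjugation. -/
def GL₀ : Subgroup (LinearMap.GeneralLinearGroup F V) where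
  carrier := {g | ∀ x, g.1 (B.conj x) = B.conj (g.1 x)}
  one_mem' := fun _ => rfl
  mul_mem' := fun {g k} hg hk x => (congrArg g.1 (hk x)).trans (hg (k.1 x))
  inv_mem' := fun {g} hg x => by
    have e : ∀ z, g.1 (g⁻¹.1 z) = z := fun z => LinearMap.congr_fun g.mul_inv z
    have e' : ∀ z, g⁻¹.1 (g.1 z) = z := fun z => LinearMap.congr_fun g.inv_mul z
    rw [← e' (B.conj (g⁻¹.1 x)), hg, e]

/-- The symmetric space `S(V₀) = {γ ∈ GL(V) : γ γ̄ = 1}`, where `γ̄ = conj ∘ γ ∘ conj`. -/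
def S : Set (LinearMap.GeneralLinearGroup F V) :=
  {γ | ∀ x, γ.1 (B.conj (γ.1 (B.conj x))) = x}

/-- The orthogonal basis `(c eᵢ)`, of the lattice `c L`, for `c ∈ F₀ˣ`. -/
def smul (c : F₀ˣ) : OrthBasis h n where
  basis := B.basis.isUnitSMul (w := fun _ => algebraMap F₀ F c)
    (fun _ => (c.isUnit).map (algebraMap F₀ F))
  orthogonal := fun i j hij => by
    simp [Module.Basis.isUnitSMul_apply, B.orthogonal i j hij]
  length_ne_zero := fun i => by
    simp [Module.Basis.isUnitSMul_apply, B.length_ne_zero i]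

/-- The dual orthogonal basis `(eᵢ / (eᵢ, eᵢ))`, which is a basis of the dual lattice of `L`. -/
def dual : OrthBasis h n where
  basis := B.basis.isUnitSMul (w := fun i => (h (B.basis i) (B.basis i))⁻¹)
    (fun i => (inv_ne_zero (B.length_ne_zero i)).isUnit)
  orthogonal := fun i j hij => by
    simp [Module.Basis.isUnitSMul_apply, B.orthogonal i j hij]
  length_ne_zero := fun i => by
    simp [Module.Basis.isUnitSMul_apply, B.length_ne_zero i]

end OrthBasis

/-- The dual lattice `L^∨ = {x ∈ V : (x, L) ⊆ O_F}`. -/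
def dualLattice (h : SesqForm σ V) (L : Submodule (integers F) V) : Set V :=
  {x | ∀ y ∈ L, h x y ∈ integers F}

/-- `g L = L` for a subset `L` of `V`. -/
def Stabilizes (g : LinearMap.GeneralLinearGroup F V) (L : Set V) : Prop :=
  (fun x => g.1 x) '' L = L

/-! Closedness of `U(V)` and `GL(V₀)`, so that they are locally compact groups. -/

theorem continuous_sigma (σ : F ≃ₐ[F₀] F) : Continuous (σ : F →+* F) := by
  have : ProperSpace F₀ := .of_nontriviallyNormedField_of_weaklyLocallyCompactSpace F₀
  have : FiniteDimensional F₀ F :=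
    Module.finite_of_finrank_pos
      (by rw [Algebra.IsQuadraticExtension.finrank_eq_two F₀ F]; norm_num)
  exact LinearMap.continuous_of_finiteDimensional σ.toLinearMap

theorem continuous_linear_gl {W : Type*} [AddCommGroup W] [Module F W] [TopologicalSpace W]
    [IsModuleTopology F W] (f : Module.End F V →ₗ[F] W) :
    Continuous fun g : LinearMap.GeneralLinearGroup F V => f g.1 := by
  have := IsModuleTopology.toContinuousAdd F W
  exact (IsModuleTopology.continuous_of_linearMap f).comp Units.continuous_val

variable [FiniteDimensional F V]

theorem isClosed_unitary (h : SesqForm σ V) :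
    IsClosed (unitary h : Set (LinearMap.GeneralLinearGroup F V)) := by
  have hc : ∀ x y, Continuous fun g : LinearMap.GeneralLinearGroup F V =>
      h (g.1 x) (g.1 y) := by
    intro x y
    let : TopologicalSpace V := moduleTopology F V
    have : IsModuleTopology F V := ⟨rfl⟩
    have := IsModuleTopology.toContinuousAdd F V
    let b := Module.finBasis F V
    have key : ∀ u v : V, h u v = ∑ j, σ (b.repr v j) * h u (b j) := by
      intro u v
      conv_lhs => rw [← b.sum_repr v]
      simp only [map_sum, LinearMap.map_smulₛₗ, smul_eq_mul]
      rfl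
    have e : (fun g : LinearMap.GeneralLinearGroup F V => h (g.1 x) (g.1 y)) =
        fun g => ∑ j, σ (b.repr (g.1 y) j) * h (g.1 x) (b j) := funext fun g => key _ _
    rw [e]
    refine continuous_finsetSum _ fun j _ => ?_
    refine Continuous.mul ((continuous_sigma σ).comp ?_) ?_
    · exact continuous_linear_gl ((b.coord j).comp (LinearMap.applyₗ y))
    · let f : V →ₗ[F] F :=
        { toFun := fun u => h u (b j), map_add' := by simp, map_smul' := by simp }
      exact continuous_linear_gl (f.comp (LinearMap.applyₗ x))
  have : (unitary h : Set (LinearMap.GeneralLinearGroup F V)) =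
      ⋂ x, ⋂ y, {g | h (g.1 x) (g.1 y) = h x y} := by
    ext g; simp [unitary]
  rw [this]
  exact isClosed_iInter fun x => isClosed_iInter fun y => isClosed_eq (hc x y) continuous_const

instance unitaryLocallyCompact (h : SesqForm σ V) :
    LocallyCompactSpace (unitary h) :=
  (isClosed_unitary h).locallyCompactSpace

theorem OrthBasis.isClosed_GL₀ {h : SesqForm σ V} {n : ℕ} (B : OrthBasis h n) :
    IsClosed (B.GL₀ : Set (LinearMap.GeneralLinearGroup F V)) := by
  have e : (B.GL₀ : Set (LinearMap.GeneralLinearGroup F V)) =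
      ⋂ x, ⋂ i, {g | B.basis.repr (g.1 (B.conj x)) i = σ (B.basis.repr (g.1 x) i)} := by
    ext g
    have hr : ∀ y i, B.basis.repr (B.conj y) i = σ (B.basis.repr y i) := by
      intro y i
      simp [OrthBasis.conj, Finsupp.single_apply]
    simp only [Set.mem_iInter]
    constructor
    · intro hg x i
      have : g.1 (B.conj x) = B.conj (g.1 x) := hg x
      change B.basis.repr (g.1 (B.conj x)) i = _
      rw [this, hr]
    · intro hg x
      refine B.basis.repr.injective (Finsupp.ext fun i => ?_)
      rw [hr]
      exact hg x i
  rw [e]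
  refine isClosed_iInter fun x => isClosed_iInter fun i => isClosed_eq ?_ ?_
  · exact continuous_linear_gl ((B.basis.coord i).comp (LinearMap.applyₗ (B.conj x)))
  · exact (continuous_sigma σ).comp
      (continuous_linear_gl ((B.basis.coord i).comp (LinearMap.applyₗ x)))

instance OrthBasis.GL₀LocallyCompact {h : SesqForm σ V} {n : ℕ} (B : OrthBasis h n) :
    LocallyCompactSpace B.GL₀ :=
  B.isClosed_GL₀.locallyCompactSpace

/-! ### The subgroups used for the normalization of measures, and the test functions -/

/-- `U(L)`. -/
def unitaryStab (h : SesqForm σ V) (L : Submodule (integers F) V) :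
    Set (LinearMap.GeneralLinearGroup F V) :=
  {g | g ∈ unitary h ∧ Stabilizes g (L : Set V)}

namespace OrthBasis

variable {h : SesqForm σ V} {n : ℕ} (B : OrthBasis h n)

/-- `L₀ = L ∩ V₀`. -/
def L₀ : Set V := (B.lattice : Set V) ∩ B.V₀

/-- `L₀^∨ = L^∨ ∩ V₀`. -/
def L₀Dual : Set V := dualLattice h B.lattice ∩ B.V₀

/-- `(L₀^∨)* = {l ∈ V₀* : l(L₀^∨) ⊆ O_{F₀}}`. -/
def L₀DualStar : Set (Module.Dual F V) :=
  {l | l ∈ B.V₀Dual ∧ ∀ x ∈ B.L₀Dual, l x ∈ integers F}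

/-- `GL(L₀, L₀^∨)`, inside `GL(V₀)`. -/
def GL₀Stab : Set B.GL₀ :=
  {g | Stabilizes (g : LinearMap.GeneralLinearGroup F V) B.L₀ ∧
    Stabilizes (g : LinearMap.GeneralLinearGroup F V) B.L₀Dual}

/-- `S(L₀, L₀^∨)`, the elements of `S(V₀)` that stabilize both `L` and `L^∨`. -/
def SStab : Set (LinearMap.GeneralLinearGroup F V) :=
  {γ | γ ∈ B.S ∧ Stabilizes γ (B.lattice : Set V) ∧ Stabilizes γ (dualLattice h B.lattice)}

/-- The transfer factor `η(det (γⁱ u)_{i = 0, …, n - 1})`, with the determinant taken with respect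
to the basis of `L`. -/
def transferFactor (γ : LinearMap.GeneralLinearGroup F V) (u : V) : ℂ :=
  eta (B.basis.det fun i : Fin n => (γ ^ (i : ℕ)).1 u)

end OrthBasis

/-! ### The semi-Lie version -/

/-- The action `h.(g, u) = (h⁻¹ g h, h⁻¹ u)` on `GL(V) × V`. -/
def actU (k : LinearMap.GeneralLinearGroup F V) (x : LinearMap.GeneralLinearGroup F V × V) :
    LinearMap.GeneralLinearGroup F V × V :=
  (k⁻¹ * x.1 * k, k⁻¹.1 x.2)

/-- The action `h.(γ, u₁, u₂) = (h⁻¹ γ h, h⁻¹ u₁, u₂ h)` on `GL(V) × V × V*`. -/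
def actS (k : LinearMap.GeneralLinearGroup F V)
    (x : LinearMap.GeneralLinearGroup F V × V × Module.Dual F V) :
    LinearMap.GeneralLinearGroup F V × V × Module.Dual F V :=
  (k⁻¹ * x.1 * k, k⁻¹.1 x.2.1, x.2.2.comp k.1)

/-- `(U(V) × V)(F₀)_rs`. -/
def unitaryRS (h : SesqForm σ V) : Set (LinearMap.GeneralLinearGroup F V × V) :=
  letI : TopologicalSpace V := moduleTopology F V
  {x | x.1 ∈ unitary h ∧
    IsRegSemisimple (fun (k : unitary h) => actU (k : LinearMap.GeneralLinearGroup F V)) x}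

/-- Matching of `(g, u)` and `(γ, u₁, u₂)`: the triples `(g, u, x ↦ (x, u))` and `(γ, u₁, u₂)` are
conjugate under `GL(V)`. -/
def Matches (h : SesqForm σ V) (x : LinearMap.GeneralLinearGroup F V × V)
    (y : LinearMap.GeneralLinearGroup F V × V × Module.Dual F V) : Prop :=
  ∃ k : LinearMap.GeneralLinearGroup F V,
    k⁻¹ * x.1 * k = y.1 ∧ k⁻¹.1 x.2 = y.2.1 ∧ ∀ z, h (k.1 z) x.2 = y.2.2 z

namespace OrthBasis

variable {h : SesqForm σ V} {n : ℕ} (B : OrthBasis h n)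

/-- `(S(V₀) × V₀ × V₀*)(F₀)_rs`. -/
def symmetricRS : Set (LinearMap.GeneralLinearGroup F V × V × Module.Dual F V) :=
  letI : TopologicalSpace V := moduleTopology F V
  {y | y.1 ∈ B.S ∧ y.2.1 ∈ B.V₀ ∧ y.2.2 ∈ B.V₀Dual ∧
    IsRegSemisimple (fun (k : B.GL₀) => actS (k : LinearMap.GeneralLinearGroup F V)) y}

/-- The orbital integral `Orb((g, u), f)`; the Haar measure gives `U(L)` volume `1`. -/
def orbU (f : LinearMap.GeneralLinearGroup F V × V → ℂ)
    (x : LinearMap.GeneralLinearGroup F V × V) : ℂ :=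
  haarIntegral {k : unitary h | (k : LinearMap.GeneralLinearGroup F V) ∈ unitaryStab h B.lattice}
    fun k => f (actU (k : LinearMap.GeneralLinearGroup F V) x)

/-- The orbital integral `Orb((γ, u₁, u₂), f')` (at `s = 0`); the Haar measure gives
`GL(L₀, L₀^∨)` volume `1`. -/
def orbS (f' : LinearMap.GeneralLinearGroup F V × V × Module.Dual F V → ℂ)
    (y : LinearMap.GeneralLinearGroup F V × V × Module.Dual F V) : ℂ :=
  B.transferFactor y.1 y.2.1 * haarIntegral B.GL₀Stab fun k =>
    f' (actS (k : LinearMap.GeneralLinearGroup F V) y) *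
      eta (LinearMap.det (k : LinearMap.GeneralLinearGroup F V).1)

/-- `f` on `U(V) × V` and `f'` on `S(V₀) × V₀ × V₀*` are transfers of each other (only the values
on these subsets of `GL(V) × V` and `GL(V) × V × V*` matter). -/
def IsTransfer (f : LinearMap.GeneralLinearGroup F V × V → ℂ)
    (f' : LinearMap.GeneralLinearGroup F V × V × Module.Dual F V → ℂ) : Prop :=
  ∀ y ∈ B.symmetricRS,
    (∀ x ∈ unitaryRS h, Matches h x y → B.orbS f' y = B.orbU f x) ∧
    ((¬ ∃ x ∈ unitaryRS h, Matches h x y) → B.orbS f' y = 0)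

/-- The semi-Lie transfer conjecture for the lattice `L = ⊕ O_F eᵢ`: the functions
`1_{U(L)} × 1_L` and `1_{S(L₀, L₀^∨)} × 1_{L₀} × 1_{(L₀^∨)*}` are transfers of each other. -/
def SemiLieTC : Prop :=
  B.IsTransfer
    (Set.indicator (unitaryStab h B.lattice ×ˢ (B.lattice : Set V)) fun _ => 1)
    (Set.indicator (B.SStab ×ˢ (B.L₀ ×ˢ B.L₀DualStar)) fun _ => 1)

end OrthBasis

/-! ### The group version -/

/-- The orthogonal direct sum `V = V^♭ ⊕ F e`, realized as `V^♭ × F` with `e = (0, 1)` and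
`(e, e) = a ∈ F₀ˣ`; its form is `((x, s), (y, t)) = (x, y) + s a t̄`. -/
def orthSum (h : SesqForm σ V) (a : F₀ˣ) : SesqForm σ (V × F) :=
  LinearMap.mk₂'ₛₗ (RingHom.id F) (σ : F →+* F)
    (fun x y => h x.1 y.1 + x.2 * algebraMap F₀ F a * σ y.2)
    (by intros; simp; ring) (by intros; simp; ring)
    (by intros; simp; ring) (by intros; simp; ring)

/-- The embedding `GL(V^♭) → GL(V)` given by the trivial action on `e`. -/
def glEmb : LinearMap.GeneralLinearGroup F V →* LinearMap.GeneralLinearGroup F (V × F) :=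
  Units.map ((LinearMap.prodMapRingHom F V F : _ →* _).comp
    (MonoidHom.inl (Module.End F V) (Module.End F F)))

/-- The conjugation action of `GL(V^♭)` on `GL(V)`. -/
def actG (k : LinearMap.GeneralLinearGroup F V) (g : LinearMap.GeneralLinearGroup F (V × F)) :
    LinearMap.GeneralLinearGroup F (V × F) :=
  (glEmb k)⁻¹ * g * glEmb k

/-- `U(V)(F₀)_rs`, for the conjugation action of `U(V^♭)`. -/
def unitaryGroupRS (h : SesqForm σ V) (a : F₀ˣ) : Set (LinearMap.GeneralLinearGroup F (V × F)) :=
  {g | g ∈ unitary (orthSum h a) ∧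
    IsRegSemisimple (fun (k : unitary h) => actG (k : LinearMap.GeneralLinearGroup F V)) g}

/-- Matching of `g ∈ U(V)` and `γ ∈ S(V₀)`: conjugate under `GL(V^♭)`. -/
def GroupMatches (g γ : LinearMap.GeneralLinearGroup F (V × F)) : Prop :=
  ∃ k : LinearMap.GeneralLinearGroup F V, actG k g = γ

namespace OrthBasis

variable {h : SesqForm σ V} {n : ℕ} (B : OrthBasis h n)

/-- The orthogonal basis `(e₁, …, eₙ, e_L)` of `L = L^♭ ⊕ O_F e_L`, where `e_L = lam • e`, with
`lam ∈ F₀ˣ`, and `(e₁, …, eₙ)` is the given orthogonal basis of `L^♭`. -/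
def sum (a lam : F₀ˣ) : OrthBasis (orthSum h a) (n + 1) where
  basis := (B.basis.prod ((Module.Basis.singleton (Fin 1) F).isUnitSMul
    (w := fun _ => algebraMap F₀ F lam)
    (fun _ => (lam.isUnit).map (algebraMap F₀ F)))).reindex finSumFinEquiv
  orthogonal := fun i j => by
    obtain ⟨i, rfl⟩ := finSumFinEquiv.surjective i
    obtain ⟨j, rfl⟩ := finSumFinEquiv.surjective j
    intro hij
    rcases i with i | i <;> rcases j with j | j
    · have : i ≠ j := by rintro rfl; exact hij rfl
      simp [orthSum, B.orthogonal i j this]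
    · simp [orthSum]
    · simp [orthSum]
    · exact absurd (by rw [Subsingleton.elim i j]) hij
  length_ne_zero := fun i => by
    obtain ⟨i, rfl⟩ := finSumFinEquiv.surjective i
    rcases i with i | i
    · simp [orthSum, B.length_ne_zero i]
    · simp [orthSum, Module.Basis.isUnitSMul_apply]

/-- `S(V₀)(F₀)_rs`, for the conjugation action of `GL(V₀^♭)`. -/
def symmetricGroupRS (a lam : F₀ˣ) : Set (LinearMap.GeneralLinearGroup F (V × F)) :=
  {γ | γ ∈ (B.sum a lam).S ∧
    IsRegSemisimple (fun (k : B.GL₀) => actG (k : LinearMap.GeneralLinearGroup F V)) γ}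

/-- The orbital integral `Orb(g, f)`; the Haar measure on `U(V^♭)` gives `U(L^♭)` volume `1`. -/
def groupOrbU (f : LinearMap.GeneralLinearGroup F (V × F) → ℂ)
    (g : LinearMap.GeneralLinearGroup F (V × F)) : ℂ :=
  haarIntegral {k : unitary h | (k : LinearMap.GeneralLinearGroup F V) ∈ unitaryStab h B.lattice}
    fun k => f (actG (k : LinearMap.GeneralLinearGroup F V) g)

/-- The orbital integral `Orb(γ, f')` (at `s = 0`), with the transfer factor
`η(det (γⁱ e_L)_{i = 0, …, n})` taken with respect to the basis of `L`; the Haar measure on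
`GL(V₀^♭)` gives `GL(L₀^♭, L₀^{♭,∨})` volume `1`. -/
def groupOrbS (a lam : F₀ˣ) (f' : LinearMap.GeneralLinearGroup F (V × F) → ℂ)
    (γ : LinearMap.GeneralLinearGroup F (V × F)) : ℂ :=
  (B.sum a lam).transferFactor γ (0, algebraMap F₀ F lam) *
    haarIntegral B.GL₀Stab fun k =>
      f' (actG (k : LinearMap.GeneralLinearGroup F V) γ) *
        eta (LinearMap.det (k : LinearMap.GeneralLinearGroup F V).1)

/-- `f` on `U(V)` and `f'` on `S(V₀)` are transfers of each other, with respect to the lattice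
`L = L^♭ ⊕ O_F e_L` (only the values on these subsets of `GL(V)` matter). -/
def IsGroupTransfer (a lam : F₀ˣ) (f f' : LinearMap.GeneralLinearGroup F (V × F) → ℂ) : Prop :=
  ∀ γ ∈ B.symmetricGroupRS a lam,
    (∀ g ∈ unitaryGroupRS h a, GroupMatches g γ → B.groupOrbS a lam f' γ = B.groupOrbU f g) ∧
    ((¬ ∃ g ∈ unitaryGroupRS h a, GroupMatches g γ) → B.groupOrbS a lam f' γ = 0)

/-- The function `1_{U(L)}`, for `L = L^♭ ⊕ O_F e_L`. -/
def groupFunU (a lam : F₀ˣ) : LinearMap.GeneralLinearGroup F (V × F) → ℂ :=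
  Set.indicator (unitaryStab (orthSum h a) (B.sum a lam).lattice) fun _ => 1

/-- The function `1_{S(L₀, L₀^∨)}`, for `L = L^♭ ⊕ O_F e_L`. -/
def groupFunS (a lam : F₀ˣ) : LinearMap.GeneralLinearGroup F (V × F) → ℂ :=
  Set.indicator (B.sum a lam).SStab fun _ => 1

/-- The group transfer conjecture for the pair `(L, e_L)`, where `L = L^♭ ⊕ O_F e_L`: the functions
`1_{U(L)}` and `1_{S(L₀, L₀^∨)}` are transfers of each other. -/
def GroupTC (a lam : F₀ˣ) : Prop :=
  B.IsGroupTransfer a lam (B.groupFunU a lam) (B.groupFunS a lam)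

/-- The sign by which the transfer factors of `(L^∨, e_L / (e_L, e_L))` and `(L, e_L)` differ:
`η(∏ᵢ (eᵢ, eᵢ) (e_L, e_L))`, the product being over the basis of `L^♭`. -/
def dualSign (a lam : F₀ˣ) : ℂ :=
  eta (∏ i, h (B.basis i) (B.basis i) * algebraMap F₀ F (a * lam ^ 2 : F₀ˣ))

end OrthBasis

/-- A lattice `M` in `V` (given as a set) satisfies the reduction with respect to its vector `e'`:
`v(e', e') = min_{x, y ∈ M} v((x, y))`. -/
def SatisfiesReduction (h : SesqForm σ V) (M : Set V) (e' : V) : Prop :=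
  e' ∈ M ∧ ∀ x ∈ M, ∀ y ∈ M, ‖h x y‖ ≤ ‖h e' e'‖

end Hermitian

end JacquetRallis

end

set_option linter.unusedSectionVars false

namespace JacquetRallis

/-! ### Valuations and the quadratic character -/

section FieldFacts

/-! Write e for the vector (0, 1) and a = (e, e), and rescale L by λ⁻¹, so that it becomes M ⊕ O_F e
with M = λ⁻¹L^♭. If the e-coefficient of γe is 1 - τ⁻¹, then γ factors uniquely as a
quasi-reflection along u - e composed with some g ⊕ 1, g ∈ GL(V^♭). This is `psi`, with inverse
`phi`: an equivariant bijection between such γ and triples (g, u, l) with τ + τ' = 1 + l(u)/a, where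
τ' plays the role of τ for γ⁻¹. On both sides of the transfer τ' = σ(τ).

On the unitary side γ is unitary exactly when g is unitary and l = (·, u), which is the semi-Lie
datum (g, u). On the symmetric side γ ∈ S(V₀) means g ∈ S(V₀^♭), gū = u and lg = l̄
(`psi_mem_S_iff`), which is a twisted form of u ∈ V₀^♭, l ∈ (V₀^♭)*. The twist is undone by Hilbert
90 in the order O_F[g]: this ring is semilocal and g ḡ = 1, so there is a unit P(g), with inverse
Q(g), satisfying g·P(g)‾ = P(g) (`exists_aeval_eq_mul_bar`). Then (g, u, l) ↦ (g, P(g)u, lQ(g))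
carries untwisted triples to twisted ones. It is conjugation by an element of GL(V^♭), so matching
is not affected; P(g) and Q(g) preserve g-stable lattices and have unit determinant, so test
functions and transfer factors are not affected either.

When τ is a unit and (M, M) ⊆ a O_F, which is the reduction hypothesis, γ stabilizes M ⊕ O_F e and
its dual exactly when g stabilizes M and M^∨, u ∈ M and l(M^∨) ⊆ O_F (`psi_stabilizes_iff`). The
sequence γⁱe is triangular with respect to e, u, gu, g²u, …, up to units, so the transfer factors
agree as well. Hence the transfer statements at γ and at the semi-Lie point are equivalent
(`groupTransferAt_psi_iff`).

It remains to reach every relevant point with a unit τ. Given γ, multiplication by a scalar ζ with ζ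
σ(ζ) = 1 changes nothing and can make 1 - d a unit, d being the e-coefficient of γe. Given (g, u,
l), a unit τ of trace 1 + l(u)/a is needed. Both exist because σ acts nontrivially on the residue
field, whatever the residue characteristic. At points with no such integral model all orbital
integrals vanish.

The second part is the first applied to the dual basis: L^∨ gives the same groups, measures and test
functions as L, and only the transfer factor changes, by the sign ε_L. -/

theorem mem_integers_iff {K : Type*} [NormedField K] [IsUltrametricDist K] {x : K} :
    x ∈ integers K ↔ ‖x‖ ≤ 1 := by
  rw [integers, Valuation.mem_integer_iff, ← NNReal.coe_le_coe]
  rfl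

section Ord

variable {K : Type*} [NontriviallyNormedField K] [IsUltrametricDist K] [LocallyCompactSpace K]

theorem exists_isUniformizer : ∃ ϖ : K, IsUniformizer ϖ := by
  have : ProperSpace K := .of_nontriviallyNormedField_of_weaklyLocallyCompactSpace K
  -- In an ultrametric space the open unit ball is also closed, hence compact here, so the norm
  -- attains its maximum on it.
  have hc : IsCompact (Metric.ball (0 : K) 1) :=
    (isCompact_closedBall (0 : K) 1).of_isClosed_subset (IsUltrametricDist.isClosed_ball 0 1)
      Metric.ball_subset_closedBall
  obtain ⟨ϖ, hϖ, hmax⟩ := hc.exists_isMaxOn ⟨0, by simp⟩ continuous_norm.continuousOn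
  refine ⟨ϖ, ⟨ϖ, rfl, by simpa using hϖ⟩, ?_⟩
  rintro r ⟨y, rfl, hy⟩
  exact hmax (by simpa using hy : y ∈ Metric.ball (0 : K) 1)

theorem IsUniformizer.norm_pos {ϖ : K} (hϖ : IsUniformizer ϖ) : 0 < ‖ϖ‖ := by
  obtain ⟨x, hx0, hx1⟩ := NormedField.exists_norm_lt_one K
  exact hx0.trans_le (hϖ.2 ⟨x, rfl, hx1⟩)

theorem IsUniformizer.norm_lt_one {ϖ : K} (hϖ : IsUniformizer ϖ) : ‖ϖ‖ < 1 := by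
  obtain ⟨y, hy, hlt⟩ := hϖ.1
  exact hlt

theorem IsUniformizer.exists_zpow {ϖ : K} (hϖ : IsUniformizer ϖ) {x : K} (hx : x ≠ 0) :
    ∃ m : ℤ, ‖x‖ = ‖ϖ‖ ^ m := by
  have h0 := hϖ.norm_pos
  have h1 := hϖ.norm_lt_one
  have hx' : 0 < ‖x‖ := norm_pos_iff.2 hx
  -- Squeezing ‖x‖ between consecutive powers of ‖ϖ‖⁻¹ puts ‖x ϖ^(m+1)‖ in (‖ϖ‖, 1]; maximality of
  -- ‖ϖ‖ below 1 leaves only the value 1.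
  obtain ⟨m, hm1, hm2⟩ := exists_mem_Ioc_zpow hx' ((one_lt_inv₀ h0).2 h1)
  have hϖ0 : ϖ ≠ 0 := norm_pos_iff.1 h0
  refine ⟨-(m + 1), ?_⟩
  rw [inv_zpow'] at hm1 hm2
  have e2 : ‖x * ϖ ^ (m + 1)‖ = ‖x‖ * ‖ϖ‖ ^ (m + 1) := by rw [norm_mul, norm_zpow]
  have hle : ‖x * ϖ ^ (m + 1)‖ ≤ 1 := by
    rw [e2]
    calc ‖x‖ * ‖ϖ‖ ^ (m + 1) ≤ ‖ϖ‖ ^ (-(m + 1)) * ‖ϖ‖ ^ (m + 1) := by gcongr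
      _ = 1 := by rw [← zpow_add₀ h0.ne']; simp
  have hgt : ‖ϖ‖ < ‖x * ϖ ^ (m + 1)‖ := by
    rw [e2]
    calc ‖ϖ‖ = ‖ϖ‖ ^ (-m) * ‖ϖ‖ ^ (m + 1) := by rw [← zpow_add₀ h0.ne']; simp
      _ < _ := by gcongr
  have : ‖x * ϖ ^ (m + 1)‖ = 1 := by
    by_contra hne
    exact hgt.not_ge (hϖ.2 ⟨_, rfl, lt_of_le_of_ne hle hne⟩)
  rw [e2] at this
  rw [zpow_neg]
  exact eq_inv_of_mul_eq_one_left this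

theorem IsUniformizer.norm_eq_zpow_ord {ϖ : K} (hϖ : IsUniformizer ϖ) {x : K} (hx : x ≠ 0) :
    ‖x‖ = ‖ϖ‖ ^ ord x := by
  have h : ∃ m : ℤ, ∃ ϖ : K, IsUniformizer ϖ ∧ ‖x‖ = ‖ϖ‖ ^ m := by
    obtain ⟨m, hm⟩ := hϖ.exists_zpow hx
    exact ⟨m, ϖ, hϖ, hm⟩
  rw [ord, dif_pos h]
  obtain ⟨ϖ', hϖ', e⟩ := h.choose_spec
  rw [← hϖ'.unique hϖ]
  exact e

theorem IsUniformizer.ord_eq {ϖ : K} (hϖ : IsUniformizer ϖ) {x : K} (hx : x ≠ 0) {m : ℤ}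
    (hm : ‖x‖ = ‖ϖ‖ ^ m) : ord x = m :=
  zpow_right_injective₀ hϖ.norm_pos hϖ.norm_lt_one.ne ((hϖ.norm_eq_zpow_ord hx).symm.trans hm)

theorem eta_mul (x y : K) : eta (x * y) = eta x * eta y := by
  by_cases hx : x = 0
  · simp [eta, hx]
  by_cases hy : y = 0
  · simp [eta, hy]
  obtain ⟨ϖ, hϖ⟩ := exists_isUniformizer (K := K)
  have : ord (x * y) = ord x + ord y := by
    refine hϖ.ord_eq (mul_ne_zero hx hy) ?_
    rw [norm_mul, hϖ.norm_eq_zpow_ord hx, hϖ.norm_eq_zpow_ord hy, zpow_add₀ hϖ.norm_pos.ne']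
  rw [eta, eta, eta, if_neg hx, if_neg hy, if_neg (mul_ne_zero hx hy), this,
    zpow_add₀ (by norm_num)]

theorem eta_eq_one_of_norm_eq_one {x : K} (hx : ‖x‖ = 1) : eta x = 1 := by
  have hx0 : x ≠ 0 := by rintro rfl; simp at hx
  obtain ⟨ϖ, hϖ⟩ := exists_isUniformizer (K := K)
  rw [eta, if_neg hx0, hϖ.ord_eq hx0 (m := 0) (by simpa using hx), zpow_zero]

theorem eta_mul_of_norm_eq_one {x : K} (hx : ‖x‖ = 1) (y : K) : eta (x * y) = eta y := by
  rw [eta_mul, eta_eq_one_of_norm_eq_one hx, one_mul]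

theorem eta_mul_self {x : K} (hx : x ≠ 0) : eta x * eta x = 1 := by
  rw [eta, if_neg hx, ← mul_zpow]
  norm_num

theorem eta_one : eta (1 : K) = 1 := eta_eq_one_of_norm_eq_one norm_one

theorem eta_pow (x : K) (m : ℕ) : eta (x ^ m) = eta x ^ m :=
  map_pow ({ toFun := eta, map_one' := eta_one, map_mul' := eta_mul } : K →* ℂ) x m

/-- Two terms of a sequence of integers lie in the same residue class. -/
theorem exists_norm_sub_lt_one (u : ℕ → K) (hu : ∀ i, ‖u i‖ ≤ 1) :
    ∃ i j, i < j ∧ ‖u i - u j‖ < 1 := by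
  have : ProperSpace K := .of_nontriviallyNormedField_of_weaklyLocallyCompactSpace K
  obtain ⟨x, -, φ, hφ, hlim⟩ := (isCompact_closedBall (0 : K) 1).tendsto_subseq
    (fun i => by simpa using hu i : ∀ i, u i ∈ Metric.closedBall (0 : K) 1)
  obtain ⟨N, hN⟩ := Metric.cauchySeq_iff'.1 hlim.cauchySeq 1 one_pos
  refine ⟨φ N, φ (N + 1), hφ (Nat.lt_succ_self N), ?_⟩
  have := hN (N + 1) (Nat.le_succ N)
  rwa [dist_comm, dist_eq_norm] at this

theorem norm_add_le_of_le {x y : K} {r : ℝ} (hx : ‖x‖ ≤ r) (hy : ‖y‖ ≤ r) : ‖x + y‖ ≤ r :=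
  (IsUltrametricDist.norm_add_le_max x y).trans (max_le hx hy)

theorem norm_sub_le_of_le {x y : K} {r : ℝ} (hx : ‖x‖ ≤ r) (hy : ‖y‖ ≤ r) : ‖x - y‖ ≤ r :=
  sub_eq_add_neg x y ▸ norm_add_le_of_le hx ((norm_neg y).trans_le hy)

theorem norm_add_lt_of_lt {x y : K} {r : ℝ} (hx : ‖x‖ < r) (hy : ‖y‖ < r) : ‖x + y‖ < r :=
  (IsUltrametricDist.norm_add_le_max x y).trans_lt (max_lt hx hy)

theorem norm_sub_lt_of_lt {x y : K} {r : ℝ} (hx : ‖x‖ < r) (hy : ‖y‖ < r) : ‖x - y‖ < r :=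
  sub_eq_add_neg x y ▸ norm_add_lt_of_lt hx ((norm_neg y).trans_lt hy)

theorem norm_eq_one_of_norm_sub_lt {x y : K} (hx : ‖x‖ = 1) (h : ‖x - y‖ < 1) : ‖y‖ = 1 := by
  have := IsUltrametricDist.norm_eq_of_add_norm_lt_max (x := x) (y := -y)
    (by rw [← sub_eq_add_neg]; exact h.trans_le (hx.symm.le.trans (le_max_left _ _)))
  rw [← norm_neg y, ← this, hx]

theorem norm_mul_le_one {x y : K} (hx : ‖x‖ ≤ 1) (hy : ‖y‖ ≤ 1) : ‖x * y‖ ≤ 1 := by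
  rw [norm_mul]
  exact mul_le_one₀ hx (norm_nonneg _) hy

theorem norm_pow_le_one {x : K} (hx : ‖x‖ ≤ 1) (m : ℕ) : ‖x ^ m‖ ≤ 1 := by
  rw [norm_pow]
  exact pow_le_one₀ (norm_nonneg _) hx

/-- In residue characteristic two, `(a - b) ^ (2 ^ k) ≡ a ^ (2 ^ k) - b ^ (2 ^ k)`. -/
theorem norm_sub_pow_two_pow_sub_lt_one (h2 : ‖(2 : K)‖ < 1) {a b : K} (ha : ‖a‖ ≤ 1)
    (hb : ‖b‖ ≤ 1) (k : ℕ) : ‖(a - b) ^ 2 ^ k - (a ^ 2 ^ k - b ^ 2 ^ k)‖ < 1 := by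
  induction k with
  | zero => simp
  | succ k ih =>
    have e : (a - b) ^ 2 ^ (k + 1) - (a ^ 2 ^ (k + 1) - b ^ 2 ^ (k + 1)) =
        ((a - b) ^ 2 ^ k - (a ^ 2 ^ k - b ^ 2 ^ k)) *
          ((a - b) ^ 2 ^ k + (a ^ 2 ^ k - b ^ 2 ^ k)) +
        2 * (b ^ 2 ^ k * (b ^ 2 ^ k - a ^ 2 ^ k)) := by
      rw [pow_succ, pow_mul, pow_mul, pow_mul]; ring
    have hab := norm_sub_le_of_le (norm_pow_le_one ha (2 ^ k)) (norm_pow_le_one hb (2 ^ k))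
    rw [e]
    refine norm_add_lt_of_lt ?_ ?_
    · rw [norm_mul]
      exact mul_lt_one_of_nonneg_of_lt_one_left (norm_nonneg _) ih
        (norm_add_le_of_le (norm_pow_le_one (norm_sub_le_of_le ha hb) _) hab)
    · rw [norm_mul]
      refine mul_lt_one_of_nonneg_of_lt_one_left (norm_nonneg _) h2 (norm_mul_le_one
        (norm_pow_le_one hb _) ?_)
      rwa [norm_sub_rev]

/-- Among the x^(2^i) two are congruent, with exponents 2^i and 2^(i+k+1). As Frobenius is additive
modulo the maximal ideal, x - x^(2^(k+1)) has its 2^i-th power of norm < 1, hence is itself of norm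
< 1. The even exponent is what allows x² to be replaced by the σ-fixed element x σ(x) later. -/
theorem exists_norm_pow_sub_lt_one (h2 : ‖(2 : K)‖ < 1) {x : K} (hx : ‖x‖ ≤ 1) :
    ∃ m : ℕ, ‖x ^ (2 * m) - x‖ < 1 := by
  obtain ⟨i, j, hij, h⟩ := exists_norm_sub_lt_one (fun i => x ^ 2 ^ i)
    (fun i => norm_pow_le_one hx _)
  obtain ⟨k, rfl⟩ := Nat.exists_eq_add_of_lt hij
  refine ⟨2 ^ k, ?_⟩
  have h3 := norm_sub_pow_two_pow_sub_lt_one h2 hx (norm_pow_le_one hx (2 * 2 ^ k)) i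
  have e : (x ^ (2 * 2 ^ k)) ^ 2 ^ i = x ^ 2 ^ (i + k + 1) := by
    rw [← pow_mul]; congr 1; ring
  rw [e] at h3
  have h4 := norm_add_lt_of_lt h3 h
  rw [sub_add_cancel, norm_pow] at h4
  rw [norm_sub_rev]
  exact (pow_lt_one_iff_of_nonneg (norm_nonneg _) (by positivity)).1 h4

end Ord

/-! ### The involution of an unramified quadratic extension -/

section Quadratic

variable {F₀ F : Type*} [NontriviallyNormedField F₀] [IsUltrametricDist F₀]
  [LocallyCompactSpace F₀] [NontriviallyNormedField F] [IsUltrametricDist F]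
  [LocallyCompactSpace F] [NormedAlgebra F₀ F] [Algebra.IsQuadraticExtension F₀ F]
  (σ : F ≃ₐ[F₀] F)

theorem sigma_sigma (x : F) : σ (σ x) = x := by
  have : FiniteDimensional F₀ F :=
    Module.finite_of_finrank_pos
      (by rw [Algebra.IsQuadraticExtension.finrank_eq_two F₀ F]; norm_num)
  have h := AlgEquiv.card_le (F := F₀) (K := F)
  rw [Algebra.IsQuadraticExtension.finrank_eq_two F₀ F] at h
  have h1 : σ ^ 2 = 1 := by
    have hc : Fintype.card (F ≃ₐ[F₀] F) ∣ 2 := by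
      have := Fintype.card_pos (α := F ≃ₐ[F₀] F)
      interval_cases Fintype.card (F ≃ₐ[F₀] F) <;> norm_num
    exact orderOf_dvd_iff_pow_eq_one.1 (orderOf_dvd_card.trans hc)
  rw [pow_two] at h1
  exact AlgEquiv.congr_fun h1 x

/-- As an F₀-linear map σ is bounded, ‖σx‖ ≤ C‖x‖; applying this to powers of x and using
multiplicativity removes the constant, and σ² = 1 gives equality. -/
theorem norm_sigma (x : F) : ‖σ x‖ = ‖x‖ := by
  have key : ∀ x : F, ‖σ x‖ ≤ ‖x‖ := by
    have : ProperSpace F₀ := .of_nontriviallyNormedField_of_weaklyLocallyCompactSpace F₀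
    have : FiniteDimensional F₀ F :=
      Module.finite_of_finrank_pos
        (by rw [Algebra.IsQuadraticExtension.finrank_eq_two F₀ F]; norm_num)
    obtain ⟨C, hC0, hC⟩ : ∃ C : ℝ, 0 < C ∧ ∀ x : F, ‖σ x‖ ≤ C * ‖x‖ := by
      let f : F →L[F₀] F := LinearMap.toContinuousLinearMap σ.toLinearMap
      exact ⟨‖f‖ + 1, by positivity, fun x => (f.le_opNorm x).trans (by gcongr; linarith)⟩
    intro x
    by_contra! hlt
    have hx : 0 < ‖x‖ := by
      refine norm_pos_iff.2 ?_
      rintro rfl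
      simp at hlt
    obtain ⟨N, hN⟩ := pow_unbounded_of_one_lt C ((one_lt_div hx).2 hlt)
    have := hC (x ^ N)
    rw [map_pow, norm_pow, norm_pow] at this
    rw [div_pow, lt_div_iff₀ (by positivity)] at hN
    exact hN.not_ge this
  refine le_antisymm (key x) ?_
  conv_lhs => rw [← sigma_sigma σ x]
  exact key _

theorem sigma_mem_integers {x : F} (hx : x ∈ integers F) : σ x ∈ integers F := by
  rw [mem_integers_iff] at *
  rwa [norm_sigma]

/-- Since `F/F₀` is unramified, the involution acts non-trivially on the residue field. -/
theorem exists_norm_sub_sigma_eq_one (hunr : IsUnramified F₀ F) (hσ : σ ≠ AlgEquiv.refl) :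
    ∃ θ : F, ‖θ‖ ≤ 1 ∧ ‖θ - σ θ‖ = 1 := by
  by_contra! hne
  have hlt : ∀ x : F, ‖x‖ ≤ 1 → ‖x - σ x‖ < 1 := fun x hx =>
    lt_of_le_of_ne (norm_sub_le_of_le hx (by rwa [norm_sigma])) (hne x hx)
  have : ProperSpace F := .of_nontriviallyNormedField_of_weaklyLocallyCompactSpace F
  have hcont : Continuous fun x : F => ‖x - σ x‖ :=
    (continuous_id.sub (continuous_sigma σ)).norm
  -- Choose x in the unit ball moved as far as possible by σ. It will be congruent to a σ-fixed c,
  -- and rescaling x - c to norm one by an element of F₀ then contradicts maximality.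
  obtain ⟨x, hx, hmax⟩ := (isCompact_closedBall (0 : F) 1).exists_isMaxOn ⟨0, by simp⟩
    hcont.continuousOn
  replace hx : ‖x‖ ≤ 1 := by simpa using hx
  replace hmax : ∀ y : F, ‖y‖ ≤ 1 → ‖y - σ y‖ ≤ ‖x - σ x‖ := fun y hy => hmax (by simpa using hy)
  have hσx : x - σ x ≠ 0 := by
    intro h0
    refine hσ (AlgEquiv.ext fun z => ?_)
    obtain ⟨c, hc0, hc⟩ : ∃ c : F₀, c ≠ 0 ∧ ‖c • z‖ ≤ 1 := by
      by_cases hz : z = 0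
      · exact ⟨1, one_ne_zero, by simp [hz]⟩
      · obtain ⟨y, hy⟩ := hunr z
        have hy0 : y ≠ 0 := by rw [← norm_pos_iff, hy]; exact norm_pos_iff.2 hz
        refine ⟨y⁻¹, inv_ne_zero hy0, ?_⟩
        rw [norm_smul, norm_inv, hy, inv_mul_cancel₀ (norm_ne_zero_iff.2 hz)]
    have h1 := hmax _ hc
    rw [h0, norm_zero, norm_le_zero_iff, map_smul, ← smul_sub, smul_eq_zero, sub_eq_zero] at h1
    exact (h1.resolve_left hc0).symm
  have hsx : ‖σ x‖ ≤ 1 := by rwa [norm_sigma]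
  -- In residue characteristic two take c = (x σx)^m with x^(2m) ≡ x; otherwise c is half the trace.
  -- Both are congruent to x because σx ≡ x.
  obtain ⟨c, hc, hxc⟩ : ∃ c : F, σ c = c ∧ ‖x - c‖ < 1 := by
    have h2le : ‖(2 : F)‖ ≤ 1 := by
      have := norm_add_le_of_le (norm_one (α := F)).le (norm_one (α := F)).le
      rwa [one_add_one_eq_two] at this
    rcases h2le.lt_or_eq with h2 | h2
    · obtain ⟨m, hm⟩ := exists_norm_pow_sub_lt_one h2 hx
      refine ⟨(x * σ x) ^ m, by rw [map_pow, map_mul, sigma_sigma, mul_comm], ?_⟩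
      have h3 : ‖x ^ (2 * m) - (x * σ x) ^ m‖ < 1 := by
        rw [pow_mul]
        obtain ⟨c, hc⟩ : ∃ c : F, ‖c‖ ≤ 1 ∧
            (x ^ 2) ^ m - (x * σ x) ^ m = (x ^ 2 - x * σ x) * c := by
          refine ⟨∑ i ∈ Finset.range m, (x ^ 2) ^ i * (x * σ x) ^ (m - 1 - i), ?_, ?_⟩
          · refine IsUltrametricDist.norm_sum_le_of_forall_le_of_nonneg zero_le_one fun i _ => ?_
            exact norm_mul_le_one (norm_pow_le_one (norm_pow_le_one hx _) _)
              (norm_pow_le_one (norm_mul_le_one hx hsx) _)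
          · rw [← (Commute.all _ _).mul_geom_sum₂]
        rw [hc.2, show x ^ 2 - x * σ x = x * (x - σ x) by ring, mul_right_comm, norm_mul]
        exact mul_lt_one_of_nonneg_of_lt_one_right (norm_mul_le_one hx hc.1) (norm_nonneg _)
          (hlt x hx)
      have := norm_sub_lt_of_lt h3 hm
      rwa [sub_sub_sub_cancel_left] at this
    · have h20 : (2 : F) ≠ 0 := by rw [← norm_pos_iff, h2]; exact one_pos
      refine ⟨(x + σ x) / 2, by rw [map_div₀, map_add, sigma_sigma, map_ofNat, add_comm], ?_⟩
      rw [show x - (x + σ x) / 2 = (x - σ x) / 2 by field_simp; ring, norm_div, h2, div_one]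
      exact hlt x hx
  have hxc0 : x - c ≠ 0 := by
    intro h0
    rw [sub_eq_zero] at h0
    rw [h0, hc, sub_self] at hσx
    exact hσx rfl
  -- Here ramification index one is essential: x - c has the norm of an element y of F₀, and
  -- dividing by y commutes with σ.
  obtain ⟨y, hy⟩ := hunr (x - c)
  have hy0 : y ≠ 0 := by rw [← norm_pos_iff, hy]; exact norm_pos_iff.2 hxc0
  have h5 := hmax (y⁻¹ • (x - c)) (by
    rw [norm_smul, norm_inv, hy, inv_mul_cancel₀ (norm_ne_zero_iff.2 hxc0)])
  rw [map_smul, ← smul_sub, map_sub, hc, sub_sub_sub_cancel_right, norm_smul, norm_inv] at h5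
  have h6 : 1 < ‖y‖⁻¹ := (one_lt_inv₀ (norm_pos_iff.2 hy0)).2 (by rw [hy]; exact hxc)
  have h7 : 0 < ‖x - σ x‖ := norm_pos_iff.2 hσx
  nlinarith

/-- ζ = 1 works unless d ≡ 1. In that case take ζ = σθ/θ with θ - σθ a unit: then 1 - ζd ≡ 1 - ζ =
(θ - σθ)/θ. This brings an integral γ to a position where τ is a unit. -/
theorem exists_unitary_norm_one_sub_mul (hunr : IsUnramified F₀ F) (hσ : σ ≠ AlgEquiv.refl)
    {d : F} (hd : ‖d‖ ≤ 1) : ∃ ζ : F, ζ * σ ζ = 1 ∧ ‖ζ‖ = 1 ∧ ‖1 - ζ * d‖ = 1 := by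
  have hle : ‖1 - d‖ ≤ 1 := norm_sub_le_of_le norm_one.le hd
  rcases hle.lt_or_eq with h | h
  · obtain ⟨θ, hθ, hθ1⟩ := exists_norm_sub_sigma_eq_one σ hunr hσ
    have hθn : ‖θ‖ = 1 := by
      refine le_antisymm hθ ?_
      rw [← hθ1]
      exact norm_sub_le_of_le le_rfl (norm_sigma σ θ).le
    have hθ0 : θ ≠ 0 := by rw [← norm_pos_iff, hθn]; exact one_pos
    have hsθ0 : σ θ ≠ 0 := by simpa using hθ0
    have hζ : ‖σ θ / θ‖ = 1 := by rw [norm_div, norm_sigma, hθn, div_one]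
    refine ⟨σ θ / θ, ?_, hζ, ?_⟩
    · rw [map_div₀, sigma_sigma]; field_simp
    · refine norm_eq_one_of_norm_sub_lt (x := 1 - σ θ / θ) ?_ ?_
      · rw [one_sub_div hθ0, norm_div, hθ1, hθn, div_one]
      · rw [show 1 - σ θ / θ - (1 - σ θ / θ * d) = -(σ θ / θ * (1 - d)) by ring, norm_neg,
          norm_mul, hζ, one_mul]
        exact h
  · exact ⟨1, by simp, by simp, by simpa using h⟩

/-- tθ/(θ - σθ) has trace t and is integral; if it is not a unit, adding the unit θ - σθ of trace
zero makes it one. There is no division by 2, so p = 2 is covered. -/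
theorem exists_norm_eq_one_add_sigma_eq (hunr : IsUnramified F₀ F) (hσ : σ ≠ AlgEquiv.refl)
    {t : F} (ht : ‖t‖ ≤ 1) (hσt : σ t = t) : ∃ τ : F, ‖τ‖ = 1 ∧ τ + σ τ = t := by
  obtain ⟨θ, hθ, hθ1⟩ := exists_norm_sub_sigma_eq_one σ hunr hσ
  have h0 : θ - σ θ ≠ 0 := by rw [← norm_pos_iff, hθ1]; exact one_pos
  have h0' : σ θ - θ ≠ 0 := by rwa [← neg_sub, neg_ne_zero]
  have e0 : t * θ / (θ - σ θ) + σ (t * θ / (θ - σ θ)) = t := by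
    rw [map_div₀, map_mul, map_sub, sigma_sigma, hσt, ← neg_sub θ (σ θ), div_neg, ← sub_eq_add_neg,
      ← sub_div, ← mul_sub, mul_div_cancel_right₀ _ h0]
  have hle : ‖t * θ / (θ - σ θ)‖ ≤ 1 := by
    rw [norm_div, hθ1, div_one]; exact norm_mul_le_one ht hθ
  rcases hle.lt_or_eq with h | h
  · refine ⟨t * θ / (θ - σ θ) + (θ - σ θ), ?_, ?_⟩
    · refine norm_eq_one_of_norm_sub_lt hθ1 ?_
      rwa [← norm_neg, neg_sub, add_sub_cancel_right]
    · rw [map_add, map_sub, sigma_sigma, add_add_add_comm, e0]; ring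
  · exact ⟨_, h, e0⟩

end Quadratic
end FieldFacts

/-! ### Hilbert's theorem 90 for semilocal rings -/

section HilbertNinety

theorem finite_maximalSpectrum_of_finite (R A : Type*) [CommRing R] [IsLocalRing R] [CommRing A]
    [Algebra R A] [Module.Finite R A] : Finite (MaximalSpectrum A) := by
  have hf := Algebra.QuasiFinite.finite_primesOver (S := A) (IsLocalRing.maximalIdeal R)
  have := hf.to_subtype
  refine Finite.of_injective (β := (IsLocalRing.maximalIdeal R).primesOver A)
    (fun m => ⟨m.asIdeal, m.isMaximal.isPrime, ⟨?_⟩⟩) ?_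
  · have := m.isMaximal
    exact (IsLocalRing.eq_maximalIdeal (Ideal.isMaximal_comap_of_isIntegral_of_isMaximal
      (R := R) m.asIdeal)).symm
  · intro m n h
    exact MaximalSpectrum.ext (congrArg (fun q : (IsLocalRing.maximalIdeal R).primesOver A => q.1) h)

/-- Distinct maximal ideals are not contained in one another, so for each n ≠ m there is an element
of n outside m; the product of these works because m is prime. -/
theorem exists_notMem_forall_mem {A : Type*} [CommRing A] [Finite (MaximalSpectrum A)]
    (m : MaximalSpectrum A) : ∃ e, e ∉ m.asIdeal ∧ ∀ n : MaximalSpectrum A, n ≠ m → e ∈ n.asIdeal := by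
  classical
  have := Fintype.ofFinite (MaximalSpectrum A)
  have h : ∀ n : MaximalSpectrum A, ∃ a, a ∉ m.asIdeal ∧ (n ≠ m → a ∈ n.asIdeal) := by
    intro n
    by_cases hn : n = m
    · exact ⟨1, fun h => m.isMaximal.ne_top ((Ideal.eq_top_iff_one _).2 h), fun h => absurd hn h⟩
    · have : ¬ n.asIdeal ≤ m.asIdeal := fun hle =>
        hn (MaximalSpectrum.ext (n.isMaximal.eq_of_le m.isMaximal.ne_top hle))
      obtain ⟨a, ha, ha'⟩ := Set.not_subset.1 this
      exact ⟨a, ha', fun _ => ha⟩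
  choose a ha ha' using h
  refine ⟨∏ n, a n, ?_, fun n hn => ?_⟩
  · rw [m.isMaximal.isPrime.prod_mem_iff]
    rintro ⟨n, -, hn⟩
    exact ha n hn
  · exact Ideal.mem_of_dvd _ (Finset.dvd_prod_of_mem a (Finset.mem_univ n)) (ha' n hn)

/-- Hilbert's theorem 90 for the units of a semilocal ring with an involution that is nowhere
residually trivial. -/
theorem exists_isUnit_add_mul {A : Type*} [CommRing A] [Finite (MaximalSpectrum A)] (s : A →+* A)
    (hs : ∀ x, s (s x) = x) {g : A} (hg : g * s g = 1) {θ : A} (hθ : IsUnit (θ - s θ)) :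
    ∃ x, IsUnit (x + g * s x) := by
  -- Z x is the set of maximal ideals obstructing x + g s(x) from being a unit. At an x with the
  -- fewest obstructions, a remaining obstruction m can be removed without creating new ones.
  let Z : A → Set (MaximalSpectrum A) := fun x => {m | x + g * s x ∈ m.asIdeal}
  obtain ⟨x, hx⟩ : ∃ x, ∀ y, (Z x).ncard ≤ (Z y).ncard :=
    ⟨Function.argmin (fun x => (Z x).ncard), fun y => Function.argmin_le (fun x => (Z x).ncard) y⟩
  refine ⟨x, ?_⟩
  by_contra hu
  obtain ⟨M, hM, hxM⟩ := exists_max_ideal_of_mem_nonunits hu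
  let m : MaximalSpectrum A := ⟨M, hM⟩
  obtain ⟨e, he, he'⟩ := exists_notMem_forall_mem m
  have hsurj : Function.Surjective s := fun y => ⟨s y, hs y⟩
  let t : MaximalSpectrum A → MaximalSpectrum A := fun n =>
    ⟨n.asIdeal.comap s, have := n.isMaximal; Ideal.comap_isMaximal_of_surjective s hsurj⟩
  have ht : ∀ n y, y ∈ (t n).asIdeal ↔ s y ∈ n.asIdeal := fun n y => Iff.rfl
  have htt : ∀ n, t (t n) = n := fun n =>
    MaximalSpectrum.ext (Ideal.ext fun y => by rw [ht, ht, hs])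
  -- The correction r must change x + g s(x) at m and nothing outside {m, t m}. No control at t m is
  -- needed, since t m already belongs to Z x.
  obtain ⟨r, hr, hr'⟩ : ∃ r, r + g * s r ∉ M ∧
      ∀ n, n ≠ m → n ≠ t m → r + g * s r ∈ n.asIdeal := by
    by_cases hm : t m = m
    · have hse : s e ∉ M := fun h => he (by rw [← hm]; exact h)
      have hin : ∀ c n, n ≠ m → n ≠ t m →
          c * (e * s e) + g * s (c * (e * s e)) ∈ n.asIdeal := by
        intro c n hn _
        have h1 : e * s e ∈ n.asIdeal := Ideal.mul_mem_right _ _ (he' n hn)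
        refine add_mem (Ideal.mul_mem_left _ _ h1) (Ideal.mul_mem_left _ _ ?_)
        rw [map_mul, map_mul, hs, mul_comm (s e)]
        exact Ideal.mul_mem_left _ _ h1
      have hee : e * s e ∉ M := fun h => (hM.isPrime.mem_or_mem h).elim he hse
      by_contra! hcon
      -- If m is fixed by t, then e s(e) is s-invariant and localizes c at m. Should every c fail,
      -- the cases c = θ and c = 1 give θ - s(θ) = (θ + g s(θ)) - s(θ)(1 + g) ∈ M, although θ - s(θ)
      -- is a unit.
      have h1 : ∀ c, c + g * s c ∈ M := by
        intro c
        have h2 : c * (e * s e) + g * s (c * (e * s e)) ∈ M := by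
          by_contra h3
          obtain ⟨n, hn1, hn2, hn3⟩ := hcon _ h3
          exact hn3 (hin c n hn1 hn2)
        rw [map_mul, map_mul, hs, show c * (e * s e) + g * (s c * (s e * e)) =
          (c + g * s c) * (e * s e) by ring] at h2
        exact (hM.isPrime.mem_or_mem h2).resolve_right hee
      have h2 : θ - s θ ∈ M := by
        have := sub_mem (h1 θ) (Ideal.mul_mem_left _ (s θ) (h1 1))
        rw [map_one] at this
        convert this using 1
        ring
      exact hM.ne_top (Ideal.eq_top_of_isUnit_mem _ h2 hθ)
    · refine ⟨e, fun h => he ?_, fun n hn hn' => ?_⟩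
      · have h1 : s e ∈ M := (ht m e).1 (he' (t m) hm)
        exact (Ideal.add_mem_iff_left _ (Ideal.mul_mem_left _ _ h1)).1 h
      · refine add_mem (he' n hn) (Ideal.mul_mem_left _ _ ((ht n e).1 (he' (t n) ?_)))
        rintro h
        exact hn' (by rw [← h, htt])
  have hlt : (Z (x + r)).ncard < (Z x).ncard := by
    refine Set.ncard_lt_ncard ⟨fun n hn => ?_, fun hsub => ?_⟩ (Set.toFinite _)
    · by_cases h1 : n = m
      · rw [h1]; exact hxM
      by_cases h2 : n = t m
      · rw [h2]
        change s (x + g * s x) ∈ M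
        -- This semi-invariance, a consequence of g s(g) = 1, shows that Z x is stable under t.
        have : s (x + g * s x) = s g * (x + g * s x) := by
          rw [map_add, map_mul, hs, mul_add, ← mul_assoc, mul_comm (s g) g, hg, one_mul, add_comm]
        rw [this]
        exact Ideal.mul_mem_left _ _ hxM
      · have h3 : (x + r) + g * s (x + r) ∈ n.asIdeal := hn
        rw [map_add, mul_add, add_add_add_comm] at h3
        exact (Ideal.add_mem_iff_left _ (hr' n h1 h2)).1 h3
    · have h3 : (x + r) + g * s (x + r) ∈ M := hsub (a := m) hxM
      rw [map_add, mul_add, add_add_add_comm] at h3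
      exact hr ((Ideal.add_mem_iff_right _ hxM).1 h3)
  exact hlt.not_ge (hx _)

end HilbertNinety

/-! ### Conjugation of endomorphisms -/

section Conjugation

theorem integers_isUnit_iff {K : Type*} [NormedField K] [IsUltrametricDist K] {x : integers K} :
    IsUnit x ↔ ‖(x : K)‖ = 1 := by
  constructor
  · rintro ⟨u, rfl⟩
    have h1 := mem_integers_iff.1 u.1.2
    have h2 := mem_integers_iff.1 u.2.2
    have h3 : ‖(u.1 : K)‖ * ‖(u.2 : K)‖ = 1 := by
      rw [← norm_mul, ← norm_one (α := K)]
      exact congrArg (fun z : integers K => ‖(z : K)‖) u.mul_inv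
    have := norm_nonneg (u.2 : K)
    have := norm_nonneg (u.1 : K)
    change ‖(u.1 : K)‖ = 1
    nlinarith
  · intro h
    have h0 : (x : K) ≠ 0 := by rw [← norm_pos_iff, h]; exact one_pos
    refine IsUnit.of_mul_eq_one ⟨(x : K)⁻¹, ?_⟩ (Subtype.ext (mul_inv_cancel₀ h0))
    rw [mem_integers_iff, norm_inv, h, inv_one]

instance integers_isLocalRing {K : Type*} [NormedField K] [IsUltrametricDist K] :
    IsLocalRing (integers K) := by
  refine IsLocalRing.of_isUnit_or_isUnit_one_sub_self fun x => ?_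
  rw [integers_isUnit_iff, integers_isUnit_iff]
  rcases (mem_integers_iff.1 x.2).lt_or_eq with h | h
  · right
    have := IsUltrametricDist.norm_eq_of_add_norm_lt_max (x := (1 : K)) (y := -(1 - x))
      (by rw [neg_sub, add_sub_cancel, norm_one]; exact h.trans_le (le_max_left _ _))
    rw [norm_neg, norm_one] at this
    exact this.symm
  · exact Or.inl h

/-- Multiplying a monic equation of degree m + 1 for u⁻¹ by u^m expresses u⁻¹ as a polynomial in u.
A monic equation of degree zero forces 1 = 0. -/
theorem inv_mem_adjoin_of_isIntegral {R E : Type*} [CommRing R] [Ring E] [Algebra R E] (u : Eˣ)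
    (h : IsIntegral R (u⁻¹ : Eˣ).1) : (u⁻¹ : Eˣ).1 ∈ Algebra.adjoin R {u.1} := by
  obtain ⟨p, hp, hp0⟩ := h
  rw [← Polynomial.aeval_def, Polynomial.aeval_eq_sum_range] at hp0
  rcases Nat.eq_zero_or_pos p.natDegree with h0 | h0
  · rw [h0] at hp0
    have h1 : p.coeff 0 = 1 := by have := hp.coeff_natDegree; rwa [h0] at this
    simp only [zero_add, Finset.sum_range_one, h1, pow_zero, one_smul] at hp0
    have : (u⁻¹ : Eˣ).1 = 0 := by rw [← mul_one (u⁻¹ : Eˣ).1, hp0, mul_zero]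
    rw [this]
    exact zero_mem _
  · obtain ⟨m, hm⟩ := Nat.exists_eq_add_of_lt h0
    rw [zero_add] at hm
    rw [Finset.sum_range_succ, hp.coeff_natDegree, one_smul, hm] at hp0
    have h2 := congrArg (fun z => z * u.1 ^ m) hp0
    simp only [add_mul, zero_mul, Finset.sum_mul] at h2
    have h3 : ((u⁻¹ : Eˣ).1) ^ (m + 1) * u.1 ^ m = (u⁻¹ : Eˣ).1 := by
      have : (u⁻¹ ^ (m + 1) * u ^ m : Eˣ) = u⁻¹ := by rw [pow_succ']; simp [mul_assoc]
      exact congrArg Units.val this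
    rw [h3] at h2
    rw [eq_neg_of_add_eq_zero_right h2]
    refine neg_mem (sum_mem fun i hi => ?_)
    rw [smul_mul_assoc]
    refine Subalgebra.smul_mem _ ?_ _
    have hi' : i ≤ m := Nat.lt_succ_iff.1 (Finset.mem_range.1 hi)
    obtain ⟨d, hd⟩ := Nat.exists_eq_add_of_le hi'
    have h4 : ((u⁻¹ : Eˣ).1) ^ i * u.1 ^ m = u.1 ^ d := by
      have : (u⁻¹ ^ i * u ^ m : Eˣ) = u ^ d := by
        rw [hd, pow_add, inv_pow, inv_mul_cancel_left]
      exact congrArg Units.val this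
    rw [h4]
    exact Subalgebra.pow_mem _ (Algebra.self_mem_adjoin_singleton R u.1) d

variable {F₀ F : Type*} [NontriviallyNormedField F₀] [IsUltrametricDist F₀]
  [LocallyCompactSpace F₀] [NontriviallyNormedField F] [IsUltrametricDist F]
  [LocallyCompactSpace F] [NormedAlgebra F₀ F] [Algebra.IsQuadraticExtension F₀ F]
  {σ : F ≃ₐ[F₀] F} {V : Type*} [AddCommGroup V] [Module F V]

theorem algebraMap_integers (r : integers F) : algebraMap (integers F) F r = r := rfl

/-- The matrix of f lies in the matrix algebra over O_F, a finite O_F-module, where every element is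
integral. -/
theorem isIntegral_of_repr_mem {ι : Type*} [Fintype ι] [DecidableEq ι] (b : Module.Basis ι F V)
    {f : Module.End F V} (hf : ∀ i j, b.repr (f (b j)) i ∈ integers F) :
    IsIntegral (integers F) f := by
  let M : Matrix ι ι (integers F) := Matrix.of fun i j => ⟨_, hf i j⟩
  have hM : IsIntegral (integers F) M := IsIntegral.of_finite _ _
  let φ : Matrix ι ι (integers F) →ₐ[integers F] Module.End F V :=
    (((LinearMap.toMatrixAlgEquiv b).symm.toAlgHom).restrictScalars (integers F)).comp
      (Algebra.ofId (integers F) F).mapMatrix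
  have : φ M = f := by
    change (LinearMap.toMatrixAlgEquiv b).symm _ = f
    rw [AlgEquiv.symm_apply_eq]
    ext i j
    simp [M, LinearMap.toMatrixAlgEquiv_apply, Algebra.ofId_apply, algebraMap_integers]
  rw [← this]
  exact hM.map φ

namespace OrthBasis

variable {h : SesqForm σ V} {n : ℕ} (B : OrthBasis h n)

theorem mem_lattice_iff {x : V} : x ∈ B.lattice ↔ ∀ i, B.basis.repr x i ∈ integers F := by
  rw [lattice, Module.Basis.mem_span_iff_repr_mem]
  simp [algebraMap_integers]

theorem basis_mem_lattice (i : Fin n) : B.basis i ∈ B.lattice := Submodule.subset_span ⟨i, rfl⟩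

theorem repr_conj (x : V) (i : Fin n) : B.basis.repr (B.conj x) i = σ (B.basis.repr x i) := by
  simp [OrthBasis.conj, Finsupp.single_apply]

theorem conj_conj (x : V) : B.conj (B.conj x) = x := by
  refine B.basis.repr.injective (Finsupp.ext fun i => ?_)
  rw [repr_conj, repr_conj, sigma_sigma]

theorem conj_add (x y : V) : B.conj (x + y) = B.conj x + B.conj y := by
  refine B.basis.repr.injective (Finsupp.ext fun i => ?_)
  simp [repr_conj]

theorem conj_smul (c : F) (x : V) : B.conj (c • x) = σ c • B.conj x := by
  refine B.basis.repr.injective (Finsupp.ext fun i => ?_)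
  simp [repr_conj]

theorem conj_basis (i : Fin n) : B.conj (B.basis i) = B.basis i := by
  refine B.basis.repr.injective (Finsupp.ext fun j => ?_)
  rw [repr_conj, B.basis.repr_self]
  by_cases hij : i = j
  · subst hij; simp
  · simp [Finsupp.single_eq_of_ne' hij]

theorem conj_zero : B.conj 0 = 0 := by
  simpa using B.conj_smul 0 0

/-- The conjugation `f ↦ f̄` of `End(V)`. -/
noncomputable def bar : Module.End F V →+* Module.End F V where
  toFun f :=
    { toFun := fun x => B.conj (f (B.conj x))
      map_add' := fun x y => by rw [conj_add, map_add, conj_add]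
      map_smul' := fun c x => by
        rw [conj_smul, map_smul, conj_smul, sigma_sigma, RingHom.id_apply] }
  map_one' := LinearMap.ext fun x => B.conj_conj x
  map_zero' := LinearMap.ext fun x => B.conj_zero
  map_add' f g := LinearMap.ext fun x => B.conj_add _ _
  map_mul' f g := LinearMap.ext fun x => by
    change B.conj (f (g (B.conj x))) = B.conj (f (B.conj (B.conj (g (B.conj x)))))
    rw [conj_conj]

theorem bar_apply (f : Module.End F V) (x : V) : B.bar f x = B.conj (f (B.conj x)) := rfl

theorem bar_bar (f : Module.End F V) : B.bar (B.bar f) = f :=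
  LinearMap.ext fun x => by rw [bar_apply, bar_apply, conj_conj, conj_conj]

theorem bar_smul (c : F) (f : Module.End F V) : B.bar (c • f) = σ c • B.bar f :=
  LinearMap.ext fun x => by
    rw [bar_apply, LinearMap.smul_apply, conj_smul, LinearMap.smul_apply, bar_apply]

theorem conj_apply (f : Module.End F V) (x : V) : B.conj (f x) = B.bar f (B.conj x) := by
  rw [bar_apply, conj_conj]

theorem mem_S_iff {γ : LinearMap.GeneralLinearGroup F V} : γ ∈ B.S ↔ γ.1 * B.bar γ.1 = 1 :=
  ⟨fun H => LinearMap.ext fun x => H x, fun H x => LinearMap.congr_fun H x⟩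

theorem mem_S_iff' {γ : LinearMap.GeneralLinearGroup F V} : γ ∈ B.S ↔ B.bar γ.1 = γ⁻¹.1 := by
  rw [mem_S_iff]
  exact ⟨fun H => (Units.inv_eq_of_mul_eq_one_right H).symm, fun H => H ▸ γ.mul_inv⟩

theorem mem_GL₀_iff {g : LinearMap.GeneralLinearGroup F V} : g ∈ B.GL₀ ↔ B.bar g.1 = g.1 := by
  refine ⟨fun H => LinearMap.ext fun x => ?_, fun H x => ?_⟩
  · have : g.1 (B.conj x) = B.conj (g.1 x) := H x
    rw [bar_apply, this, conj_conj]
  · rw [conj_apply, H]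

end OrthBasis

theorem stabilizes_iff {g : LinearMap.GeneralLinearGroup F V} {L : Set V} :
    Stabilizes g L ↔ (∀ x ∈ L, g.1 x ∈ L) ∧ ∀ x ∈ L, g⁻¹.1 x ∈ L := by
  have e : ∀ z, g.1 (g⁻¹.1 z) = z := fun z => LinearMap.congr_fun g.mul_inv z
  have e' : ∀ z, g⁻¹.1 (g.1 z) = z := fun z => LinearMap.congr_fun g.inv_mul z
  refine ⟨fun H => ⟨fun x hx => H ▸ ⟨x, hx, rfl⟩, fun x hx => ?_⟩, fun H => ?_⟩
  · obtain ⟨y, hy, rfl⟩ : x ∈ (fun x => g.1 x) '' L := by rw [Stabilizes] at H; rwa [H]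
    change g⁻¹.1 (g.1 y) ∈ L
    rwa [e']
  · refine Set.Subset.antisymm ?_ fun x hx => ⟨g⁻¹.1 x, H.2 x hx, e x⟩
    rintro - ⟨x, hx, rfl⟩
    exact H.1 x hx

namespace OrthBasis

variable {h : SesqForm σ V} {n : ℕ} (B : OrthBasis h n)

/-- In the basis k eᵢ the matrix of γ is that of k⁻¹γk in the basis eᵢ, which is integral. -/
theorem isIntegral_of_stabilizes {γ k : LinearMap.GeneralLinearGroup F V}
    (hk : ∀ x ∈ B.lattice, (k⁻¹ * γ * k).1 x ∈ B.lattice) : IsIntegral (integers F) γ.1 := by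
  refine isIntegral_of_repr_mem
    (B.basis.map (LinearMap.GeneralLinearGroup.generalLinearEquiv F V k)) fun i j => ?_
  exact B.mem_lattice_iff.1 (hk _ (B.basis_mem_lattice j)) i

open scoped IsMulCommutative in
/-- Hilbert's theorem 90 for the order generated by an integral element of `S(V₀)`. -/
theorem exists_aeval_eq_mul_bar {γ : LinearMap.GeneralLinearGroup F V} (hγ : γ ∈ B.S)
    (hi : IsIntegral (integers F) γ.1) (hi' : IsIntegral (integers F) γ⁻¹.1)
    {θ : F} (hθ : ‖θ‖ ≤ 1) (hθ1 : ‖θ - σ θ‖ = 1) :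
    ∃ P Q : Polynomial (integers F), Polynomial.aeval γ.1 P * Polynomial.aeval γ.1 Q = 1 ∧
      γ.1 * B.bar (Polynomial.aeval γ.1 P) = Polynomial.aeval γ.1 P := by
  let A := Algebra.adjoin (integers F) {γ.1}
  have hfin : Module.Finite (integers F) A := Module.Finite.of_fg hi.fg_adjoin_singleton
  have : Finite (MaximalSpectrum A) := finite_maximalSpectrum_of_finite (integers F) A
  -- The order O_F[γ] is stable under conjugation because γ̄ = γ⁻¹, and γ⁻¹ ∈ O_F[γ] by integrality.
  have hbar : ∀ x ∈ A, B.bar x ∈ A := by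
    intro x hx
    induction hx using Algebra.adjoin_induction with
    | mem x hx =>
      obtain rfl : x = γ.1 := hx
      rw [B.mem_S_iff'.1 hγ]
      exact inv_mem_adjoin_of_isIntegral γ hi'
    | algebraMap r =>
      have : B.bar (algebraMap (integers F) (Module.End F V) r) =
          algebraMap (integers F) (Module.End F V) ⟨σ r, sigma_mem_integers σ r.2⟩ := by
        have e : ∀ r : integers F, algebraMap (integers F) (Module.End F V) r = (r : F) • 1 :=
          fun r => Algebra.algebraMap_eq_smul_one (r : integers F)
        rw [e, e, bar_smul, map_one]
      rw [this]
      exact Subalgebra.algebraMap_mem _ _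
    | add x y _ _ hx hy => rw [map_add]; exact add_mem hx hy
    | mul x y _ _ hx hy => rw [map_mul]; exact mul_mem hx hy
  let s : A →+* A := (B.bar.comp A.val.toRingHom).codRestrict A.toSubring fun x => hbar x x.2
  have hs : ∀ x : A, (s x : Module.End F V) = B.bar x := fun x => rfl
  let g : A := ⟨γ.1, Algebra.subset_adjoin rfl⟩
  have hg : g * s g = 1 := Subtype.ext (B.mem_S_iff.1 hγ)
  -- The scalar θ shows that the involution of O_F[γ] is residually nontrivial at every maximal
  -- ideal it fixes.
  let t : A := algebraMap (integers F) A ⟨θ, mem_integers_iff.2 hθ⟩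
  have ht : IsUnit (t - s t) := by
    have e : t - s t = algebraMap (integers F) A ⟨θ - σ θ, mem_integers_iff.2 hθ1.le⟩ := by
      refine Subtype.ext ?_
      change (θ • (1 : Module.End F V)) - B.bar (θ • 1) = (θ - σ θ) • 1
      rw [bar_smul, map_one, sub_smul]
    rw [e]
    exact (integers_isUnit_iff.2 hθ1).map _
  obtain ⟨x, hx⟩ := exists_isUnit_add_mul s (fun x => Subtype.ext (B.bar_bar x)) hg ht
  obtain ⟨y, hy⟩ := hx.exists_right_inv
  have hrange : ∀ z : A, ∃ P : Polynomial (integers F), Polynomial.aeval γ.1 P = z := by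
    intro z
    have hz : (z : Module.End F V) ∈ Algebra.adjoin (integers F) {γ.1} := z.2
    rw [Algebra.adjoin_singleton_eq_range_aeval] at hz
    exact hz
  obtain ⟨P, hP⟩ := hrange (x + g * s x)
  obtain ⟨Q, hQ⟩ := hrange y
  refine ⟨P, Q, ?_, ?_⟩
  · rw [hP, hQ]
    exact congrArg Subtype.val hy
  · rw [hP]
    change γ.1 * B.bar (x + γ.1 * B.bar x) = x + γ.1 * B.bar x
    rw [map_add, map_mul, bar_bar, mul_add, ← mul_assoc, B.mem_S_iff.1 hγ, one_mul, add_comm]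

end OrthBasis
end Conjugation

/-! ### Factorization through a reflection -/

section Reflection

theorem gl_mul_apply {F V : Type*} [Field F] [AddCommGroup V] [Module F V]
    (g k : LinearMap.GeneralLinearGroup F V) (x : V) : (g * k).1 x = g.1 (k.1 x) := rfl

theorem gl_apply_inv_apply {F V : Type*} [Field F] [AddCommGroup V] [Module F V]
    (g : LinearMap.GeneralLinearGroup F V) (x : V) : g.1 (g⁻¹.1 x) = x :=
  LinearMap.congr_fun g.mul_inv x

theorem gl_inv_apply_apply {F V : Type*} [Field F] [AddCommGroup V] [Module F V]
    (g : LinearMap.GeneralLinearGroup F V) (x : V) : g⁻¹.1 (g.1 x) = x :=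
  LinearMap.congr_fun g.inv_mul x

theorem gl_ext {F V : Type*} [Field F] [AddCommGroup V] [Module F V]
    {g k : LinearMap.GeneralLinearGroup F V} (H : ∀ x, g.1 x = k.1 x) : g = k :=
  Units.ext (LinearMap.ext H)

variable {F : Type*} [NontriviallyNormedField F] {V : Type*} [AddCommGroup V] [Module F V]

/-- The linear form `(z, s) ↦ s - l(z) / a` on `V × F`. -/
def reflForm (a : F) (l : Module.Dual F V) : Module.Dual F (V × F) :=
  LinearMap.snd F V F - a⁻¹ • l.comp (LinearMap.fst F V F)

/-- The quasi-reflection `1 + τ⁻¹ (u - e) ⊗ (e^* - l / a)` of `V × F`. -/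
def refl (a τ : F) (u : V) (l : Module.Dual F V) : Module.End F (V × F) :=
  1 + τ⁻¹ • (reflForm a l).smulRight (u, -1)

theorem refl_apply (a τ : F) (u : V) (l : Module.Dual F V) (x : V × F) :
    refl a τ u l x = (x.1 + (τ⁻¹ * (x.2 - a⁻¹ * l x.1)) • u, x.2 - τ⁻¹ * (x.2 - a⁻¹ * l x.1)) := by
  refine Prod.ext ?_ ?_
  · simp [refl, reflForm, smul_smul]
  · simp [refl, reflForm]; ring

/-- Put N = (u - e) ⊗ (e^* - l/a). Its form takes the value -(1 + l(u)/a) = -(τ + τ') at u - e, so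
N² = -(τ + τ')N. In (1 + τ⁻¹N)(1 + τ'⁻¹N) the coefficient of N is τ⁻¹ + τ'⁻¹ - (τ + τ')/(ττ') = 0.
-/
theorem refl_mul_refl {a τ τ' : F} (hτ : τ ≠ 0) (hτ' : τ' ≠ 0) {u : V} {l : Module.Dual F V}
    (H : τ + τ' = 1 + a⁻¹ * l u) : refl a τ u l * refl a τ' u l = 1 := by
  have e : a⁻¹ * l u = τ + τ' - 1 := by rw [H]; ring
  refine LinearMap.ext fun x => ?_
  have key : ∀ m : F, τ⁻¹ * (x.2 - τ'⁻¹ * m - (a⁻¹ * l x.1 + τ'⁻¹ * m * (a⁻¹ * l u))) + τ'⁻¹ * m =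
      τ⁻¹ * (x.2 - a⁻¹ * l x.1 - m) := by
    intro m
    rw [e]
    field_simp
    ring
  have key' := key (x.2 - a⁻¹ * l x.1)
  rw [sub_self, mul_zero] at key'
  have e2 : a⁻¹ * l (x.1 + (τ'⁻¹ * (x.2 - a⁻¹ * l x.1)) • u) =
      a⁻¹ * l x.1 + τ'⁻¹ * (x.2 - a⁻¹ * l x.1) * (a⁻¹ * l u) := by
    rw [map_add, map_smul, smul_eq_mul]; ring
  rw [Module.End.mul_apply, refl_apply a τ' u l x, refl_apply]
  refine Prod.ext ?_ ?_
  · change x.1 + _ + (τ⁻¹ * (_ - a⁻¹ * l (x.1 + _))) • u = x.1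
    rw [e2, add_assoc, ← add_smul, add_comm (τ'⁻¹ * _), key', zero_smul, add_zero]
  · change x.2 - _ - τ⁻¹ * (_ - a⁻¹ * l (x.1 + _)) = x.2
    rw [e2]
    linear_combination -key'

theorem glEmb_apply (g : LinearMap.GeneralLinearGroup F V) (x : V × F) :
    (glEmb g).1 x = (g.1 x.1, x.2) := rfl

/-- The triples `(g, u, l)` with `τ + τ' = 1 + l(u) / a`. -/
def tripleSet (V : Type*) [AddCommGroup V] [Module F V] (a τ τ' : F) :
    Set (LinearMap.GeneralLinearGroup F V × V × Module.Dual F V) :=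
  {t | τ + τ' = 1 + a⁻¹ * t.2.2 t.2.1}

variable {a τ τ' : F}

/-- The element `ρ ∘ (g ⊕ 1)` of `GL(V × F)`, where `ρ` is the quasi-reflection attached
to `(u, l)`. -/
def psi (hτ : τ ≠ 0) (hτ' : τ' ≠ 0) (t : tripleSet V a τ τ') :
    LinearMap.GeneralLinearGroup F (V × F) :=
  ⟨refl a τ t.1.2.1 t.1.2.2, refl a τ' t.1.2.1 t.1.2.2, refl_mul_refl hτ hτ' t.2,
    refl_mul_refl hτ' hτ ((add_comm _ _).trans t.2)⟩ * glEmb t.1.1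

section

variable (hτ : τ ≠ 0) (hτ' : τ' ≠ 0)

theorem psi_apply (t : tripleSet V a τ τ') (x : V × F) :
    (psi hτ hτ' t).1 x =
      (t.1.1.1 x.1 + (τ⁻¹ * (x.2 - a⁻¹ * t.1.2.2 (t.1.1.1 x.1))) • t.1.2.1,
        x.2 - τ⁻¹ * (x.2 - a⁻¹ * t.1.2.2 (t.1.1.1 x.1))) :=
  refl_apply _ _ _ _ _

theorem psi_inv_apply (t : tripleSet V a τ τ') (x : V × F) :
    (psi hτ hτ' t)⁻¹.1 x =
      (t.1.1⁻¹.1 (x.1 + (τ'⁻¹ * (x.2 - a⁻¹ * t.1.2.2 x.1)) • t.1.2.1),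
        x.2 - τ'⁻¹ * (x.2 - a⁻¹ * t.1.2.2 x.1)) := by
  rw [psi, mul_inv_rev, ← map_inv, gl_mul_apply, glEmb_apply]
  change (t.1.1⁻¹.1 (refl a τ' t.1.2.1 t.1.2.2 x).1, (refl a τ' t.1.2.1 t.1.2.2 x).2) = _
  rw [refl_apply]

theorem actS_mem_tripleSet (k : LinearMap.GeneralLinearGroup F V)
    {t : LinearMap.GeneralLinearGroup F V × V × Module.Dual F V} (ht : t ∈ tripleSet V a τ τ') :
    actS k t ∈ tripleSet V a τ τ' := by
  change τ + τ' = 1 + a⁻¹ * t.2.2 (k.1 (k⁻¹.1 t.2.1))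
  rw [gl_apply_inv_apply]
  exact ht

theorem actG_psi (k : LinearMap.GeneralLinearGroup F V) (t : tripleSet V a τ τ') :
    actG k (psi hτ hτ' t) = psi hτ hτ' ⟨actS k t.1, actS_mem_tripleSet k t.2⟩ := by
  refine gl_ext fun x => ?_
  rw [actG, ← map_inv, gl_mul_apply, gl_mul_apply, glEmb_apply, glEmb_apply, psi_apply, psi_apply]
  change (k⁻¹.1 _, _) = (k⁻¹.1 (t.1.1.1 (k.1 x.1)) + (τ⁻¹ * (x.2 - a⁻¹ * t.1.2.2 (k.1 (k⁻¹.1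
    (t.1.1.1 (k.1 x.1)))))) • k⁻¹.1 t.1.2.1, x.2 - τ⁻¹ * (x.2 - a⁻¹ * t.1.2.2 (k.1 (k⁻¹.1
    (t.1.1.1 (k.1 x.1))))))
  rw [map_add, map_smul, gl_apply_inv_apply]

/-- The first component of the inverse of `psi`. -/
def phiEnd (τ : F) (f : Module.End F (V × F)) : Module.End F V :=
  (LinearMap.fst F V F).comp (f.comp (LinearMap.inl F V F)) +
    τ • ((LinearMap.snd F V F).comp (f.comp (LinearMap.inl F V F))).smulRight (f (0, 1)).1

theorem phiEnd_apply (τ : F) (f : Module.End F (V × F)) (x : V) :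
    phiEnd τ f x = (f (x, 0)).1 + (τ * (f (x, 0)).2) • (f (0, 1)).1 := by
  simp [phiEnd, smul_smul]

/-- Over each x ∈ V there is exactly one vector (x, s) whose e-coordinate f preserves, namely s =
τ·(f(x, 0))₂; `phiEnd` is the V-component of its image. The inverse f' sends that image back to (x,
s), again preserving s, so the two constructions are mutually inverse. -/
theorem snd_apply_phiEnd (hτ' : τ' ≠ 0) {f f' : Module.End F (V × F)} (hf : f' * f = 1)
    (hd : (f (0, 1)).2 = 1 - τ⁻¹) (hd' : (f' (0, 1)).2 = 1 - τ'⁻¹) (hτ : τ ≠ 0) (x : V) :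
    τ' * (f' (phiEnd τ f x, 0)).2 = τ * (f (x, 0)).2 ∧
      (f' (phiEnd τ f x, 0)).1 = x - (τ * (f (x, 0)).2) • (f' (0, 1)).1 := by
  have h0 : ∀ (k : Module.End F (V × F)) (y : V) (s : F), k (y, s) = k (y, 0) + s • k (0, 1) := by
    intro k y s
    rw [← map_smul, ← map_add]; simp
  have h1 : f (x, τ * (f (x, 0)).2) = (phiEnd τ f x, τ * (f (x, 0)).2) := by
    rw [h0]
    refine Prod.ext ?_ ?_
    · rw [phiEnd_apply]; rfl
    · change (f (x, 0)).2 + τ * (f (x, 0)).2 * (f (0, 1)).2 = _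
      rw [hd]
      field_simp
      ring
  have h2 : f' (phiEnd τ f x, τ * (f (x, 0)).2) = (x, τ * (f (x, 0)).2) := by
    rw [← h1]; exact LinearMap.congr_fun hf _
  rw [h0] at h2
  have h3 := congrArg Prod.snd h2
  have h4 := congrArg Prod.fst h2
  change (f' (phiEnd τ f x, 0)).2 + τ * (f (x, 0)).2 * (f' (0, 1)).2 = _ at h3
  change (f' (phiEnd τ f x, 0)).1 + (τ * (f (x, 0)).2) • (f' (0, 1)).1 = x at h4
  constructor
  · rw [hd'] at h3
    field_simp at h3
    linear_combination h3
  · exact eq_sub_of_add_eq h4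

theorem phiEnd_mul_phiEnd (hτ : τ ≠ 0) (hτ' : τ' ≠ 0) {f f' : Module.End F (V × F)}
    (hf : f' * f = 1) (hd : (f (0, 1)).2 = 1 - τ⁻¹) (hd' : (f' (0, 1)).2 = 1 - τ'⁻¹) :
    phiEnd τ' f' * phiEnd τ f = 1 := by
  refine LinearMap.ext fun x => ?_
  obtain ⟨h1, h2⟩ := snd_apply_phiEnd hτ' hf hd hd' hτ x
  rw [Module.End.mul_apply, phiEnd_apply, h1, h2, sub_add_cancel]
  rfl

/-- The elements of `GL(V × F)` for which the diagonal coefficients at `e` of the element and of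
its inverse are `1 - τ⁻¹` and `1 - τ'⁻¹`. -/
def glSet (V : Type*) [AddCommGroup V] [Module F V] (τ τ' : F) :
    Set (LinearMap.GeneralLinearGroup F (V × F)) :=
  {γ | (γ.1 (0, 1)).2 = 1 - τ⁻¹ ∧ (γ⁻¹.1 (0, 1)).2 = 1 - τ'⁻¹}

/-- The inverse of `psi`. -/
def phi (a : F) (hτ : τ ≠ 0) (hτ' : τ' ≠ 0) (γ : glSet V τ τ') :
    LinearMap.GeneralLinearGroup F V × V × Module.Dual F V :=
  (⟨phiEnd τ γ.1.1, phiEnd τ' γ.1⁻¹.1, phiEnd_mul_phiEnd hτ' hτ γ.1.mul_inv γ.2.2 γ.2.1,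
    phiEnd_mul_phiEnd hτ hτ' γ.1.inv_mul γ.2.1 γ.2.2⟩, τ • (γ.1.1 (0, 1)).1,
    (a * τ') • (LinearMap.snd F V F).comp (γ.1⁻¹.1.comp (LinearMap.inl F V F)))

/-- The relation between τ, τ' and l(u) is the e-coordinate of γ⁻¹γe = e. -/
theorem phi_mem (ha : a ≠ 0) (γ : glSet V τ τ') : phi a hτ hτ' γ ∈ tripleSet V a τ τ' := by
  change τ + τ' = 1 + a⁻¹ * ((a * τ') * (γ.1⁻¹.1 (τ • (γ.1.1 (0, 1)).1, 0)).2)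
  have h0 : γ.1.1 (0, 1) = ((γ.1.1 (0, 1)).1, 0) + (γ.1.1 (0, 1)).2 • ((0 : V), (1 : F)) := by
    refine Prod.ext ?_ ?_ <;> simp
  have h1 := gl_inv_apply_apply γ.1 ((0 : V), (1 : F))
  rw [h0, map_add, map_smul] at h1
  have h2 := congrArg Prod.snd h1
  change (γ.1⁻¹.1 ((γ.1.1 (0, 1)).1, 0)).2 + (γ.1.1 (0, 1)).2 * (γ.1⁻¹.1 (0, 1)).2 = 1 at h2
  rw [γ.2.1, γ.2.2] at h2
  have h3 : ((τ • (γ.1.1 (0, 1)).1, 0) : V × F) = τ • ((γ.1.1 (0, 1)).1, 0) := by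
    refine Prod.ext ?_ ?_ <;> simp
  rw [h3, map_smul, Prod.smul_snd, smul_eq_mul, eq_sub_of_add_eq h2]
  field_simp
  ring

theorem psi_phi (ha : a ≠ 0) (γ : glSet V τ τ') :
    psi hτ hτ' ⟨phi a hτ hτ' γ, phi_mem hτ hτ' ha γ⟩ = γ.1 := by
  refine gl_ext fun x => ?_
  have h0 : γ.1.1 x = γ.1.1 (x.1, 0) + x.2 • γ.1.1 (0, 1) := by
    rw [← map_smul, ← map_add]; simp
  rw [psi_apply, h0]
  change (phiEnd τ γ.1.1 x.1 + (τ⁻¹ * (x.2 - a⁻¹ * (a * τ' * (γ.1⁻¹.1 (phiEnd τ γ.1.1 x.1, 0)).2))) •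
    τ • (γ.1.1 (0, 1)).1, x.2 - τ⁻¹ * (x.2 - a⁻¹ * (a * τ' *
      (γ.1⁻¹.1 (phiEnd τ γ.1.1 x.1, 0)).2))) = _
  obtain ⟨h1, -⟩ := snd_apply_phiEnd hτ' γ.1.inv_mul γ.2.1 γ.2.2 hτ x.1
  have h2 : a⁻¹ * (a * τ' * (γ.1⁻¹.1 (phiEnd τ γ.1.1 x.1, 0)).2) = τ * (γ.1.1 (x.1, 0)).2 := by
    rw [mul_assoc, inv_mul_cancel_left₀ ha]; exact h1
  rw [h2]
  refine Prod.ext ?_ ?_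
  · change _ + _ = (γ.1.1 (x.1, 0)).1 + x.2 • (γ.1.1 (0, 1)).1
    rw [phiEnd_apply, add_assoc, smul_smul, ← add_smul]
    congr 2
    field_simp
    ring
  · change _ = (γ.1.1 (x.1, 0)).2 + x.2 * (γ.1.1 (0, 1)).2
    rw [γ.2.1]
    field_simp
    ring

theorem psi_mem (t : tripleSet V a τ τ') : psi hτ hτ' t ∈ glSet V τ τ' := by
  constructor
  · rw [psi_apply]; simp
  · rw [psi_inv_apply]; simp

theorem phi_psi (ha : a ≠ 0) (t : tripleSet V a τ τ') :
    phi a hτ hτ' ⟨psi hτ hτ' t, psi_mem hτ hτ' t⟩ = t.1 := by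
  refine Prod.ext (gl_ext fun x => ?_) (Prod.ext ?_ (LinearMap.ext fun x => ?_))
  · change phiEnd τ _ x = _
    rw [phiEnd_apply, psi_apply, psi_apply]
    simp only [map_zero, mul_zero, sub_zero, mul_one, zero_add, zero_sub, smul_smul]
    rw [add_assoc, ← add_smul]
    convert add_zero _
    rw [smul_eq_zero]
    left
    field_simp
    ring
  · change τ • ((psi hτ hτ' t).1 (0, 1)).1 = _
    rw [psi_apply]
    simp [smul_smul, hτ]
  · change a * τ' * ((psi hτ hτ' t)⁻¹.1 (x, 0)).2 = _
    rw [psi_inv_apply]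
    simp only [zero_sub]
    field_simp

theorem psi_injective (ha : a ≠ 0) :
    Function.Injective (psi hτ hτ' : tripleSet V a τ τ' → _) := by
  intro t t' H
  refine Subtype.ext ?_
  rw [← phi_psi hτ hτ' ha t, ← phi_psi hτ hτ' ha t']
  congr 1
  exact Subtype.ext H

theorem inv_mem_tripleSet (t : tripleSet V a τ τ') :
    (t.1.1⁻¹, t.1.1⁻¹.1 t.1.2.1, t.1.2.2.comp t.1.1.1) ∈ tripleSet V a τ' τ := by
  change τ' + τ = 1 + a⁻¹ * t.1.2.2 (t.1.1.1 (t.1.1⁻¹.1 t.1.2.1))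
  rw [gl_apply_inv_apply, add_comm]
  exact t.2

/-- The inverse (g ⊕ 1)⁻¹ρ⁻¹ equals ((g ⊕ 1)⁻¹ρ⁻¹(g ⊕ 1))(g ⊕ 1)⁻¹, a quasi-reflection of the same
kind times g⁻¹ ⊕ 1, with τ and τ' exchanged. Statements about ψ therefore also give those about ψ⁻¹.
-/
theorem psi_inv (t : tripleSet V a τ τ') :
    (psi hτ hτ' t)⁻¹ = psi hτ' hτ ⟨_, inv_mem_tripleSet t⟩ := by
  refine gl_ext fun x => ?_
  rw [psi_inv_apply, psi_apply]
  change _ = (t.1.1⁻¹.1 x.1 + (τ'⁻¹ * (x.2 - a⁻¹ * t.1.2.2 (t.1.1.1 (t.1.1⁻¹.1 x.1)))) •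
    t.1.1⁻¹.1 t.1.2.1, x.2 - τ'⁻¹ * (x.2 - a⁻¹ * t.1.2.2 (t.1.1.1 (t.1.1⁻¹.1 x.1))))
  rw [gl_apply_inv_apply, map_add, map_smul]

theorem actG_inv (k : LinearMap.GeneralLinearGroup F V)
    (g : LinearMap.GeneralLinearGroup F (V × F)) : (actG k g)⁻¹ = actG k g⁻¹ := by
  simp [actG, mul_assoc]

theorem actG_apply_e_snd (k : LinearMap.GeneralLinearGroup F V)
    (g : LinearMap.GeneralLinearGroup F (V × F)) :
    ((actG k g).1 (0, 1)).2 = (g.1 (0, 1)).2 := by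
  rw [actG, ← map_inv, gl_mul_apply, gl_mul_apply, glEmb_apply, glEmb_apply, map_zero]

theorem actG_mem_glSet (k : LinearMap.GeneralLinearGroup F V)
    {γ : LinearMap.GeneralLinearGroup F (V × F)} (hγ : γ ∈ glSet V τ τ') :
    actG k γ ∈ glSet V τ τ' := by
  refine ⟨?_, ?_⟩
  · rw [actG_apply_e_snd]; exact hγ.1
  · rw [actG_inv, actG_apply_e_snd]; exact hγ.2

theorem phi_actG (ha : a ≠ 0) (k : LinearMap.GeneralLinearGroup F V) (γ : glSet V τ τ') :
    phi a hτ hτ' ⟨actG k γ, actG_mem_glSet k γ.2⟩ = actS k (phi a hτ hτ' γ) := by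
  have h1 := phi_psi hτ hτ' ha ⟨_, actS_mem_tripleSet k (phi_mem hτ hτ' ha γ)⟩
  refine Eq.trans ?_ h1
  congr 1
  refine Subtype.ext ?_
  refine Eq.trans ?_ (actG_psi hτ hτ' k ⟨_, phi_mem hτ hτ' ha γ⟩)
  rw [psi_phi hτ hτ' ha]

theorem phi_injective (ha : a ≠ 0) :
    Function.Injective (phi a hτ hτ' : glSet V τ τ' → _) := by
  intro γ γ' H
  refine Subtype.ext ?_
  rw [← psi_phi hτ hτ' ha γ, ← psi_phi hτ hτ' ha γ']
  congr 1
  exact Subtype.ext H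

end

theorem aeval_conj {R E : Type*} [CommRing R] [Ring E] [Algebra R E] (u : Eˣ) (x : E)
    (P : Polynomial R) : Polynomial.aeval (u⁻¹.1 * x * u.1) P =
      u⁻¹.1 * Polynomial.aeval x P * u.1 := by
  induction P using Polynomial.induction_on' with
  | add p q hp hq => rw [map_add, map_add, hp, hq, mul_add, add_mul]
  | monomial m r =>
    have hp : (u⁻¹.1 * x * u.1) ^ m = u⁻¹.1 * x ^ m * u.1 := Units.conj_pow' u x m
    rw [Polynomial.aeval_monomial, Polynomial.aeval_monomial, hp, ← mul_assoc, ← mul_assoc,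
      ← mul_assoc, Algebra.commutes r u⁻¹.1]

/-! ### Twisting vectors and covectors by polynomials in g -/

section Twist

variable {R : Type*} [CommRing R] [Algebra R (Module.End F V)]

/-- The map `(g, u, l) ↦ (g, P(g) u, l Q(g))`. -/
noncomputable def polyTwist (P Q : Polynomial R)
    (t : LinearMap.GeneralLinearGroup F V × V × Module.Dual F V) :
    LinearMap.GeneralLinearGroup F V × V × Module.Dual F V :=
  (t.1, Polynomial.aeval t.1.1 P t.2.1, t.2.2.comp (Polynomial.aeval t.1.1 Q))

/-- The triples with `P(g) Q(g) = 1`. -/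
def twistSet (V : Type*) [AddCommGroup V] [Module F V] [Algebra R (Module.End F V)]
    (P Q : Polynomial R) : Set (LinearMap.GeneralLinearGroup F V × V × Module.Dual F V) :=
  {t | Polynomial.aeval t.1.1 P * Polynomial.aeval t.1.1 Q = 1}

theorem aeval_mul_comm {E : Type*} [Ring E] [Algebra R E] (x : E) (P Q : Polynomial R) :
    Polynomial.aeval x P * Polynomial.aeval x Q = Polynomial.aeval x Q * Polynomial.aeval x P := by
  rw [← map_mul, ← map_mul, mul_comm]

theorem actS_mem_twistSet {P Q : Polynomial R} (k : LinearMap.GeneralLinearGroup F V)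
    {t : LinearMap.GeneralLinearGroup F V × V × Module.Dual F V} (ht : t ∈ twistSet V P Q) :
    actS k t ∈ twistSet V P Q := by
  change Polynomial.aeval (k⁻¹.1 * t.1.1 * k.1) P * Polynomial.aeval (k⁻¹.1 * t.1.1 * k.1) Q = 1
  rw [← map_mul, aeval_conj, map_mul, show _ = _ from ht, mul_one]
  exact k.inv_mul

theorem actS_polyTwist (P Q : Polynomial R) (k : LinearMap.GeneralLinearGroup F V)
    (t : LinearMap.GeneralLinearGroup F V × V × Module.Dual F V) :
    polyTwist P Q (actS k t) = actS k (polyTwist P Q t) := by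
  refine Prod.ext rfl (Prod.ext ?_ (LinearMap.ext fun x => ?_))
  · change Polynomial.aeval (k⁻¹.1 * t.1.1 * k.1) P (k⁻¹.1 t.2.1) =
      k⁻¹.1 (Polynomial.aeval t.1.1 P t.2.1)
    rw [aeval_conj, Module.End.mul_apply, Module.End.mul_apply, gl_apply_inv_apply]
  · change t.2.2 (k.1 (Polynomial.aeval (k⁻¹.1 * t.1.1 * k.1) Q x)) =
      t.2.2 (Polynomial.aeval t.1.1 Q (k.1 x))
    rw [aeval_conj, Module.End.mul_apply, Module.End.mul_apply, gl_apply_inv_apply]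

theorem polyTwist_polyTwist {P Q : Polynomial R}
    {t : LinearMap.GeneralLinearGroup F V × V × Module.Dual F V} (ht : t ∈ twistSet V P Q) :
    polyTwist Q P (polyTwist P Q t) = t := by
  have h1 : Polynomial.aeval t.1.1 P * Polynomial.aeval t.1.1 Q = 1 := ht
  have h2 := (aeval_mul_comm t.1.1 Q P).trans h1
  exact Prod.ext rfl (Prod.ext (LinearMap.congr_fun h2 _)
    (LinearMap.ext fun x => congrArg t.2.2 (LinearMap.congr_fun h2 x)))

theorem polyTwist_mem_twistSet {P Q : Polynomial R}
    {t : LinearMap.GeneralLinearGroup F V × V × Module.Dual F V} (ht : t ∈ twistSet V P Q) :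
    polyTwist P Q t ∈ twistSet V Q P :=
  (aeval_mul_comm t.1.1 Q P).trans ht

end Twist

end Reflection

/-! ### Transport of regular semisimplicity -/

section RegularSemisimple

/-- Since f is injective and equivariant, the stabilizer of x fixes f(x), and the orbit of x is the
preimage of the orbit of f(x). It is thus closed in Z, and Z is closed in X. -/
theorem IsRegSemisimple.of_map {G X Y : Type*} [Group G] [TopologicalSpace X] [TopologicalSpace Y]
    {aX : G → X → X} {aY : G → Y → Y} {Z : Set X} (hZ : IsClosed Z)
    (hZa : ∀ k, ∀ x ∈ Z, aX k x ∈ Z) {f : Z → Y} (hf : Continuous f) (hinj : Function.Injective f)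
    (heqv : ∀ k (x : Z), f ⟨aX k x, hZa k x x.2⟩ = aY k (f x)) {x : Z}
    (h : IsRegSemisimple aY (f x)) : IsRegSemisimple aX (x : X) := by
  refine ⟨fun k hk => h.1 k ?_, ?_⟩
  · rw [← heqv]
    congr 1
    exact Subtype.ext hk
  · have e : (Set.range fun k => aX k x) = Subtype.val '' (f ⁻¹' Set.range fun k => aY k (f x)) := by
      ext y
      constructor
      · rintro ⟨k, rfl⟩
        exact ⟨⟨_, hZa k x x.2⟩, ⟨k, (heqv k x).symm⟩, rfl⟩
      · rintro ⟨y, ⟨k, hk⟩, rfl⟩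
        refine ⟨k, ?_⟩
        change aY k (f x) = f y at hk
        rw [← heqv] at hk
        exact congrArg Subtype.val (hinj hk)
    rw [e]
    exact hZ.isClosedEmbedding_subtypeVal.isClosedMap _ (h.2.preimage hf)

variable {F : Type*} [NontriviallyNormedField F] {V : Type*} [AddCommGroup V] [Module F V]
  [FiniteDimensional F V]

instance end_t2Space : T2Space (Module.End F V) := by
  obtain ⟨e⟩ := isHomeomorph_equivFun (F := F) (E := V →ₗ[F] V)
  exact e.symm.t2Space

variable [TopologicalSpace V] [IsModuleTopology F V]

instance linearMap_isTopologicalAddGroup {F V W : Type*} [NontriviallyNormedField F]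
    [AddCommGroup V] [Module F V] [AddCommGroup W] [Module F W] :
    IsTopologicalAddGroup (V →ₗ[F] W) :=
  IsModuleTopology.topologicalAddGroup F _

theorem continuous_eval : Continuous fun p : Module.End F V × V => p.1 p.2 := by
  have := IsModuleTopology.toContinuousAdd F V
  exact IsModuleTopology.continuous_bilinear_of_finite_left
    (LinearMap.id : Module.End F V →ₗ[F] V →ₗ[F] V)

theorem continuous_eval_dual : Continuous fun p : Module.Dual F V × V => p.1 p.2 :=
  IsModuleTopology.continuous_bilinear_of_finite_left
    (LinearMap.id : Module.Dual F V →ₗ[F] V →ₗ[F] F)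

theorem continuous_comp_dual :
    Continuous fun p : Module.Dual F V × Module.End F V => p.1.comp p.2 :=
  IsModuleTopology.continuous_bilinear_of_finite_left (LinearMap.llcomp F V V F)

theorem continuous_smulRight {W : Type*} [AddCommGroup W] [Module F W] [FiniteDimensional F W] :
    Continuous fun p : Module.Dual F W × V => p.1.smulRight p.2 :=
  IsModuleTopology.continuous_bilinear_of_finite_left
    (LinearMap.smulRightₗ : Module.Dual F W →ₗ[F] V →ₗ[F] W →ₗ[F] V)

theorem continuous_gl_mk {X : Type*} [TopologicalSpace X]
    {f : X → LinearMap.GeneralLinearGroup F V} (h1 : Continuous fun x => (f x).1)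
    (h2 : Continuous fun x => (f x)⁻¹.1) : Continuous f :=
  Units.continuous_iff.2 ⟨h1, h2⟩

theorem continuous_glEmb : Continuous (glEmb : LinearMap.GeneralLinearGroup F V → _) := by
  have key : Continuous fun f : Module.End F V => LinearMap.prodMap f (1 : Module.End F F) := by
    let φ : Module.End F V →ₗ[F] Module.End F (V × F) :=
      { toFun := fun f => LinearMap.prodMap f 0
        map_add' := fun f g => by rw [← add_zero (0 : Module.End F F), LinearMap.prodMap_add]; simp
        map_smul' := fun c f => by rw [← LinearMap.prodMap_smul]; simp }
    have e : (fun f : Module.End F V => LinearMap.prodMap f (1 : Module.End F F)) =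
        fun f => φ f + LinearMap.prodMap 0 1 := by
      funext f
      refine LinearMap.ext fun x => Prod.ext ?_ ?_ <;> simp [φ]
    rw [e]
    exact (IsModuleTopology.continuous_of_linearMap φ).add continuous_const
  exact continuous_gl_mk (key.comp Units.continuous_val)
    (key.comp (Units.continuous_val.comp continuous_inv))

variable {a τ τ' : F} (hτ : τ ≠ 0) (hτ' : τ' ≠ 0)

theorem continuous_refl (a τ : F) :
    Continuous fun p : V × Module.Dual F V => refl a τ p.1 p.2 := by
  have := IsModuleTopology.toContinuousAdd F V
  have h1 : Continuous fun l : Module.Dual F V => reflForm a l := by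
    refine Continuous.sub continuous_const (Continuous.fun_const_smul ?_ _)
    exact IsModuleTopology.continuous_of_linearMap (LinearMap.lcomp F F (LinearMap.fst F V F))
  refine continuous_const.add (Continuous.fun_const_smul ?_ _)
  exact (continuous_smulRight (F := F) (V := V × F) (W := V × F)).comp
    ((h1.comp continuous_snd).prodMk (continuous_fst.prodMk continuous_const))

theorem continuous_psi : Continuous (psi hτ hτ' : tripleSet V a τ τ' → _) := by
  have h1 : Continuous fun t : tripleSet V a τ τ' => (t.1.2.1, t.1.2.2) :=
    continuous_snd.comp continuous_subtype_val
  refine Continuous.mul ?_ (continuous_glEmb.comp (continuous_fst.comp continuous_subtype_val))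
  exact continuous_gl_mk ((continuous_refl a τ).comp h1) ((continuous_refl a τ').comp h1)

theorem continuous_phiEnd (τ : F) :
    Continuous fun f : Module.End F (V × F) => phiEnd τ f := by
  have := IsModuleTopology.toContinuousAdd F V
  refine Continuous.add ?_ (Continuous.fun_const_smul ?_ _)
  · exact IsModuleTopology.continuous_of_linearMap
      ((LinearMap.lcomp F V (LinearMap.inl F V F)).comp (LinearMap.llcomp F (V × F) (V × F) V
        (LinearMap.fst F V F)))
  · refine (continuous_smulRight (F := F) (V := V) (W := V)).comp (Continuous.prodMk ?_ ?_)
    · exact IsModuleTopology.continuous_of_linearMap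
        ((LinearMap.lcomp F F (LinearMap.inl F V F)).comp (LinearMap.llcomp F (V × F) (V × F) F
          (LinearMap.snd F V F)))
    · exact IsModuleTopology.continuous_of_linearMap ((LinearMap.fst F V F).comp
        (LinearMap.applyₗ ((0 : V), (1 : F))))

theorem continuous_phi (a : F) : Continuous (phi a hτ hτ' : glSet V τ τ' → _) := by
  have := IsModuleTopology.toContinuousAdd F V
  have h1 : Continuous fun γ : glSet V τ τ' => γ.1.1 :=
    Units.continuous_val.comp continuous_subtype_val
  have h2 : Continuous fun γ : glSet V τ τ' => γ.1⁻¹.1 :=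
    Units.continuous_val.comp (continuous_inv.comp continuous_subtype_val)
  refine Continuous.prodMk ?_ (Continuous.prodMk ?_ ?_)
  · exact continuous_gl_mk ((continuous_phiEnd τ).comp h1) ((continuous_phiEnd τ').comp h2)
  · refine Continuous.fun_const_smul (Continuous.comp (g := fun f : Module.End F (V × F) =>
      (f (0, 1)).1) ?_ h1) _
    exact IsModuleTopology.continuous_of_linearMap
      ((LinearMap.fst F V F).comp (LinearMap.applyₗ ((0 : V), (1 : F))))
  · refine Continuous.fun_const_smul (Continuous.comp (g := fun f : Module.End F (V × F) =>
      (LinearMap.snd F V F).comp (f.comp (LinearMap.inl F V F))) ?_ h2) _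
    exact IsModuleTopology.continuous_of_linearMap
        ((LinearMap.lcomp F F (LinearMap.inl F V F)).comp (LinearMap.llcomp F (V × F) (V × F) F
          (LinearMap.snd F V F)))

theorem isClosed_glSet : IsClosed (glSet V τ τ') := by
  have h : Continuous fun f : Module.End F (V × F) => (f (0, 1)).2 :=
    IsModuleTopology.continuous_of_linearMap ((LinearMap.snd F V F).comp
      (LinearMap.applyₗ ((0 : V), (1 : F))))
  exact (isClosed_eq (h.comp Units.continuous_val) continuous_const).inter
    (isClosed_eq (h.comp (Units.continuous_val.comp continuous_inv)) continuous_const)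

theorem isClosed_tripleSet : IsClosed (tripleSet V a τ τ') := by
  refine isClosed_eq continuous_const (continuous_const.add (continuous_const.mul ?_))
  exact continuous_eval_dual.comp
    ((continuous_snd.comp continuous_snd).prodMk (continuous_fst.comp continuous_snd))

/-- Both `psi` and its inverse `phi` are continuous, injective and equivariant on closed stable
sets, so regular semisimplicity passes in each direction. -/
theorem isRegSemisimple_psi_iff (ha : a ≠ 0) (K : Subgroup (LinearMap.GeneralLinearGroup F V))
    (t : tripleSet V a τ τ') :
    IsRegSemisimple (fun k : K => actG (k : LinearMap.GeneralLinearGroup F V)) (psi hτ hτ' t) ↔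
      IsRegSemisimple (fun k : K => actS (k : LinearMap.GeneralLinearGroup F V)) t.1 := by
  constructor
  · intro H
    exact IsRegSemisimple.of_map
      (aX := fun k : K => actS (k : LinearMap.GeneralLinearGroup F V))
      (aY := fun k : K => actG (k : LinearMap.GeneralLinearGroup F V))
      (isClosed_tripleSet (a := a) (τ := τ) (τ' := τ'))
      (fun k x hx => actS_mem_tripleSet k.1 hx) (continuous_psi hτ hτ') (psi_injective hτ hτ' ha)
      (fun k x => (actG_psi hτ hτ' k.1 x).symm) H
  · intro H
    refine IsRegSemisimple.of_map
      (aX := fun k : K => actG (k : LinearMap.GeneralLinearGroup F V))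
      (aY := fun k : K => actS (k : LinearMap.GeneralLinearGroup F V))
      (isClosed_glSet (τ := τ) (τ' := τ'))
      (fun k x hx => actG_mem_glSet k.1 hx) (continuous_phi hτ hτ' a) (phi_injective hτ hτ' ha)
      (fun k x => phi_actG hτ hτ' ha k.1 x) (x := ⟨_, psi_mem hτ hτ' t⟩) ?_
    rw [phi_psi hτ hτ' ha t]
    exact H

section Twist

variable {R : Type*} [CommRing R] [Algebra R (Module.End F V)]

theorem continuous_polyTwist (P Q : Polynomial R) :
    Continuous (polyTwist (V := V) (F := F) P Q) := by
  have h1 : ∀ P : Polynomial R, Continuous fun t : LinearMap.GeneralLinearGroup F V × V ×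
      Module.Dual F V => Polynomial.aeval t.1.1 P := fun P =>
    (Polynomial.continuous_aeval P).comp (Units.continuous_val.comp continuous_fst)
  exact continuous_fst.prodMk ((continuous_eval.comp ((h1 P).prodMk
    (continuous_fst.comp continuous_snd))).prodMk (continuous_comp_dual.comp
      ((continuous_snd.comp continuous_snd).prodMk (h1 Q))))

theorem isClosed_twistSet (P Q : Polynomial R) : IsClosed (twistSet (F := F) V P Q) := by
  have h1 : ∀ P : Polynomial R, Continuous fun t : LinearMap.GeneralLinearGroup F V × V ×
      Module.Dual F V => Polynomial.aeval t.1.1 P := fun P =>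
    (Polynomial.continuous_aeval P).comp (Units.continuous_val.comp continuous_fst)
  exact isClosed_eq ((h1 P).mul (h1 Q)) continuous_const

theorem IsRegSemisimple.of_polyTwist {P Q : Polynomial R}
    (K : Subgroup (LinearMap.GeneralLinearGroup F V))
    {t : LinearMap.GeneralLinearGroup F V × V × Module.Dual F V} (ht : t ∈ twistSet V P Q)
    (H : IsRegSemisimple (fun k : K => actS (k : LinearMap.GeneralLinearGroup F V))
      (polyTwist P Q t)) :
    IsRegSemisimple (fun k : K => actS (k : LinearMap.GeneralLinearGroup F V)) t := by
  refine IsRegSemisimple.of_map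
    (aX := fun k : K => actS (k : LinearMap.GeneralLinearGroup F V))
    (aY := fun k : K => actS (k : LinearMap.GeneralLinearGroup F V)) (isClosed_twistSet P Q)
    (fun k x hx => actS_mem_twistSet k.1 hx)
    (f := fun t => polyTwist P Q t.1) ((continuous_polyTwist P Q).comp continuous_subtype_val)
    (fun x y hxy => Subtype.ext ?_) (fun k x => actS_polyTwist P Q k.1 x.1) (x := ⟨t, ht⟩) H
  rw [← polyTwist_polyTwist x.2, ← polyTwist_polyTwist y.2]
  exact congrArg _ hxy

theorem isRegSemisimple_polyTwist_iff {P Q : Polynomial R}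
    (K : Subgroup (LinearMap.GeneralLinearGroup F V))
    {t : LinearMap.GeneralLinearGroup F V × V × Module.Dual F V} (ht : t ∈ twistSet V P Q) :
    IsRegSemisimple (fun k : K => actS (k : LinearMap.GeneralLinearGroup F V))
      (polyTwist P Q t) ↔
    IsRegSemisimple (fun k : K => actS (k : LinearMap.GeneralLinearGroup F V)) t := by
  refine ⟨fun H => H.of_polyTwist K ht, fun H =>
    IsRegSemisimple.of_polyTwist K (polyTwist_mem_twistSet ht) ?_⟩
  rwa [polyTwist_polyTwist ht]

end Twist

end RegularSemisimple

/-! ### The reflection factorization for unitary groups and symmetric spaces -/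

section UnitarySymmetric

variable {F₀ F : Type*} [NontriviallyNormedField F₀] [IsUltrametricDist F₀]
  [LocallyCompactSpace F₀] [NontriviallyNormedField F] [IsUltrametricDist F]
  [LocallyCompactSpace F] [NormedAlgebra F₀ F] [Algebra.IsQuadraticExtension F₀ F]
  {σ : F ≃ₐ[F₀] F} {V : Type*} [AddCommGroup V] [Module F V]
  {h : SesqForm σ V}

theorem orthSum_apply (h : SesqForm σ V) (a : F₀ˣ) (x y : V × F) :
    orthSum h a x y = h x.1 y.1 + x.2 * algebraMap F₀ F a * σ y.2 := rfl

theorem algebraMap_unit_ne_zero (a : F₀ˣ) : algebraMap F₀ F a ≠ 0 := by simp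

theorem map_smul_right (h : SesqForm σ V) (x y : V) (c : F) : h x (c • y) = σ c * h x y := by
  rw [LinearMap.map_smulₛₗ]; rfl

theorem smulLeft_apply (h : SesqForm σ V) (x y : V) (c : F) : h (c • x) y = c * h x y := by
  rw [map_smul]; rfl

section Psi

variable {a : F₀ˣ} {τ : F} (hτ : τ ≠ 0) (hτ' : σ τ ≠ 0)

/-- With w = u - e and l = (·, u), the quasi-reflection is x ↦ x - (τa)⁻¹(x, w)w, and (w, w) = (u,
u) + a = a(τ + σ(τ)). This is exactly the condition for such a map to be unitary. -/
theorem psi_mem_unitary (hh : IsHermitian h) {t : tripleSet V (algebraMap F₀ F a) τ (σ τ)}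
    (hg : t.1.1 ∈ unitary h) (hl : t.1.2.2 = h.flip t.1.2.1) :
    psi hτ hτ' t ∈ unitary (orthSum h a) := by
  intro x y
  have ha := algebraMap_unit_ne_zero (F := F) a
  have ht : τ + σ τ = 1 + (algebraMap F₀ F a)⁻¹ * t.1.2.2 t.1.2.1 := t.2
  rw [hl, LinearMap.flip_apply] at ht
  have huu : h t.1.2.1 t.1.2.1 = algebraMap F₀ F a * (τ + σ τ - 1) := by rw [ht]; field_simp; ring
  have hxy : h (t.1.1.1 x.1) (t.1.1.1 y.1) = h x.1 y.1 := hg _ _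
  rw [psi_apply, psi_apply, orthSum_apply, orthSum_apply, hl, LinearMap.flip_apply,
    LinearMap.flip_apply, ← hxy]
  generalize t.1.1.1 x.1 = z
  generalize t.1.1.1 y.1 = w
  have hsy : σ (h w t.1.2.1) = h t.1.2.1 w := (hh _ _).symm
  have hσi : σ τ⁻¹ = (σ τ)⁻¹ := map_inv₀ σ τ
  simp only [map_add, LinearMap.add_apply, map_smul_right, smulLeft_apply, map_sub, map_mul, huu,
    hsy, map_inv₀, AlgEquiv.commutes]
  field_simp
  ring

/-- Compare (ψ⁻¹z, e) = l(z)/σ(τ) with (z, ψe) = (z, u)/σ(τ). -/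
theorem eq_flip_of_psi_mem_unitary {t : tripleSet V (algebraMap F₀ F a) τ (σ τ)}
    (H : psi hτ hτ' t ∈ unitary (orthSum h a)) : t.1.2.2 = h.flip t.1.2.1 := by
  refine LinearMap.ext fun z => ?_
  have ha := algebraMap_unit_ne_zero (F := F) a
  have h1 := (unitary (orthSum h a)).inv_mem H (z, 0) ((psi hτ hτ' t).1 (0, 1))
  rw [gl_inv_apply_apply, psi_inv_apply, psi_apply, orthSum_apply, orthSum_apply] at h1
  simp only [map_zero, mul_zero, sub_zero, zero_sub, map_one, mul_one, zero_add, zero_mul,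
    add_zero, map_smul_right, map_inv₀] at h1
  rw [LinearMap.flip_apply]
  field_simp at h1
  linear_combination h1

/-- On vectors (x, l(gx)/a) the quasi-reflection is invisible: ψ acts as g on the V-component and
keeps the e-coordinate, so the contributions of e cancel. -/
theorem mem_unitary_of_psi_mem_unitary {t : tripleSet V (algebraMap F₀ F a) τ (σ τ)}
    (H : psi hτ hτ' t ∈ unitary (orthSum h a)) : t.1.1 ∈ unitary h := by
  intro x y
  have h1 := H (x, (algebraMap F₀ F a)⁻¹ * t.1.2.2 (t.1.1.1 x))
    (y, (algebraMap F₀ F a)⁻¹ * t.1.2.2 (t.1.1.1 y))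
  rw [psi_apply, psi_apply] at h1
  simp only [sub_self, mul_zero, zero_smul, add_zero, sub_zero] at h1
  exact add_right_cancel h1

end Psi

namespace OrthBasis

variable {n : ℕ} (B : OrthBasis h n)

theorem sum_basis_castSucc (a lam : F₀ˣ) (i : Fin n) :
    (B.sum a lam).basis (Fin.castSucc i) = (B.basis i, 0) := by
  have : Fin.castSucc i = finSumFinEquiv (Sum.inl i : Fin n ⊕ Fin 1) := rfl
  rw [this]
  simp [OrthBasis.sum]

theorem sum_basis_last (a lam : F₀ˣ) :
    (B.sum a lam).basis (Fin.last n) = (0, algebraMap F₀ F lam) := by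
  have : Fin.last n = finSumFinEquiv (Sum.inr 0 : Fin n ⊕ Fin 1) := rfl
  rw [this]
  simp [OrthBasis.sum, Module.Basis.isUnitSMul_apply]

theorem sum_repr_castSucc (a lam : F₀ˣ) (x : V × F) (i : Fin n) :
    (B.sum a lam).basis.repr x (Fin.castSucc i) = B.basis.repr x.1 i := by
  have : Fin.castSucc i = finSumFinEquiv (Sum.inl i : Fin n ⊕ Fin 1) := rfl
  rw [this]
  simp [OrthBasis.sum]

theorem sum_repr_last (a lam : F₀ˣ) (x : V × F) :
    (B.sum a lam).basis.repr x (Fin.last n) = (algebraMap F₀ F lam)⁻¹ * x.2 := by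
  have : Fin.last n = finSumFinEquiv (Sum.inr 0 : Fin n ⊕ Fin 1) := rfl
  rw [this]
  simp [OrthBasis.sum, Module.Basis.repr_isUnitSMul, Units.smul_def]

theorem sum_conj (a lam : F₀ˣ) (x : V × F) :
    (B.sum a lam).conj x = (B.conj x.1, σ x.2) := by
  refine (B.sum a lam).basis.repr.injective (Finsupp.ext fun i => ?_)
  rw [repr_conj]
  refine Fin.lastCases ?_ (fun i => ?_) i
  · rw [sum_repr_last, sum_repr_last, map_mul, map_inv₀, AlgEquiv.commutes]
  · rw [sum_repr_castSucc, sum_repr_castSucc, repr_conj]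

/-- The conjugation `l ↦ l̄` of `V^*`. -/
noncomputable def barDual (l : Module.Dual F V) : Module.Dual F V where
  toFun x := σ (l (B.conj x))
  map_add' x y := by rw [conj_add, map_add, map_add]
  map_smul' c x := by
    rw [conj_smul, map_smul, smul_eq_mul, map_mul, sigma_sigma, RingHom.id_apply, smul_eq_mul]

theorem barDual_apply (l : Module.Dual F V) (x : V) : B.barDual l x = σ (l (B.conj x)) := rfl

/-- Conjugation turns ψ(g, u, l) into ψ(ḡ, ū, l̄) with τ and σ(τ) exchanged, and ψ(g, u, l)⁻¹ is
ψ(g⁻¹, g⁻¹u, lg) with the same exchange. Membership in S says that these agree, and ψ is injective.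
-/
theorem psi_mem_S_iff {a : F₀ˣ} (lam : F₀ˣ) {τ : F} (hτ : τ ≠ 0) (hτ' : σ τ ≠ 0)
    (t : tripleSet V (algebraMap F₀ F a) τ (σ τ)) :
    psi hτ hτ' t ∈ (B.sum a lam).S ↔ t.1.1 ∈ B.S ∧ t.1.1.1 (B.conj t.1.2.1) = t.1.2.1 ∧
      t.1.2.2.comp t.1.1.1 = B.barDual t.1.2.2 := by
  have ha := algebraMap_unit_ne_zero (F := F) a
  let t' : LinearMap.GeneralLinearGroup F V × V × Module.Dual F V :=
    (Units.map B.bar.toMonoidHom t.1.1, B.conj t.1.2.1, B.barDual t.1.2.2)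
  have ht : τ + σ τ = 1 + (algebraMap F₀ F a)⁻¹ * t.1.2.2 t.1.2.1 := t.2
  have ht' : t' ∈ tripleSet V (algebraMap F₀ F a) (σ τ) τ := by
    change σ τ + τ = 1 + (algebraMap F₀ F a)⁻¹ * σ (t.1.2.2 (B.conj (B.conj t.1.2.1)))
    have := congrArg σ ht
    rw [map_add, map_add, map_mul, map_one, map_inv₀, AlgEquiv.commutes, sigma_sigma] at this
    rw [conj_conj, this]
  have h1 : (B.sum a lam).bar (psi hτ hτ' t).1 = (psi hτ' hτ ⟨t', ht'⟩).1 := by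
    refine LinearMap.ext fun x => ?_
    rw [bar_apply, psi_apply, psi_apply, sum_conj, sum_conj]
    change (_, _) = (B.bar t.1.1.1 x.1 + ((σ τ)⁻¹ * (x.2 - (algebraMap F₀ F a)⁻¹ *
      σ (t.1.2.2 (B.conj (B.bar t.1.1.1 x.1))))) • B.conj t.1.2.1, x.2 - (σ τ)⁻¹ * (x.2 -
      (algebraMap F₀ F a)⁻¹ * σ (t.1.2.2 (B.conj (B.bar t.1.1.1 x.1)))))
    rw [bar_apply, conj_conj, conj_add, conj_smul]
    simp only [map_sub, map_mul, map_inv₀, AlgEquiv.commutes, sigma_sigma]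
  rw [mem_S_iff', h1, ← Units.ext_iff, psi_inv, (psi_injective hτ' hτ ha).eq_iff, Subtype.mk.injEq,
    Prod.ext_iff, Prod.ext_iff, mem_S_iff', Units.ext_iff]
  refine and_congr Iff.rfl (and_congr ?_ eq_comm)
  change B.conj t.1.2.1 = t.1.1⁻¹.1 t.1.2.1 ↔ _
  constructor
  · intro H
    rw [H, gl_apply_inv_apply]
  · intro H
    conv_rhs => rw [← H]
    rw [gl_inv_apply_apply]

/-- The triples `(g, u, l)` with `g ∈ S(V₀)`, `g ū = u` and `l g = l̄`. -/
def twistedS : Set (LinearMap.GeneralLinearGroup F V × V × Module.Dual F V) :=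
  {t | t.1 ∈ B.S ∧ t.1.1 (B.conj t.2.1) = t.2.1 ∧ t.2.2.comp t.1.1 = B.barDual t.2.2}

variable {P Q : Polynomial (integers F)}
  {t : LinearMap.GeneralLinearGroup F V × V × Module.Dual F V}

theorem aeval_mul_eq_bar (ht : t ∈ twistSet V P Q)
    (hP : t.1.1 * B.bar (Polynomial.aeval t.1.1 P) = Polynomial.aeval t.1.1 P) :
    Polynomial.aeval t.1.1 Q * t.1.1 = B.bar (Polynomial.aeval t.1.1 Q) := by
  have h1 : Polynomial.aeval t.1.1 P * Polynomial.aeval t.1.1 Q = 1 := ht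
  have h2 := (aeval_mul_comm t.1.1 Q P).trans h1
  have h3 : B.bar (Polynomial.aeval t.1.1 P) * B.bar (Polynomial.aeval t.1.1 Q) = 1 := by
    rw [← map_mul, h1, map_one]
  rw [← mul_one (_ * t.1.1), ← h3, mul_assoc, ← mul_assoc t.1.1, hP, ← mul_assoc, h2, one_mul]

/-- For p = P(g) with g p̄ = p and ū = u, the conjugate of pu is p̄u, whence g applied to it gives
pu. The covector is treated in the same way, by the companion relation Q(g)g = Q(g)‾. -/
theorem polyTwist_mem_twistedS (ht : t ∈ twistSet V P Q)
    (hP : t.1.1 * B.bar (Polynomial.aeval t.1.1 P) = Polynomial.aeval t.1.1 P)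
    (h1 : t.1 ∈ B.S) (h2 : t.2.1 ∈ B.V₀) (h3 : t.2.2 ∈ B.V₀Dual) :
    polyTwist P Q t ∈ B.twistedS := by
  refine ⟨h1, ?_, LinearMap.ext fun x => ?_⟩
  · change t.1.1 (B.conj (Polynomial.aeval t.1.1 P t.2.1)) = Polynomial.aeval t.1.1 P t.2.1
    rw [conj_apply, show B.conj t.2.1 = t.2.1 from h2]
    exact LinearMap.congr_fun hP _
  · change t.2.2 ((Polynomial.aeval t.1.1 Q * t.1.1) x) =
      σ (t.2.2 (Polynomial.aeval t.1.1 Q (B.conj x)))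
    rw [B.aeval_mul_eq_bar ht hP, bar_apply]
    exact h3 _

theorem polyTwist_mem_of_mem_twistedS (ht : t ∈ twistSet V P Q)
    (hP : t.1.1 * B.bar (Polynomial.aeval t.1.1 P) = Polynomial.aeval t.1.1 P)
    (H : t ∈ B.twistedS) :
    (polyTwist Q P t).2.1 ∈ B.V₀ ∧ (polyTwist Q P t).2.2 ∈ B.V₀Dual := by
  refine ⟨?_, fun x => ?_⟩
  · change B.conj (Polynomial.aeval t.1.1 Q t.2.1) = Polynomial.aeval t.1.1 Q t.2.1
    rw [conj_apply, ← B.aeval_mul_eq_bar ht hP, Module.End.mul_apply, H.2.1]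
  · change t.2.2 (Polynomial.aeval t.1.1 P (B.conj x)) = σ (t.2.2 (Polynomial.aeval t.1.1 P x))
    have h1 : Polynomial.aeval t.1.1 P (B.conj x) =
        t.1.1 (B.conj (Polynomial.aeval t.1.1 P x)) := by
      conv_lhs => rw [← hP]
      rw [Module.End.mul_apply, conj_apply]
    rw [h1]
    have := LinearMap.congr_fun H.2.2 (B.conj (Polynomial.aeval t.1.1 P x))
    rw [barDual_apply, conj_conj] at this
    exact this

end OrthBasis

/-- The triple `(g, u, x ↦ (x, u))`. -/
def unitaryTriple (h : SesqForm σ V) (x : LinearMap.GeneralLinearGroup F V × V) :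
    LinearMap.GeneralLinearGroup F V × V × Module.Dual F V :=
  (x.1, x.2, h.flip x.2)

theorem actS_unitaryTriple {k : LinearMap.GeneralLinearGroup F V} (hk : k ∈ unitary h)
    (x : LinearMap.GeneralLinearGroup F V × V) :
    actS k (unitaryTriple h x) = unitaryTriple h (actU k x) := by
  refine Prod.ext rfl (Prod.ext rfl (LinearMap.ext fun z => ?_))
  change h (k.1 z) x.2 = h z (k⁻¹.1 x.2)
  rw [← hk z, gl_apply_inv_apply]

theorem matches_iff {x : LinearMap.GeneralLinearGroup F V × V}
    {y : LinearMap.GeneralLinearGroup F V × V × Module.Dual F V} :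
    Matches h x y ↔ ∃ k : LinearMap.GeneralLinearGroup F V, actS k (unitaryTriple h x) = y := by
  refine exists_congr fun k => ?_
  rw [Prod.ext_iff, Prod.ext_iff]
  refine and_congr Iff.rfl (and_congr Iff.rfl ?_)
  exact ⟨fun H => LinearMap.ext H, fun H z => LinearMap.congr_fun H z⟩

variable [FiniteDimensional F V]

instance dual_t2Space : T2Space (Module.Dual F V) := by
  obtain ⟨e⟩ := isHomeomorph_equivFun (F := F) (E := V →ₗ[F] F)
  exact e.symm.t2Space

/-- The pairs (g, u) are identified with the closed U(V)-stable set of triples with l = (·, u), the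
inverse being the projection. -/
theorem isRegSemisimple_unitaryTriple_iff [TopologicalSpace V] [IsModuleTopology F V]
    (x : LinearMap.GeneralLinearGroup F V × V) :
    IsRegSemisimple (fun k : unitary h => actS (k : LinearMap.GeneralLinearGroup F V))
        (unitaryTriple h x) ↔
      IsRegSemisimple (fun k : unitary h => actU (k : LinearMap.GeneralLinearGroup F V)) x := by
  have := IsModuleTopology.toContinuousAdd F V
  have hflip : Continuous fun u : V => h.flip u :=
    IsModuleTopology.continuous_of_linearMapₛₗ (continuous_sigma σ) h.flip
  constructor
  · intro H
    exact IsRegSemisimple.of_map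
      (aX := fun k : unitary h => actU (k : LinearMap.GeneralLinearGroup F V))
      (aY := fun k : unitary h => actS (k : LinearMap.GeneralLinearGroup F V))
      isClosed_univ (fun _ _ _ => trivial) (f := fun x => unitaryTriple h x.1)
      ((continuous_fst.prodMk (continuous_snd.prodMk (hflip.comp continuous_snd))).comp
        continuous_subtype_val)
      (fun x y hxy => Subtype.ext (Prod.ext (congrArg (fun t => t.1) hxy)
        (congrArg (fun t => t.2.1) hxy)))
      (fun k x => (actS_unitaryTriple k.2 x.1).symm) (x := ⟨x, trivial⟩) H
  · intro H
    refine IsRegSemisimple.of_map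
      (aX := fun k : unitary h => actS (k : LinearMap.GeneralLinearGroup F V))
      (aY := fun k : unitary h => actU (k : LinearMap.GeneralLinearGroup F V))
      (Z := {t | t.2.2 = h.flip t.2.1})
      (isClosed_eq (continuous_snd.comp continuous_snd)
        (hflip.comp (continuous_fst.comp continuous_snd))) (fun k t ht => ?_)
      (f := fun t => (t.1.1, t.1.2.1))
      ((continuous_fst.prodMk (continuous_fst.comp continuous_snd)).comp continuous_subtype_val)
      (fun t t' htt => Subtype.ext (Prod.ext (Prod.ext_iff.1 htt).1
        (Prod.ext (Prod.ext_iff.1 htt).2 ?_)))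
      (fun k x => rfl) (x := ⟨unitaryTriple h x, rfl⟩) H
    · have ht' : t = unitaryTriple h (t.1, t.2.1) := Prod.ext rfl (Prod.ext rfl ht)
      rw [ht']
      change (actS k.1 _).2.2 = _
      rw [actS_unitaryTriple k.2]
      rfl
    · rw [show t.1.2.2 = _ from t.2, show t'.1.2.2 = _ from t'.2]
      exact congrArg (fun p : _ × V => h.flip p.2) htt

end UnitarySymmetric

/-! ### Lattices -/

section Lattices

variable {F₀ F : Type*} [NontriviallyNormedField F₀] [IsUltrametricDist F₀]
  [LocallyCompactSpace F₀] [NontriviallyNormedField F] [IsUltrametricDist F]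
  [LocallyCompactSpace F] [NormedAlgebra F₀ F] [Algebra.IsQuadraticExtension F₀ F]
  {σ : F ≃ₐ[F₀] F} {V : Type*} [AddCommGroup V] [Module F V]
  {h : SesqForm σ V}

theorem smul_mem_of_norm_le_one (M : Submodule (integers F) V) {c : F} (hc : ‖c‖ ≤ 1)
    {x : V} (hx : x ∈ M) : c • x ∈ M :=
  M.smul_mem (⟨c, mem_integers_iff.2 hc⟩ : integers F) hx

theorem aeval_apply_mem {M : Submodule (integers F) V} {f : Module.End F V}
    (hf : ∀ x ∈ M, f x ∈ M) (P : Polynomial (integers F)) {x : V} (hx : x ∈ M) :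
    Polynomial.aeval f P x ∈ M := by
  rw [Polynomial.aeval_eq_sum_range, LinearMap.sum_apply]
  refine sum_mem fun i _ => ?_
  have hpow : ∀ i : ℕ, (f ^ i) x ∈ M := by
    intro i
    induction i with
    | zero => exact hx
    | succ i ih => rw [pow_succ']; exact hf _ ih
  exact M.smul_mem _ (hpow i)

theorem stabilizes_setOf_smul {g : LinearMap.GeneralLinearGroup F V} {c : F} (hc : c ≠ 0)
    {X : Set V} : Stabilizes g {x | c • x ∈ X} ↔ Stabilizes g X := by
  rw [stabilizes_iff, stabilizes_iff]
  have key : ∀ f : Module.End F V, (∀ x ∈ {x | c • x ∈ X}, f x ∈ {x | c • x ∈ X}) ↔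
      ∀ x ∈ X, f x ∈ X := by
    intro f
    constructor
    · intro H x hx
      have := H (c⁻¹ • x) (by simpa [smul_smul, hc] using hx)
      rw [map_smul] at this
      simpa [smul_smul, hc] using this
    · intro H x hx
      change c • f x ∈ X
      rw [← map_smul]
      exact H _ hx
  rw [key, key]

theorem stabilizes_dualLattice {g : LinearMap.GeneralLinearGroup F V} (hg : g ∈ unitary h)
    {L : Submodule (integers F) V} (H : Stabilizes g (L : Set V)) :
    Stabilizes g (dualLattice h L) := by
  rw [stabilizes_iff] at *
  constructor
  · intro x hx y hy
    rw [← gl_apply_inv_apply g y, hg]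
    exact hx _ (H.2 y hy)
  · intro x hx y hy
    rw [← gl_inv_apply_apply g y, (unitary h).inv_mem hg]
    exact hx _ (H.1 y hy)

/-- The lattice `M ⊕ c⁻¹ O_F e` of `V × F`. -/
def extLattice (M : Submodule (integers F) V) (c : F) : Set (V × F) :=
  {x | x.1 ∈ M ∧ ‖c * x.2‖ ≤ 1}

/-! ### Lattices stable under a quasi-reflection times g ⊕ 1 -/

section Psi

variable {a τ τ' : F} (hτ : τ ≠ 0) (hτ' : τ' ≠ 0) {M : Submodule (integers F) V} {c : F}

/-- The V-component of ψ(0, c⁻¹) is τ⁻¹c⁻¹u, which gives the condition on u as τ is a unit. For x ∈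
M, ψ(x, 0) = (gx + mu, -m) with cm integral, so mu = (cm)c⁻¹u lies in M and can be removed. -/
theorem apply_mem_of_psi_apply_mem (hτ1 : ‖τ‖ = 1) (hc : c ≠ 0) (t : tripleSet V a τ τ')
    (H : ∀ x ∈ extLattice M c, (psi hτ hτ' t).1 x ∈ extLattice M c) :
    (∀ x ∈ M, t.1.1.1 x ∈ M) ∧ c⁻¹ • t.1.2.1 ∈ M := by
  have h1 := (H (0, c⁻¹) ⟨M.zero_mem, by simp [hc]⟩).1
  rw [psi_apply] at h1
  simp only [map_zero, mul_zero, sub_zero, zero_add] at h1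
  have h2 := smul_mem_of_norm_le_one M hτ1.le h1
  rw [smul_smul, mul_inv_cancel_left₀ hτ] at h2
  refine ⟨fun x hx => ?_, h2⟩
  have h3 := H (x, 0) ⟨hx, by simp⟩
  rw [psi_apply] at h3
  obtain ⟨h4, h5⟩ := h3
  simp only [zero_sub] at h4 h5
  have h6 := smul_mem_of_norm_le_one M h5 h2
  have h7 := M.add_mem h4 h6
  rw [smul_smul, add_assoc, ← add_smul] at h7
  convert h7 using 1
  have : τ⁻¹ * -(a⁻¹ * t.1.2.2 (t.1.1.1 x)) +
      c * -(τ⁻¹ * -(a⁻¹ * t.1.2.2 (t.1.1.1 x))) * c⁻¹ = 0 := by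
    field_simp
    ring
  rw [this, zero_smul, add_zero]

theorem psi_apply_mem (hτ1 : ‖τ‖ = 1) (hc : c ≠ 0) (t : tripleSet V a τ τ')
    (hg : ∀ x ∈ M, t.1.1.1 x ∈ M) (hu : c⁻¹ • t.1.2.1 ∈ M)
    (hl : ∀ x ∈ M, ‖c * (a⁻¹ * t.1.2.2 x)‖ ≤ 1) {x : V × F} (hx : x ∈ extLattice M c) :
    (psi hτ hτ' t).1 x ∈ extLattice M c := by
  have hτi : ‖τ⁻¹‖ = 1 := by rw [norm_inv, hτ1, inv_one]
  rw [psi_apply]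
  have h1 : ‖c * (τ⁻¹ * (x.2 - a⁻¹ * t.1.2.2 (t.1.1.1 x.1)))‖ ≤ 1 := by
    rw [mul_left_comm, norm_mul, hτi, one_mul, mul_sub]
    exact norm_sub_le_of_le hx.2 (hl _ (hg _ hx.1))
  refine ⟨M.add_mem (hg _ hx.1) ?_, ?_⟩
  · have := smul_mem_of_norm_le_one M h1 hu
    rwa [smul_smul, mul_comm c, mul_assoc, mul_inv_cancel₀ hc, mul_one] at this
  · change ‖c * (x.2 - _)‖ ≤ 1
    rw [mul_sub]
    exact norm_sub_le_of_le hx.2 h1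

theorem stabilizes_of_psi_stabilizes (hτ1 : ‖τ‖ = 1) (hτ1' : ‖τ'‖ = 1) (hc : c ≠ 0)
    (t : tripleSet V a τ τ') (H : Stabilizes (psi hτ hτ' t) (extLattice M c)) :
    Stabilizes t.1.1 (M : Set V) ∧ c⁻¹ • t.1.2.1 ∈ M := by
  rw [stabilizes_iff, psi_inv] at H
  obtain ⟨h1, h2⟩ := apply_mem_of_psi_apply_mem hτ hτ' hτ1 hc t H.1
  obtain ⟨h3, -⟩ := apply_mem_of_psi_apply_mem hτ' hτ hτ1' hc _ H.2
  exact ⟨stabilizes_iff.2 ⟨h1, h3⟩, h2⟩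

theorem psi_stabilizes (hτ1 : ‖τ‖ = 1) (hτ1' : ‖τ'‖ = 1) (hc : c ≠ 0)
    (t : tripleSet V a τ τ') (hg : Stabilizes t.1.1 (M : Set V)) (hu : c⁻¹ • t.1.2.1 ∈ M)
    (hl : ∀ x ∈ M, ‖c * (a⁻¹ * t.1.2.2 x)‖ ≤ 1) :
    Stabilizes (psi hτ hτ' t) (extLattice M c) := by
  rw [stabilizes_iff] at hg
  rw [stabilizes_iff, psi_inv]
  refine ⟨fun x hx => psi_apply_mem hτ hτ' hτ1 hc t hg.1 hu hl hx, fun x hx =>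
    psi_apply_mem hτ' hτ hτ1' hc _ hg.2 ?_ (fun x hx => hl _ (hg.1 x hx)) hx⟩
  change c⁻¹ • t.1.1⁻¹.1 t.1.2.1 ∈ M
  rw [← map_smul]
  exact hg.2 _ hu

theorem norm_le_one_of_psi_stabilizes (ha : a ≠ 0) (hτ1' : ‖τ'‖ = 1)
    (t : tripleSet V a τ τ') (H : Stabilizes (psi hτ hτ' t) (extLattice M a)) {x : V}
    (hx : x ∈ M) : ‖t.1.2.2 x‖ ≤ 1 := by
  have h1 := ((stabilizes_iff.1 H).2 (x, 0) ⟨hx, by simp⟩).2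
  rw [psi_inv_apply] at h1
  simp only [zero_sub, mul_neg, neg_neg] at h1
  rwa [mul_left_comm, mul_inv_cancel_left₀ ha, norm_mul, norm_inv, hτ1', inv_one, one_mul] at h1

end Psi

/-! ### Dual and rescaled bases, and the effect of the reduction hypothesis -/

namespace OrthBasis

variable {n : ℕ} (C : OrthBasis h n)

theorem apply_basis (x : V) (i : Fin n) :
    h x (C.basis i) = C.basis.repr x i * h (C.basis i) (C.basis i) := by
  conv_lhs => rw [← C.basis.sum_repr x]
  rw [map_sum, LinearMap.sum_apply, Finset.sum_eq_single i]
  · rw [smulLeft_apply]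
  · intro j _ hj
    rw [smulLeft_apply, C.orthogonal j i hj, mul_zero]
  · simp

theorem mem_dualLattice_iff {x : V} :
    x ∈ dualLattice h C.lattice ↔ ∀ i, h x (C.basis i) ∈ integers F := by
  refine ⟨fun H i => H _ (C.basis_mem_lattice i), fun H y hy => ?_⟩
  rw [← C.basis.sum_repr y, map_sum]
  refine sum_mem fun i _ => ?_
  rw [map_smul_right]
  exact mul_mem (sigma_mem_integers σ (C.mem_lattice_iff.1 hy i)) (H i)

theorem dual_basis (i : Fin n) :
    C.dual.basis i = (h (C.basis i) (C.basis i))⁻¹ • C.basis i := by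
  simp [OrthBasis.dual, Module.Basis.isUnitSMul_apply]

theorem dual_repr (x : V) (i : Fin n) :
    C.dual.basis.repr x i = h x (C.basis i) := by
  rw [apply_basis, mul_comm]
  simp [OrthBasis.dual, Module.Basis.repr_isUnitSMul, Units.smul_def]

theorem dual_lattice : (C.dual.lattice : Set V) = dualLattice h C.lattice := by
  ext x
  rw [SetLike.mem_coe, mem_lattice_iff, mem_dualLattice_iff]
  simp only [dual_repr]

theorem sigma_length (hh : IsHermitian h) (x : V) : σ (h x x) = h x x := (hh x x).symm

theorem dual_dual (hh : IsHermitian h) (i : Fin n) :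
    C.dual.dual.basis i = C.basis i := by
  rw [dual_basis, dual_basis, map_smul_right, smulLeft_apply, smul_smul, map_inv₀,
    sigma_length hh]
  have := C.length_ne_zero i
  rw [inv_mul_cancel₀ this, mul_one, inv_inv, mul_inv_cancel₀ this, one_smul]

theorem dualLattice_dual (hh : IsHermitian h) :
    dualLattice h C.dual.lattice = (C.lattice : Set V) := by
  rw [← dual_lattice, lattice, lattice]
  simp only [funext (C.dual_dual hh)]

/-- The conjugation depends only on the F₀-structure, not on its basis. Dual and rescaled bases
therefore share V₀, S(V₀) and GL(V₀) with the original one. -/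
theorem conj_eq_of_conj_basis (C' : OrthBasis h n)
    (H : ∀ i, C.conj (C'.basis i) = C'.basis i) (x : V) : C'.conj x = C.conj x := by
  have key : ∀ s : Finset (Fin n), C.conj (∑ i ∈ s, C'.basis.repr x i • C'.basis i) =
      ∑ i ∈ s, σ (C'.basis.repr x i) • C'.basis i := by
    intro s
    induction s using Finset.induction_on with
    | empty => simpa using C.conj_zero
    | insert i s hi ih => rw [Finset.sum_insert hi, Finset.sum_insert hi, conj_add, ih, conj_smul, H]
  conv_rhs => rw [← C'.basis.sum_repr x]
  rw [key]
  rfl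

theorem dual_conj (hh : IsHermitian h) : C.dual.conj = C.conj := by
  refine funext fun x => C.conj_eq_of_conj_basis C.dual (fun i => ?_) x
  rw [dual_basis, conj_smul, conj_basis, map_inv₀, sigma_length hh]

theorem smul_basis (c : F₀ˣ) (i : Fin n) :
    (C.smul c).basis i = algebraMap F₀ F c • C.basis i := by
  simp [OrthBasis.smul, Module.Basis.isUnitSMul_apply]

theorem smul_repr (c : F₀ˣ) (x : V) (i : Fin n) :
    (C.smul c).basis.repr x i = (algebraMap F₀ F c)⁻¹ * C.basis.repr x i := by
  simp [OrthBasis.smul, Module.Basis.repr_isUnitSMul, Units.smul_def]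

theorem smul_conj (c : F₀ˣ) : (C.smul c).conj = C.conj := by
  refine funext fun x => C.conj_eq_of_conj_basis (C.smul c) (fun i => ?_) x
  rw [smul_basis, conj_smul, conj_basis, AlgEquiv.commutes]

theorem mem_smul_lattice {c : F₀ˣ} {x : V} :
    x ∈ (C.smul c).lattice ↔ (algebraMap F₀ F c)⁻¹ • x ∈ C.lattice := by
  rw [mem_lattice_iff, mem_lattice_iff]
  simp [smul_repr]

theorem mem_dualLattice_smul {c : F₀ˣ} {x : V} :
    x ∈ dualLattice h (C.smul c).lattice ↔ algebraMap F₀ F c • x ∈ dualLattice h C.lattice := by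
  rw [mem_dualLattice_iff, mem_dualLattice_iff]
  simp only [smul_basis, map_smul_right, smulLeft_apply, AlgEquiv.commutes]

theorem stabilizes_smul_lattice {c : F₀ˣ} {g : LinearMap.GeneralLinearGroup F V} :
    Stabilizes g ((C.smul c).lattice : Set V) ↔ Stabilizes g (C.lattice : Set V) := by
  rw [← stabilizes_setOf_smul (X := (C.lattice : Set V))
    (inv_ne_zero (algebraMap_unit_ne_zero (F := F) c))]
  have : ((C.smul c).lattice : Set V) = {x | (algebraMap F₀ F c)⁻¹ • x ∈ (C.lattice : Set V)} :=
    Set.ext fun x => C.mem_smul_lattice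
  rw [this]

theorem S_eq_of_conj_eq {C C' : OrthBasis h n} (H : C'.conj = C.conj) : C'.S = C.S := by
  simp only [OrthBasis.S, H]

theorem V₀_eq_of_conj_eq {C C' : OrthBasis h n} (H : C'.conj = C.conj) : C'.V₀ = C.V₀ := by
  simp only [OrthBasis.V₀, H]

theorem V₀Dual_eq_of_conj_eq {C C' : OrthBasis h n} (H : C'.conj = C.conj) :
    C'.V₀Dual = C.V₀Dual := by
  simp only [OrthBasis.V₀Dual, H]

theorem GL₀_eq_of_conj_eq {C C' : OrthBasis h n} (H : C'.conj = C.conj) : C'.GL₀ = C.GL₀ := by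
  ext g
  change (∀ x, g.1 (C'.conj x) = C'.conj (g.1 x)) ↔ ∀ x, g.1 (C.conj x) = C.conj (g.1 x)
  rw [H]

theorem conj_dual_basis (hh : IsHermitian h) (i : Fin n) :
    C.conj (C.dual.basis i) = C.dual.basis i := by
  rw [← C.dual_conj hh, conj_basis]

/-- The dual basis is fixed by conjugation, so L₀^∨ spans L^∨ over O_F, and integrality can be
tested on all of L^∨. -/
theorem mem_L₀DualStar_iff (hh : IsHermitian h) {l : Module.Dual F V} (hl : l ∈ C.V₀Dual) :
    l ∈ C.L₀DualStar ↔ ∀ x ∈ C.dual.lattice, ‖l x‖ ≤ 1 := by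
  constructor
  · rintro ⟨-, H⟩ x hx
    rw [← C.dual.basis.sum_repr x, map_sum, ← mem_integers_iff]
    refine sum_mem fun i _ => ?_
    rw [map_smul]
    refine mul_mem (C.dual.mem_lattice_iff.1 hx i) (H _ ⟨?_, C.conj_dual_basis hh i⟩)
    rw [← dual_lattice]
    exact C.dual.basis_mem_lattice i
  · intro H
    refine ⟨hl, fun x hx => mem_integers_iff.2 (H x ?_)⟩
    have := hx.1
    rwa [← dual_lattice] at this

section Sum

variable (B : OrthBasis h n) (a lam : F₀ˣ)

theorem mem_sum_lattice {x : V × F} : x ∈ (B.sum a lam).lattice ↔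
    (algebraMap F₀ F lam)⁻¹ • x ∈ extLattice (B.smul lam⁻¹).lattice 1 := by
  have hl := algebraMap_unit_ne_zero (F := F) lam
  rw [extLattice, Set.mem_ofPred_eq, mem_smul_lattice, mem_lattice_iff, mem_lattice_iff,
    Fin.forall_fin_succ', sum_repr_last]
  simp only [sum_repr_castSucc, mem_integers_iff, one_mul, Prod.smul_fst, Prod.smul_snd,
    smul_eq_mul, Units.val_inv_eq_inv_val, map_inv₀, inv_inv, smul_smul, mul_inv_cancel₀ hl, one_smul]

theorem mem_dualLattice_sum {x : V × F} :
    x ∈ dualLattice (orthSum h a) (B.sum a lam).lattice ↔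
      algebraMap F₀ F lam • x ∈ extLattice (B.smul lam⁻¹).dual.lattice (algebraMap F₀ F a) := by
  have hl := algebraMap_unit_ne_zero (F := F) lam
  rw [extLattice, Set.mem_ofPred_eq, ← SetLike.mem_coe, dual_lattice, mem_dualLattice_smul,
    mem_dualLattice_iff, mem_dualLattice_iff, Fin.forall_fin_succ', sum_basis_last]
  simp only [sum_basis_castSucc, orthSum_apply, Prod.smul_fst, Prod.smul_snd, smul_eq_mul,
    map_zero, mul_zero, add_zero, zero_add, AlgEquiv.commutes, Units.val_inv_eq_inv_val, map_inv₀,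
    smul_smul, inv_mul_cancel₀ hl, one_smul, mem_integers_iff]
  refine and_congr Iff.rfl ?_
  rw [show x.2 * algebraMap F₀ F a * algebraMap F₀ F lam =
    algebraMap F₀ F a * (algebraMap F₀ F lam * x.2) by ring]

theorem stabilizes_sum_lattice {g : LinearMap.GeneralLinearGroup F (V × F)} :
    Stabilizes g ((B.sum a lam).lattice : Set (V × F)) ↔
      Stabilizes g (extLattice (B.smul lam⁻¹).lattice 1) := by
  rw [← stabilizes_setOf_smul (X := extLattice _ _)
    (inv_ne_zero (algebraMap_unit_ne_zero (F := F) lam))]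
  have : ((B.sum a lam).lattice : Set (V × F)) =
      {x | (algebraMap F₀ F lam)⁻¹ • x ∈ extLattice (B.smul lam⁻¹).lattice 1} :=
    Set.ext fun x => B.mem_sum_lattice a lam
  rw [this]

theorem stabilizes_dualLattice_sum {g : LinearMap.GeneralLinearGroup F (V × F)} :
    Stabilizes g (dualLattice (orthSum h a) (B.sum a lam).lattice) ↔
      Stabilizes g (extLattice (B.smul lam⁻¹).dual.lattice (algebraMap F₀ F a)) := by
  rw [← stabilizes_setOf_smul (X := extLattice _ _) (algebraMap_unit_ne_zero (F := F) lam)]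
  have : dualLattice (orthSum h a) (B.sum a lam).lattice = {x | algebraMap F₀ F lam • x ∈
      extLattice (B.smul lam⁻¹).dual.lattice (algebraMap F₀ F a)} :=
    Set.ext fun x => B.mem_dualLattice_sum a lam
  rw [this]

/-- Rescaling by λ⁻¹ divides the form by λ², and (e_L, e_L) = λ²a. -/
theorem norm_le_of_satisfiesReduction (H : SatisfiesReduction (orthSum h a)
    ((B.sum a lam).lattice : Set (V × F)) (0, algebraMap F₀ F lam)) {x y : V}
    (hx : x ∈ (B.smul lam⁻¹).lattice) (hy : y ∈ (B.smul lam⁻¹).lattice) :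
    ‖h x y‖ ≤ ‖algebraMap F₀ F a‖ := by
  have hl := algebraMap_unit_ne_zero (F := F) lam
  have key : ∀ x ∈ (B.smul lam⁻¹).lattice,
      ((algebraMap F₀ F lam • x, 0) : V × F) ∈ ((B.sum a lam).lattice : Set (V × F)) := by
    intro x hx
    rw [SetLike.mem_coe, mem_sum_lattice]
    refine ⟨?_, by simp⟩
    change (algebraMap F₀ F lam)⁻¹ • algebraMap F₀ F lam • x ∈ _
    rwa [smul_smul, inv_mul_cancel₀ hl, one_smul]
  have h1 := H.2 _ (key x hx) _ (key y hy)
  rw [orthSum_apply, orthSum_apply] at h1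
  simp only [map_smul_right, smulLeft_apply, map_zero, zero_add, add_zero, mul_zero,
    AlgEquiv.commutes, norm_mul] at h1
  have h2 : 0 < ‖algebraMap F₀ F lam‖ := norm_pos_iff.2 hl
  have h3 : 0 < ‖algebraMap F₀ F lam‖ * ‖algebraMap F₀ F lam‖ := mul_pos h2 h2
  refine le_of_mul_le_mul_left ?_ h3
  linarith

end Sum

/-- This inclusion M ⊆ a M^∨ is the form in which the reduction hypothesis is used. -/
theorem inv_smul_mem_dual {a : F₀ˣ}
    (hred : ∀ x ∈ C.lattice, ∀ y ∈ C.lattice, ‖h x y‖ ≤ ‖algebraMap F₀ F a‖) {x : V}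
    (hx : x ∈ C.lattice) : (algebraMap F₀ F a)⁻¹ • x ∈ C.dual.lattice := by
  rw [← SetLike.mem_coe, dual_lattice]
  intro y hy
  rw [smulLeft_apply, mem_integers_iff, norm_mul, norm_inv]
  exact inv_mul_le_one_of_le₀ (hred x hx y hy) (norm_nonneg _)

/-- The lattice M ⊕ O_F e yields u ∈ M, and M^∨ ⊕ a⁻¹O_F e yields l(M^∨) ⊆ O_F. Conversely these two
lattices also require l(M)/a ⊆ O_F and a⁻¹u ∈ M^∨, both of which follow from M ⊆ a M^∨. -/
theorem psi_stabilizes_iff {a : F₀ˣ}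
    (hred : ∀ x ∈ C.lattice, ∀ y ∈ C.lattice, ‖h x y‖ ≤ ‖algebraMap F₀ F a‖) {τ τ' : F}
    (hτ : τ ≠ 0) (hτ' : τ' ≠ 0) (hτ1 : ‖τ‖ = 1) (hτ1' : ‖τ'‖ = 1)
    (t : tripleSet V (algebraMap F₀ F a) τ τ') :
    (Stabilizes (psi hτ hτ' t) (extLattice C.lattice 1) ∧
      Stabilizes (psi hτ hτ' t) (extLattice C.dual.lattice (algebraMap F₀ F a))) ↔
    (Stabilizes t.1.1 (C.lattice : Set V) ∧ Stabilizes t.1.1 (dualLattice h C.lattice)) ∧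
      t.1.2.1 ∈ C.lattice ∧ ∀ x ∈ C.dual.lattice, ‖t.1.2.2 x‖ ≤ 1 := by
  have ha := algebraMap_unit_ne_zero (F := F) a
  constructor
  · rintro ⟨h1, h2⟩
    obtain ⟨h3, h4⟩ := stabilizes_of_psi_stabilizes hτ hτ' hτ1 hτ1' one_ne_zero t h1
    obtain ⟨h5, -⟩ := stabilizes_of_psi_stabilizes hτ hτ' hτ1 hτ1' ha t h2
    rw [dual_lattice] at h5
    rw [inv_one, one_smul] at h4
    exact ⟨⟨h3, h5⟩, h4, fun x hx => norm_le_one_of_psi_stabilizes hτ hτ' ha hτ1' t h2 hx⟩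
  · rintro ⟨⟨h1, h2⟩, h3, h4⟩
    rw [← dual_lattice] at h2
    refine ⟨psi_stabilizes hτ hτ' hτ1 hτ1' one_ne_zero t h1 (by simpa using h3) fun x hx => ?_,
      psi_stabilizes hτ hτ' hτ1 hτ1' ha t h2 (C.inv_smul_mem_dual hred h3) fun x hx => ?_⟩
    · have := h4 _ (C.inv_smul_mem_dual hred hx)
      rwa [map_smul, smul_eq_mul, ← one_mul (_ * _)] at this
    · rw [mul_inv_cancel_left₀ ha]
      exact h4 x hx

end OrthBasis
end Lattices

/-! ### The transfer factors -/

section TransferFactor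

theorem pow_apply_sub_mem_span {F M : Type*} [Field F] [AddCommGroup M] [Module F M]
    {f : Module.End F M} {w : ℕ → M}
    (hw : ∀ j, f (w j) - w (j + 1) ∈ Submodule.span F (w '' (Finset.range (j + 1) : Set ℕ)))
    (i : ℕ) : (f ^ i) (w 0) - w i ∈ Submodule.span F (w '' (Finset.range i : Set ℕ)) := by
  induction i with
  | zero => simp
  | succ i ih =>
    have e : (f ^ (i + 1)) (w 0) - w (i + 1) = f ((f ^ i) (w 0) - w i) + (f (w i) - w (i + 1)) := by
      rw [pow_succ', Module.End.mul_apply, map_sub]; abel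
    rw [e]
    refine add_mem ?_ (hw i)
    have : Submodule.span F (w '' (Finset.range i : Set ℕ)) ≤
        (Submodule.span F (w '' (Finset.range (i + 1) : Set ℕ))).comap f := by
      rw [Submodule.span_le]
      rintro _ ⟨j, hj, rfl⟩
      have hj' : j < i := by simpa using hj
      rw [SetLike.mem_coe, Submodule.mem_comap, ← sub_add_cancel (f (w j)) (w (j + 1))]
      refine add_mem (Submodule.span_mono (Set.image_mono ?_) (hw j))
        (Submodule.subset_span ⟨j + 1, by simpa using hj', rfl⟩)
      intro k hk
      simp only [Finset.coe_range, Set.mem_Iio] at hk ⊢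
      omega
    exact this ih

theorem exists_sum_range_eq_of_mem_span {F M : Type*} [Field F] [AddCommGroup M] [Module F M]
    {w : ℕ → M} {i : ℕ} {x : M}
    (hx : x ∈ Submodule.span F (w '' (Finset.range i : Set ℕ))) :
    ∃ c : ℕ → F, ∑ j ∈ Finset.range i, c j • w j = x := by
  obtain ⟨c, hc⟩ := (Submodule.mem_span_image_finset_iff_exists_fun F).1 hx
  refine ⟨fun j => if hj : j ∈ Finset.range i then c ⟨j, hj⟩ else 0, ?_⟩
  rw [← hc, ← Finset.sum_coe_sort]
  refine Finset.sum_congr rfl fun j _ => ?_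
  exact congrArg (· • w j) (dif_pos j.2)

/-- If f sends each wⱼ to w_{j+1} modulo the span of w₀, …, wⱼ, then the iterates of w₀ differ from
the wᵢ by a unitriangular matrix. -/
theorem det_pow_apply_eq {F M : Type*} [Field F] [AddCommGroup M] [Module F M] {N : ℕ}
    (b : Module.Basis (Fin N) F M) {f : Module.End F M} {w : ℕ → M}
    (hw : ∀ j, f (w j) - w (j + 1) ∈ Submodule.span F (w '' (Finset.range (j + 1) : Set ℕ))) :
    (b.det fun i : Fin N => (f ^ (i : ℕ)) (w 0)) = b.det fun i : Fin N => w i := by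
  choose c hc using fun i => exists_sum_range_eq_of_mem_span (pow_apply_sub_mem_span hw i)
  let T : Matrix (Fin N) (Fin N) F := Matrix.of fun i j =>
    (if j = i then 1 else 0) + (if (j : ℕ) < i then c i j else 0)
  have hT : ∀ i : Fin N, (f ^ (i : ℕ)) (w 0) = ∑ j, T i j • w j := by
    intro i
    simp only [T, Matrix.of_apply, add_smul, Finset.sum_add_distrib, ite_smul, one_smul, zero_smul,
      Finset.sum_ite_eq', Finset.mem_univ, if_true]
    rw [Fin.sum_univ_eq_sum_range (fun j => if j < (i : ℕ) then c i j • w j else 0) N,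
      ← Finset.sum_filter]
    have : (Finset.range N).filter (fun j => j < (i : ℕ)) = Finset.range i := by
      ext j
      have := i.2
      simp only [Finset.mem_filter, Finset.mem_range]
      omega
    rw [this, hc, add_sub_cancel]
  have hM : b.toMatrix (fun i : Fin N => (f ^ (i : ℕ)) (w 0)) =
      b.toMatrix (fun i : Fin N => w i) * T.transpose := by
    ext k i
    rw [Module.Basis.toMatrix_apply, hT, Matrix.mul_apply, map_sum, Finsupp.finsetSum_apply]
    refine Finset.sum_congr rfl fun j _ => ?_
    rw [map_smul, Finsupp.smul_apply, smul_eq_mul, mul_comm]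
    rfl
  have hdet : T.det = 1 := by
    rw [Matrix.det_of_isLowerTriangular T]
    · simp [T]
    · intro i j hij
      have hij' : i < j := hij
      have h1 : ¬ j = i := hij'.ne'
      have h2 : ¬ j < i := hij'.not_gt
      simp [T, h1, h2]
  rw [Module.Basis.det_apply, Module.Basis.det_apply, hM, Matrix.det_mul, Matrix.det_transpose,
    hdet, mul_one]

variable {F₀ F : Type*} [NontriviallyNormedField F₀] [IsUltrametricDist F₀]
  [LocallyCompactSpace F₀] [NontriviallyNormedField F] [IsUltrametricDist F]
  [LocallyCompactSpace F] [NormedAlgebra F₀ F] [Algebra.IsQuadraticExtension F₀ F]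
  {σ : F ≃ₐ[F₀] F} {V : Type*} [AddCommGroup V] [Module F V]
  {h : SesqForm σ V}

namespace OrthBasis

variable {n : ℕ} (B : OrthBasis h n)

theorem det_mem_integers {ι : Type*} [Fintype ι] [DecidableEq ι] (b : Module.Basis ι F V)
    {f : Module.End F V} (hf : ∀ i j, b.repr (f (b j)) i ∈ integers F) :
    LinearMap.det f ∈ integers F := by
  rw [← LinearMap.det_toMatrix b, Matrix.det_apply]
  refine sum_mem fun p _ => ?_
  rw [Units.smul_def, zsmul_eq_mul]
  refine mul_mem (intCast_mem _ _) (prod_mem fun i _ => ?_)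
  rw [LinearMap.toMatrix_apply]
  exact hf _ _

theorem norm_det_aeval_le_one {g k : LinearMap.GeneralLinearGroup F V}
    (hk : ∀ x ∈ B.lattice, (k⁻¹ * g * k).1 x ∈ B.lattice) (P : Polynomial (integers F)) :
    ‖LinearMap.det (Polynomial.aeval g.1 P)‖ ≤ 1 := by
  have h1 : LinearMap.det (Polynomial.aeval g.1 P) =
      LinearMap.det (Polynomial.aeval (k⁻¹ * g * k).1 P) := by
    change _ = LinearMap.det (Polynomial.aeval (k⁻¹.1 * g.1 * k.1) P)
    rw [aeval_conj, map_mul, map_mul, mul_right_comm, ← map_mul]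
    rw [show k⁻¹.1 * k.1 = 1 from k.inv_mul, map_one, one_mul]
  rw [h1, ← mem_integers_iff]
  exact det_mem_integers B.basis fun i j =>
    B.mem_lattice_iff.1 (aeval_apply_mem hk P (B.basis_mem_lattice j)) i

theorem sum_det_snoc [FiniteDimensional F V] (a lam : F₀ˣ) (v : Fin n → V) :
    (B.sum a lam).basis.det (Fin.snoc (α := fun _ => V × F)
      (fun i => (algebraMap F₀ F lam • v i, 0)) (0, algebraMap F₀ F lam)) =
    (B.smul lam⁻¹).basis.det v := by
  let E : Module.End F V := (B.smul lam⁻¹).basis.constr F v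
  have hl := algebraMap_unit_ne_zero (F := F) lam
  have hE : ∀ i, E (B.basis i) = algebraMap F₀ F lam • v i := by
    intro i
    have : B.basis i = algebraMap F₀ F lam • (B.smul lam⁻¹).basis i := by
      rw [smul_basis, smul_smul, Units.val_inv_eq_inv_val, map_inv₀, mul_inv_cancel₀ hl, one_smul]
    rw [this, map_smul, Module.Basis.constr_basis]
  have h1 : Fin.snoc (α := fun _ => V × F) (fun i => (algebraMap F₀ F lam • v i, 0))
      (0, algebraMap F₀ F lam) = (E.prodMap LinearMap.id) ∘ (B.sum a lam).basis := by
    funext i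
    refine Fin.lastCases ?_ (fun i => ?_) i
    · rw [Fin.snoc_last, Function.comp_apply, sum_basis_last]
      simp
    · rw [Fin.snoc_castSucc, Function.comp_apply, sum_basis_castSucc, LinearMap.prodMap_apply, hE]
      simp
  have h2 : v = E ∘ (B.smul lam⁻¹).basis := by
    funext i
    rw [Function.comp_apply, Module.Basis.constr_basis]
  rw [h1, Module.Basis.det_comp, Module.Basis.det_self, mul_one, LinearMap.det_prodMap,
    LinearMap.det_id, mul_one]
  conv_rhs => rw [h2]
  rw [Module.Basis.det_comp, Module.Basis.det_self, mul_one]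

/-- The sequence `e_L, τ⁻¹ λ u, τ⁻¹ λ g u, τ⁻¹ λ g² u, …`. -/
def transferSeq (c τ : F) (g : LinearMap.GeneralLinearGroup F V) (u : V) : ℕ → V × F
  | 0 => (0, c)
  | j + 1 => (c • τ⁻¹ • (g ^ j).1 u, 0)

/-- On vectors of V, ψ is g plus a multiple of u - e, and u - e lies in the span of the first two
terms. On the initial term, ψ(w₀) = w₁ + (1 - τ⁻¹)w₀. -/
theorem psi_transferSeq_sub_mem {a c : F} (hc : c ≠ 0) {τ τ' : F} (hτ : τ ≠ 0)
    (hτ' : τ' ≠ 0) (t : tripleSet V a τ τ') (j : ℕ) :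
    (psi hτ hτ' t).1 (transferSeq c τ t.1.1 t.1.2.1 j) - transferSeq c τ t.1.1 t.1.2.1 (j + 1) ∈
      Submodule.span F (transferSeq c τ t.1.1 t.1.2.1 '' (Finset.range (j + 1) : Set ℕ)) := by
  have h0 : ∀ j, transferSeq c τ t.1.1 t.1.2.1 0 ∈
      Submodule.span F (transferSeq c τ t.1.1 t.1.2.1 '' (Finset.range (j + 1) : Set ℕ)) :=
    fun j => Submodule.subset_span ⟨0, by simp, rfl⟩
  cases j with
  | zero =>
    have : (psi hτ hτ' t).1 (transferSeq c τ t.1.1 t.1.2.1 0) -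
        transferSeq c τ t.1.1 t.1.2.1 (0 + 1) =
        (1 - τ⁻¹) • transferSeq c τ t.1.1 t.1.2.1 0 := by
      rw [psi_apply]
      refine Prod.ext ?_ ?_
      · simp [transferSeq, smul_smul, mul_comm]
      · simp [transferSeq]; ring
    rw [this]
    exact Submodule.smul_mem _ _ (h0 0)
  | succ j =>
    obtain ⟨m, hm⟩ : ∃ m : F, (psi hτ hτ' t).1 (transferSeq c τ t.1.1 t.1.2.1 (j + 1)) -
        transferSeq c τ t.1.1 t.1.2.1 (j + 1 + 1) = (m • t.1.2.1, -m) := by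
      refine ⟨τ⁻¹ * (0 - a⁻¹ * t.1.2.2 (t.1.1.1 (c • τ⁻¹ • (t.1.1 ^ j).1 t.1.2.1))), ?_⟩
      rw [psi_apply]
      refine Prod.ext ?_ ?_
      · simp [transferSeq, pow_succ']
      · simp [transferSeq]
    have e : ((m • t.1.2.1, -m) : V × F) =
        (-(m * c⁻¹)) • transferSeq c τ t.1.1 t.1.2.1 0 +
          (m * τ * c⁻¹) • transferSeq c τ t.1.1 t.1.2.1 1 := by
      refine Prod.ext ?_ ?_
      · simp [transferSeq, smul_smul, mul_assoc, hc, hτ]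
      · simp [transferSeq, hc]
    rw [hm, e]
    exact add_mem (Submodule.smul_mem _ _ (h0 _))
      (Submodule.smul_mem _ _ (Submodule.subset_span ⟨1, by simp, rfl⟩))

/-- Moving e_L from the first place to the last changes the determinant by a sign, and η(-1) = 1. -/
theorem eta_det_snoc {M : Type*} [AddCommGroup M] [Module F M] {n : ℕ}
    (b : Module.Basis (Fin (n + 1)) F M) (w : ℕ → M) :
    eta (b.det (Fin.snoc (α := fun _ => M) (fun i : Fin n => w (i + 1)) (w 0))) =
      eta (b.det fun i : Fin (n + 1) => w i) := by
  have h2 : (fun i : Fin (n + 1) => w i) = Fin.cons (α := fun _ => M) (w 0)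
      (fun i : Fin n => w (i + 1)) := by
    funext i
    refine Fin.cases rfl (fun i => ?_) i
    simp
  have h3 : (Fin.snoc (α := fun _ => M) (fun i : Fin n => w (i + 1)) (w 0)) =
      (fun i : Fin (n + 1) => w i) ∘ finRotate (n + 1) := by
    rw [h2, Fin.snoc_eq_cons_rotate]
    rfl
  rw [h3, AlternatingMap.map_perm, Units.smul_def, zsmul_eq_mul, eta_mul_of_norm_eq_one]
  rcases Int.units_eq_one_or (Equiv.Perm.sign (finRotate (n + 1))) with h | h <;> simp [h]

theorem eta_det_smul {M : Type*} [AddCommGroup M] [Module F M] {n : ℕ}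
    (b : Module.Basis (Fin n) F M) {c : F} (hc : ‖c‖ = 1) (v : Fin n → M) :
    eta (b.det fun i => c • v i) = eta (b.det v) := by
  rw [AlternatingMap.map_smul_univ b.det (fun _ => c) v, smul_eq_mul, eta_mul_of_norm_eq_one]
  simp [hc]

theorem transferFactor_psi [FiniteDimensional F V] {a : F₀ˣ} (lam : F₀ˣ) {τ τ' : F} (hτ : τ ≠ 0)
    (hτ' : τ' ≠ 0) (hτ1 : ‖τ‖ = 1) (t : tripleSet V (algebraMap F₀ F a) τ τ') :
    (B.sum a lam).transferFactor (psi hτ hτ' t) (0, algebraMap F₀ F lam) =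
      (B.smul lam⁻¹).transferFactor t.1.1 t.1.2.1 := by
  have hl := algebraMap_unit_ne_zero (F := F) lam
  have h0 : ((0 : V), algebraMap F₀ F lam) =
      transferSeq (algebraMap F₀ F lam) τ t.1.1 t.1.2.1 0 := rfl
  have h1 := det_pow_apply_eq (B.sum a lam).basis (psi_transferSeq_sub_mem hl hτ hτ' t)
  rw [transferFactor, transferFactor, h0]
  simp only [Units.val_pow_eq_pow_val]
  rw [h1, ← eta_det_snoc,
    ← eta_det_smul (B.smul lam⁻¹).basis (c := τ⁻¹) (by rw [norm_inv, hτ1, inv_one])]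
  exact congrArg eta (B.sum_det_snoc a lam
    (fun i : Fin n => τ⁻¹ • (t.1.1.1 ^ (i : ℕ)) t.1.2.1))

/-- P(g) commutes with the powers of g, so the determinant is multiplied by det P(g). Since g has a
stable lattice, det P(g) and det Q(g) are integral; their product is 1, so det P(g) is a unit. -/
theorem transferFactor_polyTwist [FiniteDimensional F V] {P Q : Polynomial (integers F)}
    {y : LinearMap.GeneralLinearGroup F V × V × Module.Dual F V} (hy : y ∈ twistSet V P Q)
    {k : LinearMap.GeneralLinearGroup F V}
    (hk : ∀ x ∈ B.lattice, (k⁻¹ * y.1 * k).1 x ∈ B.lattice) :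
    B.transferFactor (polyTwist P Q y).1 (polyTwist P Q y).2.1 = B.transferFactor y.1 y.2.1 := by
  have h1 : (fun i : Fin n => (y.1 ^ (i : ℕ)).1 (Polynomial.aeval y.1.1 P y.2.1)) =
      (Polynomial.aeval y.1.1 P) ∘ fun i : Fin n => (y.1 ^ (i : ℕ)).1 y.2.1 := by
    funext i
    have : y.1.1 ^ (i : ℕ) * Polynomial.aeval y.1.1 P =
        Polynomial.aeval y.1.1 P * y.1.1 ^ (i : ℕ) := by
      have := aeval_mul_comm y.1.1 (Polynomial.X ^ (i : ℕ)) P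
      rwa [map_pow, Polynomial.aeval_X] at this
    exact LinearMap.congr_fun this y.2.1
  change eta (B.basis.det fun i : Fin n => (y.1 ^ (i : ℕ)).1 (Polynomial.aeval y.1.1 P y.2.1)) = _
  rw [h1, Module.Basis.det_comp]
  refine eta_mul_of_norm_eq_one ?_ _
  have h2 := B.norm_det_aeval_le_one hk P
  have h3 := B.norm_det_aeval_le_one hk Q
  have h4 : ‖LinearMap.det (Polynomial.aeval y.1.1 P)‖ *
      ‖LinearMap.det (Polynomial.aeval y.1.1 Q)‖ = 1 := by
    rw [← norm_mul, ← map_mul, show _ = _ from hy, map_one, norm_one]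
  have := norm_nonneg (LinearMap.det (Polynomial.aeval y.1.1 P))
  have := norm_nonneg (LinearMap.det (Polynomial.aeval y.1.1 Q))
  nlinarith

end OrthBasis
end TransferFactor

/-! ### Comparison of the orbital integrals -/

section Comparison

/-- Bases with the same conjugation define propositionally equal groups `GL₀`; this transports the
normalized integral from one to the other. -/
theorem haarIntegral_congr_subgroup {G : Type*} [Group G] [TopologicalSpace G]
    [IsTopologicalGroup G] {H H' : Subgroup G} [LocallyCompactSpace H] [LocallyCompactSpace H']
    (e : H = H') {K : Set H} {K' : Set H'}
    (hK : ∀ g (hg : g ∈ H) (hg' : g ∈ H'), (⟨g, hg⟩ : H) ∈ K ↔ (⟨g, hg'⟩ : H') ∈ K')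
    {φ : H → ℂ} {φ' : H' → ℂ}
    (hφ : ∀ g (hg : g ∈ H) (hg' : g ∈ H'), φ ⟨g, hg⟩ = φ' ⟨g, hg'⟩) :
    haarIntegral K φ = haarIntegral K' φ' := by
  subst e
  have h1 : K = K' := Set.ext fun g => hK g g.2 g.2
  have h2 : φ = φ' := funext fun g => hφ g g.2 g.2
  rw [h1, h2]

theorem haarIntegral_eq_zero {G : Type*} [Group G] [TopologicalSpace G]
    [IsTopologicalGroup G] [LocallyCompactSpace G] {K : Set G} {φ : G → ℂ} (hφ : ∀ g, φ g = 0) :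
    haarIntegral K φ = 0 := by
  rw [funext hφ, haarIntegral]
  simp

theorem haarIntegral_const_mul {G : Type*} [Group G] [TopologicalSpace G]
    [IsTopologicalGroup G] [LocallyCompactSpace G] {K : Set G} (c : ℂ) (φ : G → ℂ) :
    haarIntegral K (fun g => c * φ g) = c * haarIntegral K φ := by
  rw [haarIntegral, haarIntegral]
  exact integral_const_mul _ _

variable {F₀ F : Type*} [NontriviallyNormedField F₀] [IsUltrametricDist F₀]
  [LocallyCompactSpace F₀] [NontriviallyNormedField F] [IsUltrametricDist F]
  [LocallyCompactSpace F] [NormedAlgebra F₀ F] [Algebra.IsQuadraticExtension F₀ F]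
  {σ : F ≃ₐ[F₀] F} {V : Type*} [AddCommGroup V] [Module F V]
  {h : SesqForm σ V}

/-- The function `1_{U(L)} × 1_L`. -/
noncomputable def OrthBasis.semiLieFunU {n : ℕ} (C : OrthBasis h n) :
    LinearMap.GeneralLinearGroup F V × V → ℂ :=
  Set.indicator (unitaryStab h C.lattice ×ˢ (C.lattice : Set V)) fun _ => 1

/-- The function `1_{S(L₀, L₀^∨)} × 1_{L₀} × 1_{(L₀^∨)*}`. -/
noncomputable def OrthBasis.semiLieFunS {n : ℕ} (C : OrthBasis h n) :
    LinearMap.GeneralLinearGroup F V × V × Module.Dual F V → ℂ :=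
  Set.indicator (C.SStab ×ˢ (C.L₀ ×ˢ C.L₀DualStar)) fun _ => 1

theorem indicator_one_congr {X Y : Type*} {s : Set X} {t : Set Y} {x : X} {y : Y}
    (H : x ∈ s ↔ y ∈ t) :
    Set.indicator s (fun _ => (1 : ℂ)) x = Set.indicator t (fun _ => (1 : ℂ)) y := by
  by_cases hx : x ∈ s
  · rw [Set.indicator_of_mem hx, Set.indicator_of_mem (H.1 hx)]
  · rw [Set.indicator_of_notMem hx, Set.indicator_of_notMem (mt H.2 hx)]

namespace OrthBasis

variable {n : ℕ} (B : OrthBasis h n) {a lam : F₀ˣ}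

theorem actG_mem_S {k : LinearMap.GeneralLinearGroup F V} (hk : k ∈ B.GL₀)
    {γ : LinearMap.GeneralLinearGroup F (V × F)} (hγ : γ ∈ (B.sum a lam).S) :
    actG k γ ∈ (B.sum a lam).S := by
  have hk' : ∀ k ∈ B.GL₀, (B.sum a lam).bar (glEmb k).1 = (glEmb k).1 := by
    intro k hk
    rw [← mem_GL₀_iff]
    intro x
    rw [sum_conj, glEmb_apply, glEmb_apply, sum_conj]
    exact Prod.ext (hk x.1) rfl
  rw [mem_S_iff] at hγ ⊢
  have e : (actG k γ).1 = (glEmb k⁻¹).1 * γ.1 * (glEmb k).1 := by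
    rw [actG, ← map_inv]; rfl
  have e1 : (glEmb k).1 * (glEmb k⁻¹).1 = 1 := by rw [map_inv]; exact (glEmb k).mul_inv
  have e2 : (glEmb k⁻¹).1 * (glEmb k).1 = 1 := by rw [map_inv]; exact (glEmb k).inv_mul
  rw [e, map_mul, map_mul, hk' _ hk, hk' _ (B.GL₀.inv_mem hk), mul_assoc _ (glEmb k).1,
    ← mul_assoc (glEmb k).1, ← mul_assoc (glEmb k).1, e1, one_mul, ← mul_assoc, mul_assoc _ γ.1, hγ,
    mul_one, e2]

theorem conj_mem_S {k : LinearMap.GeneralLinearGroup F V} (hk : k ∈ B.GL₀)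
    {γ : LinearMap.GeneralLinearGroup F V} (hγ : γ ∈ B.S) : k⁻¹ * γ * k ∈ B.S := by
  have hk' := B.GL₀.inv_mem hk
  rw [mem_S_iff] at hγ ⊢
  rw [mem_GL₀_iff] at hk hk'
  rw [Units.val_mul, Units.val_mul, map_mul, map_mul, hk, hk', mul_assoc _ k.1,
    ← mul_assoc k.1, ← mul_assoc k.1, k.mul_inv, one_mul, ← mul_assoc, mul_assoc _ γ.1, hγ,
    mul_one, k.inv_mul]

theorem apply_mem_V₀ {k : LinearMap.GeneralLinearGroup F V} (hk : k ∈ B.GL₀) {u : V}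
    (hu : u ∈ B.V₀) : k.1 u ∈ B.V₀ := by
  have h1 : k.1 (B.conj u) = B.conj (k.1 u) := hk u
  change B.conj (k.1 u) = k.1 u
  rw [← h1, show B.conj u = u from hu]

theorem comp_mem_V₀Dual {k : LinearMap.GeneralLinearGroup F V} (hk : k ∈ B.GL₀)
    {l : Module.Dual F V} (hl : l ∈ B.V₀Dual) : l.comp k.1 ∈ B.V₀Dual := by
  intro x
  change l (k.1 (B.conj x)) = σ (l (k.1 x))
  rw [show k.1 (B.conj x) = B.conj (k.1 x) from hk x]
  exact hl _

theorem psi_polyTwist_mem_SStab_iff (hh : IsHermitian h)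
    (hred : ∀ x ∈ (B.smul lam⁻¹).lattice, ∀ y ∈ (B.smul lam⁻¹).lattice,
      ‖h x y‖ ≤ ‖algebraMap F₀ F a‖) {τ : F} (hτ : τ ≠ 0) (hτ' : σ τ ≠ 0) (hτ1 : ‖τ‖ = 1)
    {P Q : Polynomial (integers F)} {y : LinearMap.GeneralLinearGroup F V × V × Module.Dual F V}
    (hPQ : y ∈ twistSet V P Q)
    (ht : polyTwist P Q y ∈ tripleSet V (algebraMap F₀ F a) τ (σ τ))
    (hS : psi hτ hτ' ⟨_, ht⟩ ∈ (B.sum a lam).S) (h1 : y.1 ∈ (B.smul lam⁻¹).S)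
    (h2 : y.2.1 ∈ (B.smul lam⁻¹).V₀) (h3 : y.2.2 ∈ (B.smul lam⁻¹).V₀Dual) :
    psi hτ hτ' ⟨_, ht⟩ ∈ (B.sum a lam).SStab ↔ y ∈ (B.smul lam⁻¹).SStab ×ˢ
      ((B.smul lam⁻¹).L₀ ×ˢ (B.smul lam⁻¹).L₀DualStar) := by
  set C := B.smul lam⁻¹ with hC
  have key := C.psi_stabilizes_iff hred hτ hτ' hτ1 ((norm_sigma σ τ).trans hτ1) ⟨_, ht⟩
  have e1 : psi hτ hτ' ⟨_, ht⟩ ∈ (B.sum a lam).SStab ↔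
      (Stabilizes (psi hτ hτ' ⟨_, ht⟩) (extLattice C.lattice 1) ∧
      Stabilizes (psi hτ hτ' ⟨_, ht⟩) (extLattice C.dual.lattice (algebraMap F₀ F a))) := by
    change _ ∧ _ ↔ _
    rw [stabilizes_sum_lattice, stabilizes_dualLattice_sum]
    exact and_iff_right hS
  have e2 : y ∈ C.SStab ×ˢ (C.L₀ ×ˢ C.L₀DualStar) ↔
      (Stabilizes y.1 (C.lattice : Set V) ∧ Stabilizes y.1 (dualLattice h C.lattice)) ∧
      y.2.1 ∈ C.lattice ∧ ∀ x ∈ C.dual.lattice, ‖y.2.2 x‖ ≤ 1 := by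
    rw [Set.mem_prod, Set.mem_prod, C.mem_L₀DualStar_iff hh h3]
    exact and_congr (and_iff_right h1) (and_congr (and_iff_left h2) Iff.rfl)
  rw [e1, e2, key]
  -- Once g stabilizes M and M^∨, so do P(g) and Q(g), as polynomials with integral coefficients;
  -- being mutually inverse, they do not alter the conditions on u and l.
  refine and_congr_right fun hst => ?_
  have hM := (stabilizes_iff.1 hst.1).1
  have hM' := (stabilizes_iff.1 hst.2).1
  rw [← dual_lattice] at hM'
  have h4 : ∀ x, Polynomial.aeval y.1.1 P (Polynomial.aeval y.1.1 Q x) = x :=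
    fun x => LinearMap.congr_fun hPQ x
  have h5 : ∀ x, Polynomial.aeval y.1.1 Q (Polynomial.aeval y.1.1 P x) = x :=
    fun x => LinearMap.congr_fun ((aeval_mul_comm y.1.1 Q P).trans hPQ) x
  refine and_congr ⟨fun H => ?_, fun H => aeval_apply_mem hM P H⟩ ⟨fun H x hx => ?_, fun H x hx => ?_⟩
  · rw [← h5 y.2.1]
    exact aeval_apply_mem hM Q H
  · rw [← h4 x, ← h4 x]
    have := H _ (aeval_apply_mem hM' P hx)
    change ‖y.2.2 (Polynomial.aeval y.1.1 Q (Polynomial.aeval y.1.1 P x))‖ ≤ 1 at this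
    rw [h5] at this
    rwa [h4, h4]
  · exact H _ (aeval_apply_mem hM' Q hx)

/-- Only M itself has to be tested: a unitary g stabilizing M also stabilizes M^∨, and l = (·, u) is
integral on M^∨ as soon as u ∈ M. -/
theorem psi_unitaryTriple_mem_unitaryStab_iff (hh : IsHermitian h)
    (hred : ∀ x ∈ (B.smul lam⁻¹).lattice, ∀ y ∈ (B.smul lam⁻¹).lattice,
      ‖h x y‖ ≤ ‖algebraMap F₀ F a‖) {τ : F} (hτ : τ ≠ 0) (hτ' : σ τ ≠ 0) (hτ1 : ‖τ‖ = 1)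
    {x : LinearMap.GeneralLinearGroup F V × V} (hx : x.1 ∈ unitary h)
    (ht : unitaryTriple h x ∈ tripleSet V (algebraMap F₀ F a) τ (σ τ)) :
    psi hτ hτ' ⟨_, ht⟩ ∈ unitaryStab (orthSum h a) (B.sum a lam).lattice ↔
      x ∈ unitaryStab h (B.smul lam⁻¹).lattice ×ˢ ((B.smul lam⁻¹).lattice : Set V) := by
  set C := B.smul lam⁻¹ with hC
  have hτ1' := (norm_sigma σ τ).trans hτ1
  have e1 : psi hτ hτ' ⟨_, ht⟩ ∈ unitaryStab (orthSum h a) (B.sum a lam).lattice ↔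
      Stabilizes (psi hτ hτ' ⟨_, ht⟩) (extLattice C.lattice 1) := by
    change _ ∧ _ ↔ _
    rw [stabilizes_sum_lattice]
    exact and_iff_right (psi_mem_unitary hτ hτ' hh hx rfl)
  rw [e1, Set.mem_prod]
  constructor
  · intro H
    obtain ⟨h1, h2⟩ := stabilizes_of_psi_stabilizes hτ hτ' hτ1 hτ1' one_ne_zero _ H
    rw [inv_one, one_smul] at h2
    exact ⟨⟨hx, h1⟩, h2⟩
  · rintro ⟨⟨-, h1⟩, h2⟩
    refine ((C.psi_stabilizes_iff hred hτ hτ' hτ1 hτ1' ⟨_, ht⟩).2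
      ⟨⟨h1, stabilizes_dualLattice hx h1⟩, h2, fun z hz => ?_⟩).1
    rw [← SetLike.mem_coe, dual_lattice] at hz
    exact mem_integers_iff.1 (hz _ h2)

theorem mem_GL₀Stab_smul_iff {c : F₀ˣ} {g : LinearMap.GeneralLinearGroup F V} (hg : g ∈ B.GL₀)
    (hg' : g ∈ (B.smul c).GL₀) :
    (⟨g, hg⟩ : B.GL₀) ∈ B.GL₀Stab ↔ (⟨g, hg'⟩ : (B.smul c).GL₀) ∈ (B.smul c).GL₀Stab := by
  have hc := algebraMap_unit_ne_zero (F := F) c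
  have hV : ∀ (d : F₀) (x : V), d ≠ 0 → (algebraMap F₀ F d • x ∈ B.V₀ ↔ x ∈ B.V₀) := by
    intro d x hd
    change B.conj _ = _ ↔ B.conj x = x
    rw [conj_smul, AlgEquiv.commutes]
    exact smul_right_inj ((map_ne_zero _).2 hd)
  have h1 : (B.smul c).L₀ = {x | (algebraMap F₀ F c)⁻¹ • x ∈ B.L₀} := by
    ext x
    change x ∈ (B.smul c).lattice ∧ x ∈ (B.smul c).V₀ ↔
      (algebraMap F₀ F c)⁻¹ • x ∈ B.lattice ∧ (algebraMap F₀ F c)⁻¹ • x ∈ B.V₀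
    rw [mem_smul_lattice, V₀_eq_of_conj_eq (B.smul_conj c), ← map_inv₀, hV _ _ (by simp)]
  have h2 : (B.smul c).L₀Dual = {x | algebraMap F₀ F c • x ∈ B.L₀Dual} := by
    ext x
    change x ∈ dualLattice h (B.smul c).lattice ∧ x ∈ (B.smul c).V₀ ↔
      algebraMap F₀ F c • x ∈ dualLattice h B.lattice ∧ algebraMap F₀ F c • x ∈ B.V₀
    rw [mem_dualLattice_smul, V₀_eq_of_conj_eq (B.smul_conj c), hV _ _ (by simp)]
  change Stabilizes g B.L₀ ∧ Stabilizes g B.L₀Dual ↔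
    Stabilizes g (B.smul c).L₀ ∧ Stabilizes g (B.smul c).L₀Dual
  rw [h1, h2, stabilizes_setOf_smul (inv_ne_zero hc), stabilizes_setOf_smul hc]

variable [FiniteDimensional F V]

theorem groupOrbU_psi (hh : IsHermitian h)
    (hred : ∀ x ∈ (B.smul lam⁻¹).lattice, ∀ y ∈ (B.smul lam⁻¹).lattice,
      ‖h x y‖ ≤ ‖algebraMap F₀ F a‖) {τ : F} (hτ : τ ≠ 0) (hτ' : σ τ ≠ 0) (hτ1 : ‖τ‖ = 1)
    {x : LinearMap.GeneralLinearGroup F V × V} (hx : x.1 ∈ unitary h)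
    (ht : unitaryTriple h x ∈ tripleSet V (algebraMap F₀ F a) τ (σ τ)) :
    B.groupOrbU (B.groupFunU a lam) (psi hτ hτ' ⟨_, ht⟩) =
      (B.smul lam⁻¹).orbU (B.smul lam⁻¹).semiLieFunU x := by
  refine haarIntegral_congr_subgroup rfl (fun g hg _ => ?_) (fun g hg _ => ?_)
  · change _ ∧ _ ↔ _ ∧ _
    rw [stabilizes_smul_lattice]
  · refine indicator_one_congr ?_
    have h1 := actS_unitaryTriple hg x
    have h2 := actS_mem_tripleSet g ht
    rw [h1] at h2
    have h3 : actG g (psi hτ hτ' ⟨_, ht⟩) = psi hτ hτ' ⟨_, h2⟩ := by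
      rw [actG_psi]
      congr 1
      exact Subtype.ext h1
    change actG g (psi hτ hτ' ⟨_, ht⟩) ∈ _ ↔ _
    rw [h3]
    refine B.psi_unitaryTriple_mem_unitaryStab_iff hh hred hτ hτ' hτ1 ?_ h2
    exact (unitary h).mul_mem ((unitary h).mul_mem ((unitary h).inv_mem hg) hx) hg

/-- The integrands agree pointwise by equivariance and the lattice criterion. The g-stable lattice
supplied by `hk` enters only through the comparison of transfer factors. -/
theorem groupOrbS_psi (hh : IsHermitian h)
    (hred : ∀ x ∈ (B.smul lam⁻¹).lattice, ∀ y ∈ (B.smul lam⁻¹).lattice,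
      ‖h x y‖ ≤ ‖algebraMap F₀ F a‖) {τ : F} (hτ : τ ≠ 0) (hτ' : σ τ ≠ 0) (hτ1 : ‖τ‖ = 1)
    {P Q : Polynomial (integers F)} {y : LinearMap.GeneralLinearGroup F V × V × Module.Dual F V}
    (hPQ : y ∈ twistSet V P Q)
    (ht : polyTwist P Q y ∈ tripleSet V (algebraMap F₀ F a) τ (σ τ))
    (hS : psi hτ hτ' ⟨_, ht⟩ ∈ (B.sum a lam).S) (h1 : y.1 ∈ (B.smul lam⁻¹).S)
    (h2 : y.2.1 ∈ (B.smul lam⁻¹).V₀) (h3 : y.2.2 ∈ (B.smul lam⁻¹).V₀Dual)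
    {k : LinearMap.GeneralLinearGroup F V}
    (hk : ∀ x ∈ (B.smul lam⁻¹).lattice, (k⁻¹ * y.1 * k).1 x ∈ (B.smul lam⁻¹).lattice) :
    B.groupOrbS a lam (B.groupFunS a lam) (psi hτ hτ' ⟨_, ht⟩) =
      (B.smul lam⁻¹).orbS (B.smul lam⁻¹).semiLieFunS y := by
  have hGL : B.GL₀ = (B.smul lam⁻¹).GL₀ := (GL₀_eq_of_conj_eq (B.smul_conj lam⁻¹)).symm
  rw [groupOrbS, orbS, transferFactor_psi B lam hτ hτ' hτ1,
    transferFactor_polyTwist (B.smul lam⁻¹) hPQ hk]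
  congr 1
  refine haarIntegral_congr_subgroup hGL (fun g hg hg' => B.mem_GL₀Stab_smul_iff hg hg')
    (fun g hg hg' => ?_)
  congr 1
  refine indicator_one_congr ?_
  have h4 := actS_mem_tripleSet g ht
  rw [← actS_polyTwist] at h4
  have h5 : actG g (psi hτ hτ' ⟨_, ht⟩) = psi hτ hτ' ⟨_, h4⟩ := by
    rw [actG_psi]
    congr 1
    exact Subtype.ext (actS_polyTwist P Q g y).symm
  change actG g (psi hτ hτ' ⟨_, ht⟩) ∈ _ ↔ _
  have h6 := B.actG_mem_S hg hS
  rw [h5] at h6 ⊢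
  exact B.psi_polyTwist_mem_SStab_iff hh hred hτ hτ' hτ1 (actS_mem_twistSet g hPQ) h4 h6
    ((B.smul lam⁻¹).conj_mem_S hg' h1)
    ((B.smul lam⁻¹).apply_mem_V₀ ((B.smul lam⁻¹).GL₀.inv_mem hg') h2)
    ((B.smul lam⁻¹).comp_mem_V₀Dual hg' h3)

end OrthBasis
end Comparison

/-! ### Comparison of the transfer statements -/

section Transfer

variable {F₀ F : Type*} [NontriviallyNormedField F₀] [IsUltrametricDist F₀]
  [LocallyCompactSpace F₀] [NontriviallyNormedField F] [IsUltrametricDist F]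
  [LocallyCompactSpace F] [NormedAlgebra F₀ F] [Algebra.IsQuadraticExtension F₀ F]
  {σ : F ≃ₐ[F₀] F} {V : Type*} [AddCommGroup V] [Module F V]
  {h : SesqForm σ V}

theorem actS_actS (m k : LinearMap.GeneralLinearGroup F V)
    (t : LinearMap.GeneralLinearGroup F V × V × Module.Dual F V) :
    actS m (actS k t) = actS (k * m) t := by
  refine Prod.ext ?_ (Prod.ext ?_ rfl)
  · change m⁻¹ * (k⁻¹ * t.1 * k) * m = (k * m)⁻¹ * t.1 * (k * m)
    rw [mul_inv_rev]
    simp only [mul_assoc]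
  · change m⁻¹.1 (k⁻¹.1 t.2.1) = (k * m)⁻¹.1 t.2.1
    rw [mul_inv_rev]
    rfl

theorem actS_one (t : LinearMap.GeneralLinearGroup F V × V × Module.Dual F V) :
    actS 1 t = t := by
  refine Prod.ext ?_ rfl
  change (1 : LinearMap.GeneralLinearGroup F V)⁻¹ * t.1 * 1 = t.1
  rw [inv_one, one_mul, mul_one]

theorem actG_actG (m k : LinearMap.GeneralLinearGroup F V)
    (g : LinearMap.GeneralLinearGroup F (V × F)) : actG m (actG k g) = actG (k * m) g := by
  simp only [actG, map_mul, mul_inv_rev, mul_assoc]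

theorem actG_one (g : LinearMap.GeneralLinearGroup F (V × F)) : actG 1 g = g := by
  simp [actG]

/-- The twist is the action of Q(g), which commutes with g. It therefore stays inside a GL(V)-orbit,
the relation that defines matching, even though it moves points out of V₀ × V₀*. -/
theorem exists_polyTwist_eq_actS {P Q : Polynomial (integers F)}
    {y : LinearMap.GeneralLinearGroup F V × V × Module.Dual F V} (hPQ : y ∈ twistSet V P Q) :
    ∃ p : LinearMap.GeneralLinearGroup F V, polyTwist P Q y = actS p y := by
  have h1 : Polynomial.aeval y.1.1 P * Polynomial.aeval y.1.1 Q = 1 := hPQ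
  have h2 := (aeval_mul_comm y.1.1 Q P).trans h1
  refine ⟨⟨_, _, h2, h1⟩, Prod.ext (Units.ext ?_) rfl⟩
  change y.1.1 = Polynomial.aeval y.1.1 P * y.1.1 * Polynomial.aeval y.1.1 Q
  have h3 := aeval_mul_comm y.1.1 P Polynomial.X
  rw [Polynomial.aeval_X] at h3
  rw [h3, mul_assoc, h1, mul_one]

theorem isRegSemisimple_congr_subgroup {G X : Type*} [Group G] [TopologicalSpace X]
    {H H' : Subgroup G} (e : H = H') (act : G → X → X) (x : X) :
    IsRegSemisimple (fun k : H => act k) x ↔ IsRegSemisimple (fun k : H' => act k) x := by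
  subst e
  rfl

variable [FiniteDimensional F V]

theorem psi_unitaryTriple_mem_unitaryGroupRS_iff (hh : IsHermitian h) {a : F₀ˣ} {τ : F}
    (hτ : τ ≠ 0) (hτ' : σ τ ≠ 0) {x : LinearMap.GeneralLinearGroup F V × V}
    (ht : unitaryTriple h x ∈ tripleSet V (algebraMap F₀ F a) τ (σ τ)) :
    psi hτ hτ' ⟨_, ht⟩ ∈ unitaryGroupRS h a ↔ x ∈ unitaryRS h := by
  let : TopologicalSpace V := moduleTopology F V
  have : IsModuleTopology F V := ⟨rfl⟩
  have h1 := isRegSemisimple_psi_iff hτ hτ' (algebraMap_unit_ne_zero a) (unitary h) ⟨_, ht⟩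
  have h2 := isRegSemisimple_unitaryTriple_iff (h := h) x
  refine and_congr ⟨fun H => mem_unitary_of_psi_mem_unitary hτ hτ' H, fun H =>
    psi_mem_unitary hτ hτ' hh H rfl⟩ (h1.trans h2)

namespace OrthBasis

variable {n : ℕ} (B : OrthBasis h n) {a lam : F₀ˣ}

theorem psi_polyTwist_mem_symmetricGroupRS_iff {τ : F} (hτ : τ ≠ 0) (hτ' : σ τ ≠ 0)
    {P Q : Polynomial (integers F)} {y : LinearMap.GeneralLinearGroup F V × V × Module.Dual F V}
    (hPQ : y ∈ twistSet V P Q)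
    (ht : polyTwist P Q y ∈ tripleSet V (algebraMap F₀ F a) τ (σ τ))
    (hS : psi hτ hτ' ⟨_, ht⟩ ∈ (B.sum a lam).S) (h1 : y.1 ∈ B.S) (h2 : y.2.1 ∈ B.V₀)
    (h3 : y.2.2 ∈ B.V₀Dual) :
    psi hτ hτ' ⟨_, ht⟩ ∈ B.symmetricGroupRS a lam ↔ y ∈ (B.smul lam⁻¹).symmetricRS := by
  let : TopologicalSpace V := moduleTopology F V
  have : IsModuleTopology F V := ⟨rfl⟩
  have hc := B.smul_conj lam⁻¹
  have e1 := isRegSemisimple_psi_iff hτ hτ' (algebraMap_unit_ne_zero a) B.GL₀ ⟨_, ht⟩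
  have e2 := isRegSemisimple_polyTwist_iff B.GL₀ hPQ
  have e3 := isRegSemisimple_congr_subgroup (GL₀_eq_of_conj_eq hc) (actS (V := V) (F := F)) y
  have e4 := e1.trans (e2.trans e3.symm)
  have s1 : y.1 ∈ (B.smul lam⁻¹).S := by rwa [S_eq_of_conj_eq hc]
  have s2 : y.2.1 ∈ (B.smul lam⁻¹).V₀ := by rwa [V₀_eq_of_conj_eq hc]
  have s3 : y.2.2 ∈ (B.smul lam⁻¹).V₀Dual := by rwa [V₀Dual_eq_of_conj_eq hc]
  exact ⟨fun H => ⟨s1, s2, s3, e4.1 H.2⟩, fun H => ⟨hS, e4.2 H.2.2.2⟩⟩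

/-- The transfer statement for `1_{U(L)} × 1_L` and `1_{S(L₀, L₀^∨)} × 1_{L₀} × 1_{(L₀^∨)*}`
at a single point. -/
def SemiLieTransferAt (C : OrthBasis h n)
    (y : LinearMap.GeneralLinearGroup F V × V × Module.Dual F V) : Prop :=
  (∀ x ∈ unitaryRS h, Matches h x y → C.orbS C.semiLieFunS y = C.orbU C.semiLieFunU x) ∧
    ((¬ ∃ x ∈ unitaryRS h, Matches h x y) → C.orbS C.semiLieFunS y = 0)

/-- The transfer statement for `1_{U(L)}` and `1_{S(L₀, L₀^∨)}` at a single point. -/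
def GroupTransferAt (a lam : F₀ˣ) (γ : LinearMap.GeneralLinearGroup F (V × F)) : Prop :=
  (∀ g ∈ unitaryGroupRS h a, GroupMatches g γ →
      B.groupOrbS a lam (B.groupFunS a lam) γ = B.groupOrbU (B.groupFunU a lam) g) ∧
    ((¬ ∃ g ∈ unitaryGroupRS h a, GroupMatches g γ) →
      B.groupOrbS a lam (B.groupFunS a lam) γ = 0)

/-- The symmetric orbital integrals are equal, so it suffices to match the unitary partners: x
matches y by m exactly when ψ(x) matches ψ(twist of y) by mp, where p realizes the twist, and
partners have equal orbital integrals. -/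
theorem groupTransferAt_psi_iff (hh : IsHermitian h)
    (hred : ∀ x ∈ (B.smul lam⁻¹).lattice, ∀ y ∈ (B.smul lam⁻¹).lattice,
      ‖h x y‖ ≤ ‖algebraMap F₀ F a‖) {τ : F} (hτ : τ ≠ 0) (hτ' : σ τ ≠ 0) (hτ1 : ‖τ‖ = 1)
    {P Q : Polynomial (integers F)} {y : LinearMap.GeneralLinearGroup F V × V × Module.Dual F V}
    (hPQ : y ∈ twistSet V P Q)
    (ht : polyTwist P Q y ∈ tripleSet V (algebraMap F₀ F a) τ (σ τ))
    (hS : psi hτ hτ' ⟨_, ht⟩ ∈ (B.sum a lam).S) (h1 : y.1 ∈ B.S) (h2 : y.2.1 ∈ B.V₀)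
    (h3 : y.2.2 ∈ B.V₀Dual) {k : LinearMap.GeneralLinearGroup F V}
    (hk : ∀ x ∈ (B.smul lam⁻¹).lattice, (k⁻¹ * y.1 * k).1 x ∈ (B.smul lam⁻¹).lattice) :
    B.GroupTransferAt a lam (psi hτ hτ' ⟨_, ht⟩) ↔ (B.smul lam⁻¹).SemiLieTransferAt y := by
  have hc := B.smul_conj lam⁻¹
  have ha := algebraMap_unit_ne_zero (F := F) a
  have hOS := B.groupOrbS_psi hh hred hτ hτ' hτ1 hPQ ht hS (by rwa [S_eq_of_conj_eq hc])
    (by rwa [V₀_eq_of_conj_eq hc]) (by rwa [V₀Dual_eq_of_conj_eq hc]) hk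
  obtain ⟨p, hp⟩ := exists_polyTwist_eq_actS hPQ
  have fwd : ∀ x ∈ unitaryRS h, Matches h x y → ∃ g ∈ unitaryGroupRS h a,
      GroupMatches g (psi hτ hτ' ⟨_, ht⟩) ∧ B.groupOrbU (B.groupFunU a lam) g =
        (B.smul lam⁻¹).orbU (B.smul lam⁻¹).semiLieFunU x := by
    intro x hx hxy
    obtain ⟨m, hm⟩ := matches_iff.1 hxy
    have e1 : actS (m * p) (unitaryTriple h x) = polyTwist P Q y := by
      rw [hp, ← actS_actS, hm]
    have e2 : unitaryTriple h x ∈ tripleSet V (algebraMap F₀ F a) τ (σ τ) := by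
      have := actS_mem_tripleSet (m * p)⁻¹ ht
      rwa [← e1, actS_actS, mul_inv_cancel, actS_one] at this
    refine ⟨psi hτ hτ' ⟨_, e2⟩,
      (psi_unitaryTriple_mem_unitaryGroupRS_iff hh hτ hτ' e2).2 hx, ⟨m * p, ?_⟩,
      B.groupOrbU_psi hh hred hτ hτ' hτ1 hx.1 e2⟩
    rw [actG_psi]
    congr 1
    exact Subtype.ext e1
  -- A partner g is conjugate to a ψ-value, hence is itself one; its unitarity then forces the
  -- triple to have the form (x₁, x₂, (·, x₂)).
  have bwd : ∀ g ∈ unitaryGroupRS h a, GroupMatches g (psi hτ hτ' ⟨_, ht⟩) →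
      ∃ x ∈ unitaryRS h, Matches h x y ∧ B.groupOrbU (B.groupFunU a lam) g =
        (B.smul lam⁻¹).orbU (B.smul lam⁻¹).semiLieFunU x := by
    rintro g hg ⟨m, hm⟩
    have e1 := actS_mem_tripleSet m⁻¹ ht
    have e2 : g = psi hτ hτ' ⟨_, e1⟩ := by
      rw [← actG_psi hτ hτ' m⁻¹ ⟨_, ht⟩, ← hm, actG_actG, mul_inv_cancel, actG_one]
    have hgu := hg.1
    rw [e2] at hgu
    have e3 := eq_flip_of_psi_mem_unitary hτ hτ' hgu
    have e4 := mem_unitary_of_psi_mem_unitary hτ hτ' hgu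
    obtain ⟨x, hx⟩ : ∃ x, actS m⁻¹ (polyTwist P Q y) = unitaryTriple h x :=
      ⟨((actS m⁻¹ (polyTwist P Q y)).1, (actS m⁻¹ (polyTwist P Q y)).2.1),
        Prod.ext rfl (Prod.ext rfl e3)⟩
    have e5 := e1
    rw [hx] at e5
    have e6 : g = psi hτ hτ' ⟨_, e5⟩ := by
      rw [e2]
      congr 1
      exact Subtype.ext hx
    have hxu : x.1 ∈ unitary h := by
      have : x.1 = (actS m⁻¹ (polyTwist P Q y)).1 := by rw [hx]; rfl
      rw [this]
      exact e4
    rw [e6] at hg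
    refine ⟨x, (psi_unitaryTriple_mem_unitaryGroupRS_iff hh hτ hτ' e5).1 hg,
      matches_iff.2 ⟨m * p⁻¹, ?_⟩, ?_⟩
    · rw [← actS_actS, ← hx, actS_actS m, inv_mul_cancel, actS_one, hp, actS_actS, mul_inv_cancel,
        actS_one]
    · rw [e6]
      exact B.groupOrbU_psi hh hred hτ hτ' hτ1 hxu e5
  rw [GroupTransferAt, SemiLieTransferAt, hOS]
  refine and_congr ⟨fun H x hx hxy => ?_, fun H g hg hgγ => ?_⟩ (imp_congr_left (not_congr
    ⟨fun ⟨g, hg, hgγ⟩ => ?_, fun ⟨x, hx, hxy⟩ => ?_⟩))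
  · obtain ⟨g, hg, hgγ, e⟩ := fwd x hx hxy
    rw [H g hg hgγ, e]
  · obtain ⟨x, hx, hxy, e⟩ := bwd g hg hgγ
    rw [H x hx hxy, e]
  · obtain ⟨x, hx, hxy, -⟩ := bwd g hg hgγ
    exact ⟨x, hx, hxy⟩
  · obtain ⟨g, hg, hgγ, -⟩ := fwd x hx hxy
    exact ⟨g, hg, hgγ⟩

end OrthBasis

/-! ### Scalars of norm one -/

section Scalars

/-- The scalar `ζ` as an element of `GL(V)`. -/
def scalarGL (V : Type*) [AddCommGroup V] [Module F V] (ζ : Fˣ) :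
    LinearMap.GeneralLinearGroup F V :=
  Units.map (algebraMap F (Module.End F V)).toMonoidHom ζ

theorem scalarGL_apply {V : Type*} [AddCommGroup V] [Module F V] (ζ : Fˣ) (x : V) :
    (scalarGL V ζ).1 x = (ζ : F) • x := rfl

theorem scalarGL_inv {V : Type*} [AddCommGroup V] [Module F V] (ζ : Fˣ) :
    (scalarGL V ζ)⁻¹ = scalarGL V ζ⁻¹ := (map_inv _ ζ).symm

theorem scalarGL_mul_comm {V : Type*} [AddCommGroup V] [Module F V] (ζ : Fˣ)
    (g : LinearMap.GeneralLinearGroup F V) : scalarGL V ζ * g = g * scalarGL V ζ :=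
  gl_ext fun x => (map_smul g.1 (ζ : F) x).symm

theorem actG_scalarGL_mul (ζ : Fˣ) (k : LinearMap.GeneralLinearGroup F V)
    (g : LinearMap.GeneralLinearGroup F (V × F)) :
    actG k (scalarGL _ ζ * g) = scalarGL _ ζ * actG k g := by
  rw [actG, actG, ← mul_assoc, ← scalarGL_mul_comm, mul_assoc, mul_assoc, mul_assoc]

theorem stabilizes_scalarGL_mul_iff {V : Type*} [AddCommGroup V] [Module F V] {ζ : Fˣ}
    (hζ : ‖(ζ : F)‖ = 1)
    {g : LinearMap.GeneralLinearGroup F V} {M : Submodule (integers F) V} :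
    Stabilizes (scalarGL V ζ * g) (M : Set V) ↔ Stabilizes g (M : Set V) := by
  have key : ∀ (ζ : Fˣ) (g : LinearMap.GeneralLinearGroup F V), ‖(ζ : F)‖ = 1 →
      Stabilizes g (M : Set V) → Stabilizes (scalarGL V ζ * g) (M : Set V) := by
    intro ζ g hζ H
    rw [stabilizes_iff] at H ⊢
    have hζ' : ‖((ζ⁻¹ : Fˣ) : F)‖ = 1 := by
      rw [Units.val_inv_eq_inv_val, norm_inv, hζ, inv_one]
    refine ⟨fun x hx => smul_mem_of_norm_le_one M hζ.le (H.1 x hx), fun x hx => ?_⟩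
    rw [mul_inv_rev, scalarGL_inv]
    exact H.2 _ (smul_mem_of_norm_le_one M hζ'.le hx)
  refine ⟨fun H => ?_, key ζ g hζ⟩
  have := key ζ⁻¹ _ (by rw [Units.val_inv_eq_inv_val, norm_inv, hζ, inv_one]) H
  rwa [← scalarGL_inv, inv_mul_cancel_left] at this

theorem IsRegSemisimple.scalarGL_mul (ζ : Fˣ) {K : Subgroup (LinearMap.GeneralLinearGroup F V)}
    {g : LinearMap.GeneralLinearGroup F (V × F)}
    (H : IsRegSemisimple (fun k : K => actG (k : LinearMap.GeneralLinearGroup F V)) g) :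
    IsRegSemisimple (fun k : K => actG (k : LinearMap.GeneralLinearGroup F V))
      (scalarGL _ ζ * g) := by
  refine IsRegSemisimple.of_map
    (aX := fun k : K => actG (k : LinearMap.GeneralLinearGroup F V))
    (aY := fun k : K => actG (k : LinearMap.GeneralLinearGroup F V)) isClosed_univ
    (fun _ _ _ => trivial) (f := fun g => scalarGL _ ζ⁻¹ * g.1)
    (continuous_const.mul continuous_subtype_val)
    (fun x y hxy => Subtype.ext (mul_left_cancel hxy))
    (fun k x => (actG_scalarGL_mul ζ⁻¹ k.1 x.1).symm) (x := ⟨scalarGL _ ζ * g, trivial⟩) ?_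
  change IsRegSemisimple _ (scalarGL _ ζ⁻¹ * (scalarGL _ ζ * g))
  rwa [← scalarGL_inv, inv_mul_cancel_left]

theorem scalarGL_mem_unitary {W : Type*} [AddCommGroup W] [Module F W] {h : SesqForm σ W}
    {ζ : Fˣ} (hζ : (ζ : F) * σ ζ = 1) : scalarGL W ζ ∈ unitary h := by
  intro x y
  rw [scalarGL_apply, scalarGL_apply, map_smul_right, smulLeft_apply, ← mul_assoc,
    mul_comm (σ _), hζ, one_mul]

theorem scalarGL_mul_mem_unitary_iff {W : Type*} [AddCommGroup W] [Module F W] {h : SesqForm σ W}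
    {ζ : Fˣ} (hζ : (ζ : F) * σ ζ = 1) {g : LinearMap.GeneralLinearGroup F W} :
    scalarGL W ζ * g ∈ unitary h ↔ g ∈ unitary h :=
  (unitary h).mul_mem_cancel_left (scalarGL_mem_unitary hζ)

theorem OrthBasis.scalarGL_mul_mem_S_iff {W : Type*} [AddCommGroup W] [Module F W]
    {h : SesqForm σ W} {n : ℕ} (C : OrthBasis h n) {ζ : Fˣ} (hζ : (ζ : F) * σ ζ = 1)
    {g : LinearMap.GeneralLinearGroup F W} : scalarGL W ζ * g ∈ C.S ↔ g ∈ C.S := by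
  refine forall_congr' fun x => ?_
  have : (scalarGL W ζ * g).1 (C.conj ((scalarGL W ζ * g).1 (C.conj x))) =
      g.1 (C.conj (g.1 (C.conj x))) := by
    rw [gl_mul_apply, gl_mul_apply, scalarGL_apply, scalarGL_apply, conj_smul, map_smul, smul_smul,
      hζ, one_smul]
  rw [this]

theorem norm_eq_one_of_mul_sigma {ζ : F} (hζ : ζ * σ ζ = 1) : ‖ζ‖ = 1 := by
  have := congrArg norm hζ
  rw [norm_mul, norm_sigma, norm_one] at this
  exact (mul_self_eq_one_iff.1 this).resolve_right (by linarith [norm_nonneg ζ])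

theorem inv_mul_sigma_inv {ζ : Fˣ} (hζ : (ζ : F) * σ ζ = 1) :
    ((ζ⁻¹ : Fˣ) : F) * σ ((ζ⁻¹ : Fˣ) : F) = 1 := by
  rw [Units.val_inv_eq_inv_val, map_inv₀, ← mul_inv, hζ, inv_one]

namespace OrthBasis

variable {n : ℕ} (B : OrthBasis h n) {a lam : F₀ˣ}

theorem transferFactor_scalarGL_mul {W : Type*} [AddCommGroup W] [Module F W]
    {h : SesqForm σ W} {n : ℕ} (C : OrthBasis h n) {ζ : Fˣ} (hζ : ‖(ζ : F)‖ = 1)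
    (g : LinearMap.GeneralLinearGroup F W) (u : W) :
    C.transferFactor (scalarGL W ζ * g) u = C.transferFactor g u := by
  have e : (fun i : Fin n => ((scalarGL W ζ * g) ^ (i : ℕ)).1 u) =
      fun i : Fin n => (ζ : F) ^ (i : ℕ) • (g ^ (i : ℕ)).1 u := by
    funext i
    have hc : Commute (scalarGL W ζ) g := scalarGL_mul_comm ζ g
    rw [hc.mul_pow, gl_mul_apply]
    have : scalarGL W ζ ^ (i : ℕ) = scalarGL W (ζ ^ (i : ℕ)) := (map_pow _ ζ _).symm
    rw [this, scalarGL_apply, Units.val_pow_eq_pow_val]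
  rw [transferFactor, transferFactor, e, AlternatingMap.map_smul_univ C.basis.det
    (fun i : Fin n => (ζ : F) ^ (i : ℕ)), smul_eq_mul, eta_mul_of_norm_eq_one]
  simp [hζ]

theorem groupOrbU_scalarGL_mul {ζ : Fˣ} (hζ : (ζ : F) * σ ζ = 1)
    (g : LinearMap.GeneralLinearGroup F (V × F)) :
    B.groupOrbU (B.groupFunU a lam) (scalarGL _ ζ * g) = B.groupOrbU (B.groupFunU a lam) g := by
  refine haarIntegral_congr_subgroup rfl (fun _ _ _ => Iff.rfl) fun k hk _ => ?_
  change B.groupFunU a lam (actG k (scalarGL _ ζ * g)) = B.groupFunU a lam (actG k g)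
  rw [actG_scalarGL_mul]
  exact indicator_one_congr (and_congr (scalarGL_mul_mem_unitary_iff hζ)
    (stabilizes_scalarGL_mul_iff (norm_eq_one_of_mul_sigma hζ)))

theorem groupOrbS_scalarGL_mul {ζ : Fˣ} (hζ : (ζ : F) * σ ζ = 1)
    (g : LinearMap.GeneralLinearGroup F (V × F)) :
    B.groupOrbS a lam (B.groupFunS a lam) (scalarGL _ ζ * g) =
      B.groupOrbS a lam (B.groupFunS a lam) g := by
  have hζ1 := norm_eq_one_of_mul_sigma hζ
  rw [groupOrbS, groupOrbS, transferFactor_scalarGL_mul _ hζ1]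
  congr 1
  refine haarIntegral_congr_subgroup rfl (fun _ _ _ => Iff.rfl) fun k hk _ => ?_
  change B.groupFunS a lam (actG k (scalarGL _ ζ * g)) * _ = B.groupFunS a lam (actG k g) * _
  rw [actG_scalarGL_mul]
  congr 1
  refine indicator_one_congr (and_congr ((B.sum a lam).scalarGL_mul_mem_S_iff hζ)
    (and_congr (stabilizes_scalarGL_mul_iff hζ1) ?_))
  rw [← dual_lattice]
  exact stabilizes_scalarGL_mul_iff hζ1

/-- A scalar with ζσ(ζ) = 1 is central, unitary, a unit, and preserves S(V₀). Supports, matching and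
regular semisimplicity are unchanged, and the determinant in the transfer factor only acquires a
power of ζ. -/
theorem GroupTransferAt.of_scalarGL_mul {ζ : Fˣ} (hζ : (ζ : F) * σ ζ = 1)
    {γ : LinearMap.GeneralLinearGroup F (V × F)}
    (H : B.GroupTransferAt a lam (scalarGL _ ζ * γ)) : B.GroupTransferAt a lam γ := by
  rw [GroupTransferAt, B.groupOrbS_scalarGL_mul hζ] at H
  refine ⟨fun g hg ⟨k, hk⟩ => ?_, fun hne => H.2 ?_⟩
  · rw [← B.groupOrbU_scalarGL_mul hζ g]
    exact H.1 _ ⟨(scalarGL_mul_mem_unitary_iff hζ).2 hg.1, hg.2.scalarGL_mul ζ⟩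
      ⟨k, by rw [actG_scalarGL_mul, hk]⟩
  · rintro ⟨g, hg, k, hk⟩
    refine hne ⟨scalarGL _ ζ⁻¹ * g, ⟨(scalarGL_mul_mem_unitary_iff (inv_mul_sigma_inv hζ)).2 hg.1,
      hg.2.scalarGL_mul ζ⁻¹⟩, k, ?_⟩
    rw [actG_scalarGL_mul, hk, ← scalarGL_inv, inv_mul_cancel_left]

end OrthBasis
end Scalars
end Transfer

/-! ### The reduction to the semi-Lie transfer conjecture -/

section Reduction

variable {F₀ F : Type*} [NontriviallyNormedField F₀] [IsUltrametricDist F₀]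
  [LocallyCompactSpace F₀] [NontriviallyNormedField F] [IsUltrametricDist F]
  [LocallyCompactSpace F] [NormedAlgebra F₀ F] [Algebra.IsQuadraticExtension F₀ F]
  {σ : F ≃ₐ[F₀] F} {V : Type*} [AddCommGroup V] [Module F V] [FiniteDimensional F V]
  {h : SesqForm σ V}

namespace OrthBasis

variable {n : ℕ} (B : OrthBasis h n) {a lam : F₀ˣ}

theorem semiLieTransferAt_of_notMem (C : OrthBasis h n)
    {y : LinearMap.GeneralLinearGroup F V × V × Module.Dual F V}
    (hS : ∀ k ∈ C.GL₀, actS k y ∉ C.SStab ×ˢ (C.L₀ ×ˢ C.L₀DualStar))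
    (hU : ∀ x, Matches h x y → ∀ k ∈ unitary h,
      actU k x ∉ unitaryStab h C.lattice ×ˢ (C.lattice : Set V)) : C.SemiLieTransferAt y := by
  have h1 : C.orbS C.semiLieFunS y = 0 := by
    rw [orbS, haarIntegral_eq_zero, mul_zero]
    intro k
    rw [semiLieFunS, Set.indicator_of_notMem (hS k.1 k.2), zero_mul]
  refine ⟨fun x _ hxy => ?_, fun _ => h1⟩
  rw [h1, orbU, haarIntegral_eq_zero]
  intro k
  exact Set.indicator_of_notMem (hU x hxy k.1 k.2) _

/-- The hypothesis ranges over all of GL(V^♭), so it also applies to the conjugates of any matching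
unitary element, and every orbital integral vanishes. -/
theorem groupTransferAt_of_not_stabilizes {γ : LinearMap.GeneralLinearGroup F (V × F)}
    (H : ∀ k : LinearMap.GeneralLinearGroup F V,
      ¬ Stabilizes (actG k γ) ((B.sum a lam).lattice : Set (V × F))) :
    B.GroupTransferAt a lam γ := by
  have h1 : B.groupOrbS a lam (B.groupFunS a lam) γ = 0 := by
    rw [groupOrbS, haarIntegral_eq_zero, mul_zero]
    intro k
    rw [groupFunS, Set.indicator_of_notMem fun hk => H k.1 hk.2.1, zero_mul]
  refine ⟨fun g _ ⟨m, hm⟩ => ?_, fun _ => h1⟩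
  rw [h1, groupOrbU, haarIntegral_eq_zero]
  intro k
  refine Set.indicator_of_notMem (fun hk => H (m⁻¹ * k.1) ?_) _
  rw [← actG_actG, ← hm, actG_actG m⁻¹, mul_inv_cancel, actG_one]
  exact hk.2

theorem inv_conj_apply_mem {M : Submodule (integers F) V}
    {g k : LinearMap.GeneralLinearGroup F V} (hk : Stabilizes (k⁻¹ * g * k) (M : Set V)) :
    ∀ x ∈ M, (k⁻¹ * g⁻¹ * k).1 x ∈ M := by
  have e : k⁻¹ * g⁻¹ * k = (k⁻¹ * g * k)⁻¹ := by group
  rw [e]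
  exact (stabilizes_iff.1 hk).2

/-- Hilbert's theorem 90 for an element of `S(V₀)` with an invariant lattice. -/
theorem exists_aeval_eq_mul_bar_of_stabilizes (hunr : IsUnramified F₀ F)
    (hσ : σ ≠ AlgEquiv.refl) (C : OrthBasis h n) {g k : LinearMap.GeneralLinearGroup F V}
    (hg : g ∈ B.S) (hk : Stabilizes (k⁻¹ * g * k) (C.lattice : Set V)) :
    ∃ P Q : Polynomial (integers F), Polynomial.aeval g.1 P * Polynomial.aeval g.1 Q = 1 ∧
      g.1 * B.bar (Polynomial.aeval g.1 P) = Polynomial.aeval g.1 P := by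
  obtain ⟨θ, hθ, hθ1⟩ := exists_norm_sub_sigma_eq_one σ hunr hσ
  exact B.exists_aeval_eq_mul_bar hg (C.isIntegral_of_stabilizes (stabilizes_iff.1 hk).1)
    (C.isIntegral_of_stabilizes (inv_conj_apply_mem hk)) hθ hθ1

theorem semiLieTransferAt_of_groupTC (hunr : IsUnramified F₀ F) (hσ : σ ≠ AlgEquiv.refl)
    (hh : IsHermitian h)
    (hred : ∀ x ∈ (B.smul lam⁻¹).lattice, ∀ y ∈ (B.smul lam⁻¹).lattice,
      ‖h x y‖ ≤ ‖algebraMap F₀ F a‖) (H : B.GroupTC a lam)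
    {y : LinearMap.GeneralLinearGroup F V × V × Module.Dual F V}
    (hy : y ∈ (B.smul lam⁻¹).symmetricRS) {k : LinearMap.GeneralLinearGroup F V}
    (hk : Stabilizes (k⁻¹ * y.1 * k) ((B.smul lam⁻¹).lattice : Set V))
    (hu : ‖(algebraMap F₀ F a)⁻¹ * y.2.2 y.2.1‖ ≤ 1) : (B.smul lam⁻¹).SemiLieTransferAt y := by
  have hc := B.smul_conj lam⁻¹
  have h1 : y.1 ∈ B.S := by rw [← S_eq_of_conj_eq hc]; exact hy.1
  have h2 : y.2.1 ∈ B.V₀ := by rw [← V₀_eq_of_conj_eq hc]; exact hy.2.1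
  have h3 : y.2.2 ∈ B.V₀Dual := by rw [← V₀Dual_eq_of_conj_eq hc]; exact hy.2.2.1
  obtain ⟨P, Q, hPQ, hP⟩ := B.exists_aeval_eq_mul_bar_of_stabilizes hunr hσ _ h1 hk
  have hl : σ (y.2.2 y.2.1) = y.2.2 y.2.1 := by
    rw [← h3 y.2.1, show B.conj y.2.1 = y.2.1 from h2]
  -- The trace condition is the constraint defining the domain of ψ; the twist does not change l(u),
  -- because Q(y₁)P(y₁) = 1.
  obtain ⟨τ, hτ1, hτt⟩ := exists_norm_eq_one_add_sigma_eq σ hunr hσ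
    (norm_add_le_of_le norm_one.le hu)
    (by rw [map_add, map_one, map_mul, map_inv₀, AlgEquiv.commutes, hl])
  have hτ : τ ≠ 0 := by rw [← norm_pos_iff, hτ1]; exact one_pos
  have hτ' : σ τ ≠ 0 := by simpa using hτ
  have ht : polyTwist P Q y ∈ tripleSet V (algebraMap F₀ F a) τ (σ τ) := by
    have e : Polynomial.aeval y.1.1 Q (Polynomial.aeval y.1.1 P y.2.1) = y.2.1 :=
      LinearMap.congr_fun ((aeval_mul_comm y.1.1 Q P).trans hPQ) _
    change τ + σ τ = 1 + (algebraMap F₀ F a)⁻¹ *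
      y.2.2 (Polynomial.aeval y.1.1 Q (Polynomial.aeval y.1.1 P y.2.1))
    rw [e, hτt]
  have hS := (B.psi_mem_S_iff lam hτ hτ' ⟨_, ht⟩).2 (B.polyTwist_mem_twistedS hPQ hP h1 h2 h3)
  exact (B.groupTransferAt_psi_iff hh hred hτ hτ' hτ1 hPQ ht hS h1 h2 h3 (stabilizes_iff.1 hk).1).1
    (H _ ((B.psi_polyTwist_mem_symmetricGroupRS_iff hτ hτ' hPQ ht hS h1 h2 h3).2 hy))

theorem semiLieTC_of_groupTC (hunr : IsUnramified F₀ F) (hσ : σ ≠ AlgEquiv.refl)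
    (hh : IsHermitian h)
    (hred : ∀ x ∈ (B.smul lam⁻¹).lattice, ∀ y ∈ (B.smul lam⁻¹).lattice,
      ‖h x y‖ ≤ ‖algebraMap F₀ F a‖) (H : B.GroupTC a lam) : (B.smul lam⁻¹).SemiLieTC := by
  intro y hy
  by_cases hex : (∃ k : LinearMap.GeneralLinearGroup F V,
      Stabilizes (k⁻¹ * y.1 * k) ((B.smul lam⁻¹).lattice : Set V)) ∧
      ‖(algebraMap F₀ F a)⁻¹ * y.2.2 y.2.1‖ ≤ 1
  · obtain ⟨⟨k, hk⟩, hu⟩ := hex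
    exact B.semiLieTransferAt_of_groupTC hunr hσ hh hred H hy hk hu
  -- A point of either support in the orbit would give a stable lattice and, as a⁻¹u ∈ M^∨ by the
  -- reduction, integrality of l(u)/a. Outside this case both sides vanish.
  · refine (B.smul lam⁻¹).semiLieTransferAt_of_notMem (fun k hk hmem => hex ⟨⟨k, hmem.1.2.1⟩, ?_⟩)
      fun x hxy k hk hmem => hex ?_
    · have h1 := ((B.smul lam⁻¹).mem_L₀DualStar_iff hh hmem.2.2.1).1 hmem.2.2 _
        ((B.smul lam⁻¹).inv_smul_mem_dual hred hmem.2.1.1)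
      rw [map_smul] at h1
      change ‖_ * y.2.2 (k.1 (k⁻¹.1 y.2.1))‖ ≤ 1 at h1
      rwa [gl_apply_inv_apply] at h1
    · obtain ⟨m, rfl⟩ := matches_iff.1 hxy
      refine ⟨⟨m⁻¹ * k, ?_⟩, ?_⟩
      · change Stabilizes (actS (m⁻¹ * k) (actS m (unitaryTriple h x))).1 _
        rw [actS_actS, mul_inv_cancel_left]
        exact hmem.1.2
      · change ‖_ * h (m.1 (m⁻¹.1 x.2)) x.2‖ ≤ 1
        rw [gl_apply_inv_apply, norm_mul, norm_inv,
          ← (unitary h).inv_mem hk x.2 x.2]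
        exact inv_mul_le_one_of_le₀ (hred _ hmem.2 _ hmem.2) (norm_nonneg _)

theorem groupTC_of_semiLieTC (hunr : IsUnramified F₀ F) (hσ : σ ≠ AlgEquiv.refl)
    (hh : IsHermitian h)
    (hred : ∀ x ∈ (B.smul lam⁻¹).lattice, ∀ y ∈ (B.smul lam⁻¹).lattice,
      ‖h x y‖ ≤ ‖algebraMap F₀ F a‖) (H : (B.smul lam⁻¹).SemiLieTC) : B.GroupTC a lam := by
  intro γ hγ
  by_cases hex : ∃ k : LinearMap.GeneralLinearGroup F V,
    Stabilizes (actG k γ) ((B.sum a lam).lattice : Set (V × F))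
  swap
  · exact B.groupTransferAt_of_not_stabilizes fun k hk => hex ⟨k, hk⟩
  obtain ⟨k, hk⟩ := hex
  have ha := algebraMap_unit_ne_zero (F := F) a
  have hd : ‖(γ.1 (0, 1)).2‖ ≤ 1 := by
    have h1 := (stabilizes_iff.1 ((B.stabilizes_sum_lattice a lam).1 hk)).1 (0, 1)
      ⟨Submodule.zero_mem _, by simp⟩
    have h2 := h1.2
    rwa [actG_apply_e_snd, one_mul] at h2
  -- The e-coefficient d is integral, being invariant under GL(V^♭)-conjugation; after multiplying γ
  -- by this scalar, τ = (1 - d)⁻¹ is a unit.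
  obtain ⟨z, hz, hz1, hzd⟩ := exists_unitary_norm_one_sub_mul σ hunr hσ hd
  have hz0 : z ≠ 0 := by rw [← norm_pos_iff, hz1]; exact one_pos
  let ζ : Fˣ := Units.mk0 z hz0
  have hζ : (ζ : F) * σ ζ = 1 := hz
  refine GroupTransferAt.of_scalarGL_mul B hζ ?_
  obtain ⟨γ, rfl⟩ : ∃ γ', γ = scalarGL _ ζ⁻¹ * γ' := ⟨scalarGL _ ζ * γ, by
    rw [← scalarGL_inv, inv_mul_cancel_left]⟩
  have hcancel : scalarGL (V × F) ζ * (scalarGL _ ζ⁻¹ * γ) = γ := by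
    rw [← scalarGL_inv, mul_inv_cancel_left]
  have hγS : γ ∈ (B.sum a lam).S := ((B.sum a lam).scalarGL_mul_mem_S_iff
    (inv_mul_sigma_inv hζ)).1 hγ.1
  have hγR := hγ.2.scalarGL_mul ζ
  rw [hcancel] at hγR ⊢
  rw [actG_scalarGL_mul, stabilizes_scalarGL_mul_iff
    (norm_eq_one_of_mul_sigma (inv_mul_sigma_inv hζ)), stabilizes_sum_lattice] at hk
  have e1 : z * ((scalarGL (V × F) ζ⁻¹ * γ).1 (0, 1)).2 = (γ.1 (0, 1)).2 := by
    rw [gl_mul_apply, scalarGL_apply, Prod.smul_snd, smul_eq_mul, Units.val_inv_eq_inv_val,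
      Units.val_mk0, mul_inv_cancel_left₀ hz0]
  rw [e1] at hzd
  have h0 : 1 - (γ.1 (0, 1)).2 ≠ 0 := by rw [← norm_pos_iff, hzd]; exact one_pos
  obtain ⟨τ, hτd⟩ : ∃ τ : F, τ⁻¹ = 1 - (γ.1 (0, 1)).2 := ⟨_, inv_inv _⟩
  have hτ : τ ≠ 0 := by rintro rfl; rw [inv_zero] at hτd; exact h0 hτd.symm
  have hτ' : σ τ ≠ 0 := by simpa using hτ
  have hτ1 : ‖τ‖ = 1 := by rw [← inv_inj, ← norm_inv, hτd, hzd, inv_one]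
  have hτ1' : ‖σ τ‖ = 1 := (norm_sigma σ τ).trans hτ1
  -- The second coefficient is governed by σ(τ) because γ⁻¹ = γ̄.
  have hmem : γ ∈ glSet V τ (σ τ) := by
    refine ⟨by rw [hτd, sub_sub_cancel], ?_⟩
    rw [← (B.sum a lam).mem_S_iff'.1 hγS, bar_apply, sum_conj, sum_conj, conj_zero, map_one,
      ← map_inv₀, hτd, map_sub, map_one, sub_sub_cancel]
  obtain ⟨t, rfl⟩ : ∃ t : tripleSet V (algebraMap F₀ F a) τ (σ τ), psi hτ hτ' t = γ :=
    ⟨_, psi_phi hτ hτ' ha ⟨γ, hmem⟩⟩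
  have htS := (B.psi_mem_S_iff lam hτ hτ' t).1 hγS
  rw [actG_psi] at hk
  have hk' := (stabilizes_of_psi_stabilizes hτ hτ' hτ1 hτ1' one_ne_zero _ hk).1
  obtain ⟨P, Q, hPQ, hP⟩ := B.exists_aeval_eq_mul_bar_of_stabilizes hunr hσ _ htS.1 hk'
  obtain ⟨h2, h3⟩ := B.polyTwist_mem_of_mem_twistedS hPQ hP htS
  have hQP : t.1 ∈ twistSet V Q P := (aeval_mul_comm _ _ _).trans hPQ
  have hy : polyTwist Q P t.1 ∈ twistSet V P Q := hPQ
  have et : polyTwist P Q (polyTwist Q P t.1) = t.1 := polyTwist_polyTwist hQP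
  have ht : polyTwist P Q (polyTwist Q P t.1) ∈ tripleSet V (algebraMap F₀ F a) τ (σ τ) := by
    rw [et]; exact t.2
  have et' : t = ⟨_, ht⟩ := Subtype.ext et.symm
  rw [et'] at hγS hγR ⊢
  exact (B.groupTransferAt_psi_iff hh hred hτ hτ' hτ1 hy ht hγS htS.1 h2 h3
    (stabilizes_iff.1 hk').1).2 (H _ ((B.psi_polyTwist_mem_symmetricGroupRS_iff hτ hτ' hy ht hγS
      htS.1 h2 h3).1 ⟨hγS, hγR⟩))

theorem groupTC_iff_semiLieTC (hunr : IsUnramified F₀ F) (hσ : σ ≠ AlgEquiv.refl)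
    (hh : IsHermitian h) (a lam : F₀ˣ) (H : SatisfiesReduction (orthSum h a)
      ((B.sum a lam).lattice : Set (V × F)) (0, algebraMap F₀ F lam)) :
    B.GroupTC a lam ↔ (B.smul lam⁻¹).SemiLieTC := by
  have hred : ∀ x ∈ (B.smul lam⁻¹).lattice, ∀ y ∈ (B.smul lam⁻¹).lattice,
      ‖h x y‖ ≤ ‖algebraMap F₀ F a‖ := fun x hx y hy => B.norm_le_of_satisfiesReduction a lam H hx hy
  exact ⟨B.semiLieTC_of_groupTC hunr hσ hh hred, B.groupTC_of_semiLieTC hunr hσ hh hred⟩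

end OrthBasis
end Reduction

/-! ### Duality -/

section Duality

theorem eta_inv {K : Type*} [NontriviallyNormedField K] [IsUltrametricDist K]
    [LocallyCompactSpace K] (x : K) : eta x⁻¹ = eta x := by
  by_cases hx : x = 0
  · rw [hx, inv_zero]
  · have h1 := eta_mul_self hx
    have h2 : eta x⁻¹ * eta x = 1 := by rw [← eta_mul, inv_mul_cancel₀ hx, eta_one]
    have h3 : eta x ≠ 0 := left_ne_zero_of_mul_eq_one h1
    exact mul_right_cancel₀ h3 (h2.trans h1.symm)

variable {F₀ F : Type*} [NontriviallyNormedField F₀] [IsUltrametricDist F₀]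
  [LocallyCompactSpace F₀] [NontriviallyNormedField F] [IsUltrametricDist F]
  [LocallyCompactSpace F] [NormedAlgebra F₀ F] [Algebra.IsQuadraticExtension F₀ F]
  {σ : F ≃ₐ[F₀] F} {V : Type*} [AddCommGroup V] [Module F V]
  {h : SesqForm σ V}

theorem isHermitian_orthSum (hh : IsHermitian h) (a : F₀ˣ) : IsHermitian (orthSum h a) := by
  intro x y
  rw [orthSum_apply, orthSum_apply, map_add, map_mul, map_mul, AlgEquiv.commutes, sigma_sigma,
    hh x.1 y.1]
  ring

namespace OrthBasis

variable {n : ℕ} (C : OrthBasis h n)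

theorem eq_of_basis_eq {C C' : OrthBasis h n} (H : ∀ i, C.basis i = C'.basis i) : C = C' := by
  obtain ⟨b, _, _⟩ := C
  obtain ⟨b', _, _⟩ := C'
  obtain rfl : b = b' := Module.Basis.eq_of_apply_eq H
  rfl

theorem mem_unitaryStab_dual_iff (hh : IsHermitian h) {g : LinearMap.GeneralLinearGroup F V} :
    g ∈ unitaryStab h C.dual.lattice ↔ g ∈ unitaryStab h C.lattice := by
  refine and_congr_right fun hg => ⟨fun H => ?_, fun H => ?_⟩
  · rw [← C.dualLattice_dual hh]
    exact stabilizes_dualLattice hg H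
  · rw [dual_lattice]
    exact stabilizes_dualLattice hg H

theorem SStab_dual (hh : IsHermitian h) : C.dual.SStab = C.SStab := by
  rw [SStab, SStab, S_eq_of_conj_eq (C.dual_conj hh), C.dualLattice_dual hh, C.dual_lattice]
  exact Set.ext fun _ => and_congr_right fun _ => and_comm

theorem mem_GL₀Stab_dual_iff (hh : IsHermitian h) {g : LinearMap.GeneralLinearGroup F V}
    (hg : g ∈ C.dual.GL₀) (hg' : g ∈ C.GL₀) :
    (⟨g, hg⟩ : C.dual.GL₀) ∈ C.dual.GL₀Stab ↔ (⟨g, hg'⟩ : C.GL₀) ∈ C.GL₀Stab := by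
  change Stabilizes g C.dual.L₀ ∧ Stabilizes g C.dual.L₀Dual ↔
    Stabilizes g C.L₀ ∧ Stabilizes g C.L₀Dual
  rw [L₀, L₀Dual, L₀, L₀Dual, V₀_eq_of_conj_eq (C.dual_conj hh), C.dualLattice_dual hh,
    C.dual_lattice]
  exact and_comm

theorem dual_basis_det (v : Fin n → V) :
    C.dual.basis.det v = (∏ i, h (C.basis i) (C.basis i)) * C.basis.det v := by
  have h1 : C.basis.det C.dual.basis = ∏ i, (h (C.basis i) (C.basis i))⁻¹ := by
    rw [funext C.dual_basis, AlternatingMap.map_smul_univ C.basis.det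
      (fun i => (h (C.basis i) (C.basis i))⁻¹), C.basis.det_self, smul_eq_mul, mul_one]
  have h3 : C.basis.det v = C.basis.det C.dual.basis * C.dual.basis.det v :=
    congrArg (· v) (C.basis.det.eq_smul_basis_det C.dual.basis)
  rw [h3, h1, ← mul_assoc, ← Finset.prod_mul_distrib, Finset.prod_eq_one, one_mul]
  exact fun i _ => mul_inv_cancel₀ (C.length_ne_zero i)

variable (B : OrthBasis h n) (a lam : F₀ˣ)

/-- Since (e_L, e_L) = aλ², the last dual vector is λe/(aλ²) = (aλ)⁻¹e. -/
theorem dual_sum_eq : B.dual.sum a (a * lam)⁻¹ = (B.sum a lam).dual := by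
  refine eq_of_basis_eq fun i => ?_
  rw [dual_basis]
  refine Fin.lastCases ?_ (fun i => ?_) i
  · rw [sum_basis_last, sum_basis_last, orthSum_apply]
    refine Prod.ext (by simp) ?_
    simp only [map_zero, zero_add, AlgEquiv.commutes, Prod.smul_snd, smul_eq_mul,
      Units.val_inv_eq_inv_val, Units.val_mul, map_inv₀, map_mul]
    have := algebraMap_unit_ne_zero (F := F) lam
    have := algebraMap_unit_ne_zero (F := F) a
    field_simp
  · rw [sum_basis_castSucc, sum_basis_castSucc, orthSum_apply, dual_basis]
    simp

theorem symmetricGroupRS_dual [FiniteDimensional F V] (hh : IsHermitian h) :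
    B.dual.symmetricGroupRS a (a * lam)⁻¹ = B.symmetricGroupRS a lam := by
  ext γ
  refine and_congr ?_ (isRegSemisimple_congr_subgroup (GL₀_eq_of_conj_eq (B.dual_conj hh)) _ _)
  rw [dual_sum_eq, S_eq_of_conj_eq ((B.sum a lam).dual_conj (isHermitian_orthSum hh a))]

/-- The dual basis multiplies the determinant by ∏(eᵢ, eᵢ)·aλ², and replacing e_L by e_L/(aλ²)
scales all n + 1 vectors. This leaves η(∏(eᵢ, eᵢ))·η(aλ²)^(n+2), while `dualSign` has exponent n;
the difference is a square. -/
theorem transferFactor_dual (γ : LinearMap.GeneralLinearGroup F (V × F)) :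
    (B.dual.sum a (a * lam)⁻¹).transferFactor γ (0, algebraMap F₀ F ((a * lam)⁻¹ : F₀ˣ)) =
      (B.sum a lam).transferFactor γ (0, algebraMap F₀ F lam) * B.dualSign a lam := by
  have hs := algebraMap_unit_ne_zero (F := F) (a * lam ^ 2)
  have hl := algebraMap_unit_ne_zero (F := F) lam
  have ha := algebraMap_unit_ne_zero (F := F) a
  have e1 : ((0, algebraMap F₀ F ((a * lam)⁻¹ : F₀ˣ)) : V × F) =
      (algebraMap F₀ F (a * lam ^ 2 : F₀ˣ))⁻¹ • (0, algebraMap F₀ F lam) := by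
    refine Prod.ext (by simp) ?_
    simp only [Prod.smul_snd, smul_eq_mul, Units.val_inv_eq_inv_val, Units.val_mul, map_inv₀,
      map_mul, Units.val_pow_eq_pow_val, map_pow]
    field_simp
  have e2 : ∏ i, orthSum h a ((B.sum a lam).basis i) ((B.sum a lam).basis i) =
      (∏ i, h (B.basis i) (B.basis i)) * algebraMap F₀ F (a * lam ^ 2 : F₀ˣ) := by
    rw [Fin.prod_univ_castSucc, sum_basis_last]
    simp only [sum_basis_castSucc, orthSum_apply]
    simp only [map_zero, mul_zero, add_zero, zero_add, AlgEquiv.commutes, Units.val_mul, map_mul,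
      Units.val_pow_eq_pow_val, map_pow]
    ring
  have e3 := eta_mul_self hs
  rw [transferFactor, transferFactor, e1, dual_sum_eq]
  simp only [map_smul]
  rw [AlternatingMap.map_smul_univ (B.sum a lam).dual.basis.det
    (fun _ => (algebraMap F₀ F (a * lam ^ 2 : F₀ˣ))⁻¹), dual_basis_det, e2, smul_eq_mul,
    Finset.prod_const, Finset.card_univ, Fintype.card_fin, dualSign, Finset.prod_mul_distrib,
    Finset.prod_const, Finset.card_univ, Fintype.card_fin]
  simp only [eta_mul, eta_pow, eta_inv]
  rw [pow_succ]
  linear_combination (eta (algebraMap F₀ F (a * lam ^ 2 : F₀ˣ)) ^ n *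
    eta (∏ i, h (B.basis i) (B.basis i)) * eta ((B.sum a lam).basis.det fun i : Fin (n + 1) =>
      (γ ^ (i : ℕ)).1 (0, algebraMap F₀ F lam))) * e3

variable [FiniteDimensional F V]

theorem groupOrbU_dual (hh : IsHermitian h) (g : LinearMap.GeneralLinearGroup F (V × F)) :
    B.dual.groupOrbU (B.dual.groupFunU a (a * lam)⁻¹) g = B.groupOrbU (B.groupFunU a lam) g := by
  refine haarIntegral_congr_subgroup rfl (fun k _ _ => B.mem_unitaryStab_dual_iff hh)
    fun k _ _ => indicator_one_congr ?_
  rw [dual_sum_eq]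
  exact (B.sum a lam).mem_unitaryStab_dual_iff (isHermitian_orthSum hh a)

theorem groupOrbS_dual (hh : IsHermitian h) (γ : LinearMap.GeneralLinearGroup F (V × F)) :
    B.dual.groupOrbS a (a * lam)⁻¹ (B.dual.groupFunS a (a * lam)⁻¹) γ =
      B.groupOrbS a lam (fun γ => B.dualSign a lam * B.groupFunS a lam γ) γ := by
  rw [groupOrbS, groupOrbS, transferFactor_dual, mul_assoc, ← haarIntegral_const_mul]
  congr 1
  refine haarIntegral_congr_subgroup (GL₀_eq_of_conj_eq (B.dual_conj hh))
    (fun k hk hk' => B.mem_GL₀Stab_dual_iff hh hk hk') fun k _ _ => ?_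
  change _ * (B.dual.groupFunS a (a * lam)⁻¹ (actG k γ) * _) = _ * B.groupFunS a lam (actG k γ) * _
  rw [groupFunS, groupFunS, dual_sum_eq, SStab_dual _ (isHermitian_orthSum hh a), mul_assoc]

/-- Passing to L^∨ merely interchanges the two lattices in the definitions, as the bidual of L is L.
What remains is the sign of the transfer factor, which is absorbed into the test function. -/
theorem groupTC_dual_iff (hh : IsHermitian h) :
    B.dual.GroupTC a (a * lam)⁻¹ ↔ B.IsGroupTransfer a lam (B.groupFunU a lam)
      (fun γ => B.dualSign a lam * B.groupFunS a lam γ) := by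
  rw [GroupTC, IsGroupTransfer, IsGroupTransfer, B.symmetricGroupRS_dual a lam hh]
  simp only [B.groupOrbS_dual a lam hh, B.groupOrbU_dual a lam hh]

end OrthBasis
end Duality
end JacquetRallis

/-! ### The two equivalences, for L and for its dual -/

theorem mainTheorem4
    {F₀ F : Type*} [NontriviallyNormedField F₀] [IsUltrametricDist F₀] [LocallyCompactSpace F₀]
    [CharZero F₀] [NontriviallyNormedField F] [IsUltrametricDist F] [LocallyCompactSpace F]
    [NormedAlgebra F₀ F] [Algebra.IsQuadraticExtension F₀ F]
    (hunr : JacquetRallis.IsUnramified F₀ F)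
    (σ : F ≃ₐ[F₀] F) (hσ : σ ≠ AlgEquiv.refl)
    {Vb : Type*} [AddCommGroup Vb] [Module F Vb] [FiniteDimensional F Vb]
    (h : JacquetRallis.SesqForm σ Vb) (hh : JacquetRallis.IsHermitian h)
    {n : ℕ} (B : JacquetRallis.OrthBasis h n) (a lam : F₀ˣ) :
    (JacquetRallis.SatisfiesReduction (JacquetRallis.orthSum h a)
        ((B.sum a lam).lattice : Set (Vb × F)) (0, algebraMap F₀ F lam) →
      (B.GroupTC a lam ↔ (B.smul lam⁻¹).SemiLieTC)) ∧
    (JacquetRallis.SatisfiesReduction (JacquetRallis.orthSum h a)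
        (JacquetRallis.dualLattice (JacquetRallis.orthSum h a) (B.sum a lam).lattice)
        (0, algebraMap F₀ F ((a * lam)⁻¹ : F₀ˣ)) →
      (B.dual.GroupTC a (a * lam)⁻¹ ↔ (B.dual.smul (a * lam)).SemiLieTC) ∧
      (B.IsGroupTransfer a lam (B.groupFunU a lam)
          (fun γ => B.dualSign a lam * B.groupFunS a lam γ) ↔
        (B.dual.smul (a * lam)).SemiLieTC) ∧
      (B.dualSign a lam = 1 →
        (B.GroupTC a lam ↔ (B.dual.smul (a * lam)).SemiLieTC))) := by
  refine ⟨B.groupTC_iff_semiLieTC hunr hσ hh a lam, fun H => ?_⟩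
  -- This presents L^∨ as the lattice of the orthogonal sum built from the dual basis and (aλ)⁻¹, so
  -- that the first part applies to it.
  rw [← (B.sum a lam).dual_lattice, ← B.dual_sum_eq] at H
  have h1 := B.dual.groupTC_iff_semiLieTC hunr hσ hh a _ H
  rw [inv_inv] at h1
  have h2 := (B.groupTC_dual_iff a lam hh).symm.trans h1
  refine ⟨h1, h2, fun hs => ?_⟩
  rw [← h2, hs]
  simp only [one_mul]
  rfl
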